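/- **Setting.** Write $\mathfrak t(\mathbb F_2)=\mathbb F_2^n$, paired with $\mathbb Z^n$ by $(a,v)\mapsto\sum_i a_iv_i \bmod 2$, and let $\mathcal P^n_d=\{x\in\mathbb R^n: x_i\ge 0,\ \sum_i x_i\le d\}$, the convex hull of $de_0,\dots,de_n$ with $e_0=0$. A *primitive triangulation* of a lattice polytope $P\subset\mathbb R^n$ is a triangulation of $P$ into lattice simplices all of whose $n$-simplices have volume $1/n!$. **Itenberg–Viro triangulations.** If $K$ triangulates $\mathcal P^{n+1}_d$ and $L$ triangulates $\mathcal P^n_{d+1}$, let $K+(-1)^\eta L$ be the triangulation of $\mathcal P^{n+1}_{d+1}$ consisting of $K+e_{n+1}$ and, for $0\le i\le n$, of the joins of $K|_{[de_0,\dots,de_i]}+e_{n+1}$ with $L|_{[(d+1)e_i,\dots,(d+1)e_n]}$ if $\eta$ is even, and of $K|_{[de_i,\dots,de_n]}+e_{n+1}$ with $L|_{[(d+1)e_0,\dots,(d+1)e_i]}$ if $\eta$ is odd. Then $IV^1_d$ is the unique primitive triangulation of $\mathcal P^1_d$, $IV^n_1=\mathcal P^n_1$, and $IV^{n+1}_{d+1}=IV^{n+1}_d+(-1)^dIV^n_{d+1}$.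 **The equation.** Let $K$ be a primitive triangulation of $P$ and $n\ge2$. $\partial K$ is the subcomplex generated by the $(n-1)$-simplices lying in exactly one $n$-simplex; $\mathcal B_0K$ is the set of simplices with all vertices in $\partial K$; $\mathcal B_1K$ is the subcomplex generated by the simplices $\tau$ such that every vertex $v$ of $\tau$ is in $\partial K$ or satisfies $\mathrm{lk}(v;\tau)=\tau\setminus\{v\}\subset\partial K$. The simplices of $\mathcal B_1K\setminus\mathcal B_0K$ of dimension $n-1$ have a single vertex $\mathrm{ap}(\tau)$ not in $\partial K$. The normal cosheaf is $N(\sigma)=(T\sigma)^\perp(\mathbb F_2)\subset\mathfrak t(\mathbb F_2)$ and the cotangent cosheaf is $T^*=\mathfrak t(\mathbb F_2)/N$. For $\varepsilon\in C^0(K;\mathbb F_2)$, $\mathrm D\varepsilon\in H_n(K;\partial K;T^*)$ has as value on an $n$-simplex $\sigma$ the unique vector $v$ such that $(b-a)(v)=\varepsilon(b)-\varepsilon(a)$ for all vertices $a,b$ of $\sigma$, and $\mathrm D^2\varepsilon\in H_{n-1}(K;\partial K;N)$ is its image under the connecting morphism of $0\to N\to\mathfrak t(\mathbb F_2)\to T^*\to0$.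 For a vertex $\alpha$ of an $n$-simplex $\sigma$, $e_\sigma(\alpha)$ is the nonzero vector of the line $N(\sigma\setminus\{\alpha\})$. For an interior $(n-1)$-simplex $\tau$, bounding the $n$-simplices $\sigma_\pm$, and a vertex $\alpha$ of $\tau$, $\rho_\tau(\alpha)=e_{\sigma_+}(\alpha)-e_{\sigma_-}(\alpha)$. Let $I(\tau)$ be the set of vertices $\alpha$ of $\tau$ with $\alpha\notin\partial K$ and $\tau\setminus\{\alpha\}\not\subset\partial K$. $K$ is *$\rho$-uniform* if $\rho_\tau$ is constant on $I(\tau)$ for all interior $(n-1)$-simplices $\tau$. In that case $\rho\in C_{n-1}(K;\mathcal B_0K;N)$ is the chain with value $\rho_\tau(\alpha)$, for any $\alpha\in I(\tau)$, on $\tau\notin\mathcal B_1K$, and $\rho_\tau(\mathrm{ap}(\tau))$ on $\tau\in\mathcal B_1K\setminus\mathcal B_0K$; when this chain is a cycle, $\rho$ also denotes its class in $H_{n-1}(K;\mathcal B_0K;N)$. $K$ is *simply integrable* if it is $\rho$-uniform and the equation $$\mathrm D^2\varepsilon=\rho\quad\text{in } H_{n-1}(K;\mathcal B_0K;N)\tag{$*$}$$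 (which includes that $\rho$ is a cycle) has a solution $\varepsilon\in C^0(K;\mathbb F_2)$. **T-hypersurfaces.** For $x\in P$, $\mathrm{Sed}(x)\subset\mathfrak t(\mathbb F_2)$ is the annihilator of $TQ\cap\mathbb Z^n$, where $Q$ is the face of $P$ containing $x$ in its relative interior. The real locus $\mathbb RP$ of the toric variety of $P$ is the quotient of $P\times\mathfrak t(\mathbb F_2)$ identifying $(x,v)$ with $(x,w)$ when $v-w\in\mathrm{Sed}(x)$; for $P=\mathcal P^n_d$ it is the real projective space, and its $n+1$ toric divisors are the preimages of the facets of $\mathcal P^n_d$. $K$ lifts to a subdivision $\mathbb RK$ of $\mathbb RP$. The T-hypersurface $\mathbb RX_\varepsilon\subset\mathbb RP$ is the union of the closed cells $[\sigma;\sigma']$ ($\sigma\le\sigma'$) of the cubical subdivision of $\mathbb RK$ such that $\sigma$ has an edge, lying in the quadrant $v$ over an edge $\{a,b\}$ of $K$, with $\varepsilon(a)+\varepsilon(b)+(b-a)(v)=1$. Let $h^{n-1,0}$ be the number of lattice points in the interior of $P$. **Theorem.** For all $n\ge2$ and $d\ge1$, $IV^n_d$ is a primitive triangulation of $\mathcal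 P^n_d$ and it is simply integrable. More precisely, the Harnack distribution $h^n(x_1,\dots,x_n)=\sum_{i<j}x_ix_j \bmod 2$ is a solution of $(*)$ for $K=IV^n_d$. In particular, the connected components of the projective T-hypersurface $\mathbb RX_{h^n}\subset\mathbb R\mathcal P^n_d$ defined by $IV^n_d$ and $h^n$ are exactly: 1. $h^{n-1,0}$ spheres $S_k$ of dimension $n-1$, bounding pairwise disjoint closed $n$-balls $B_k$ (that is, $S_k$ is the frontier of $B_k$ and $(B_k,S_k)$ is homeomorphic to the closed unit ball of $\mathbb R^n$ with its unit sphere); no sphere $S_k$ meets a toric divisor; 2. one further connected component, which meets every toric divisor. -/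

import Mathlib

namespace THyp

/-! ### Finite simplicial complexes with vertices in the lattice `ℤⁿ = 𝔱*(ℤ)` -/

/-- A simplex is given by the finite set of its vertices. -/
abbrev Simplex (n : ℕ) := Finset (Fin n → ℤ)

/-- A finite family of simplices. That the families considered below are simplicial complexes,
and even primitive triangulations, is expressed by `IsPrimitiveTriangulation`. -/
abbrev SComplex (n : ℕ) := Finset (Simplex n)

/-- The `n`-simplices (maximal simplices) of `K ⊂ ℤⁿ` having `τ` as a face. -/
def topCofaces {n : ℕ} (K : SComplex n) (τ : Simplex n) : Finset (Simplex n) :=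
  K.filter fun σ => τ ⊆ σ ∧ σ.card = n + 1

/-- The boundary `∂K`: the subcomplex generated by the `(n-1)`-simplices contained in exactly one
`n`-simplex. -/
def bd {n : ℕ} (K : SComplex n) : SComplex n :=
  K.filter fun σ => ∃ τ ∈ K, σ ⊆ τ ∧ τ.card = n ∧ (topCofaces K τ).card = 1

/-- `v` is a vertex of `L`. -/
def IsVertexOf {n : ℕ} (L : SComplex n) (v : Fin n → ℤ) : Prop := ∃ τ ∈ L, v ∈ τ

instance {n : ℕ} (L : SComplex n) (v : Fin n → ℤ) : Decidable (IsVertexOf L v) :=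
  inferInstanceAs (Decidable (∃ τ ∈ L, v ∈ τ))

/-- `𝓑₀K`: the simplices of `K` all of whose vertices are in `∂K`. -/
def bdZero {n : ℕ} (K : SComplex n) : SComplex n :=
  K.filter fun σ => ∀ v ∈ σ, IsVertexOf (bd K) v

/-- `𝓑₁K`: the union of the closed simplices `τ` all of whose vertices `v` lie in `∂K` or satisfy
`lk(v; τ) ⊆ ∂K` (the link of `v` in `τ` is the face `τ \ {v}`, possibly empty). -/
def bdOne {n : ℕ} (K : SComplex n) : SComplex n :=
  K.filter fun σ => ∃ τ ∈ K, σ ⊆ τ ∧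
    ∀ v ∈ τ, IsVertexOf (bd K) v ∨ τ.erase v = ∅ ∨ τ.erase v ∈ bd K

/-- `L` contains every simplex of `K` that is a face of a simplex of `L`. -/
def IsFaceClosed {n : ℕ} (K L : SComplex n) : Prop := ∀ σ ∈ L, ∀ τ ∈ K, τ ⊆ σ → τ ∈ L

theorem bd_subset_bdZero {n : ℕ} (K : SComplex n) : bd K ⊆ bdZero K := by
  intro σ hσ
  refine Finset.mem_filter.2 ⟨(Finset.mem_filter.1 hσ).1, fun v hv => ⟨σ, hσ, hv⟩⟩

theorem bdZero_faceClosed {n : ℕ} (K : SComplex n) : IsFaceClosed K (bdZero K) := by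
  intro σ hσ τ hτ h
  exact Finset.mem_filter.2 ⟨hτ, fun v hv => (Finset.mem_filter.1 hσ).2 v (h hv)⟩

/-! ### Cellular cosheaves of `𝔽₂`-vector spaces and their relative homology -/

/-- A cellular cosheaf: a contravariant functor from simplices, ordered by inclusion, to
`𝔽₂`-vector spaces. -/
structure Cosheaf (n : ℕ) where
  obj : Simplex n → Type
  addCommGroup : ∀ σ, AddCommGroup (obj σ)
  module : ∀ σ, Module (ZMod 2) (obj σ)
  ext : ∀ {τ σ : Simplex n}, τ ⊆ σ → obj σ →ₗ[ZMod 2] obj τ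
  ext_refl : ∀ (σ : Simplex n) (x : obj σ), ext (Finset.Subset.refl σ) x = x
  ext_trans : ∀ {ρ τ σ : Simplex n} (h : ρ ⊆ τ) (h' : τ ⊆ σ) (x : obj σ),
    ext h (ext h' x) = ext (h.trans h') x

attribute [instance] Cosheaf.addCommGroup Cosheaf.module

/-- The `k`-simplices of `K` that do not belong to `L`. -/
def cells {n : ℕ} (K L : SComplex n) (k : ℕ) : Finset (Simplex n) :=
  K.filter fun σ => σ ∉ L ∧ σ.card = k + 1

/-- The relative `k`-chains `C_k(K; L; F)`. -/
abbrev Chains {n : ℕ} (F : Cosheaf n) (K L : SComplex n) (k : ℕ) :=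
  (σ : {σ : Simplex n // σ ∈ cells K L k}) → F.obj σ.1

/-- The boundary operator `C_i(K; L; F) → C_j(K; L; F)`; it is nonzero only for `i = j + 1`. -/
def boundary {n : ℕ} (F : Cosheaf n) (K L : SComplex n) (i j : ℕ) :
    Chains F K L i →ₗ[ZMod 2] Chains F K L j where
  toFun c τ := ∑ σ, if h : τ.1 ⊆ σ.1 ∧ i = j + 1 then F.ext h.1 (c σ) else 0
  map_add' c c' := by
    funext τ
    simp only [Pi.add_apply, ← Finset.sum_add_distrib]
    refine Finset.sum_congr rfl fun σ _ => ?_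
    split_ifs <;> simp
  map_smul' r c := by
    funext τ
    simp only [Pi.smul_apply, RingHom.id_apply, Finset.smul_sum]
    refine Finset.sum_congr rfl fun σ _ => ?_
    split_ifs <;> simp

/-- Relative cycles (in degree `0` the operator `boundary F K L 0 0` is zero). -/
abbrev cycles {n : ℕ} (F : Cosheaf n) (K L : SComplex n) (k : ℕ) :
    Submodule (ZMod 2) (Chains F K L k) :=
  LinearMap.ker (boundary F K L k (k - 1))

/-- Relative boundaries, inside the cycles. -/
abbrev boundaries {n : ℕ} (F : Cosheaf n) (K L : SComplex n) (k : ℕ) :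
    Submodule (ZMod 2) (cycles F K L k) :=
  (LinearMap.range (boundary F K L (k + 1) k)).comap (cycles F K L k).subtype

/-- The relative homology group `H_k(K; L; F)`. -/
abbrev Homology {n : ℕ} (F : Cosheaf n) (K L : SComplex n) (k : ℕ) :=
  cycles F K L k ⧸ boundaries F K L k

/-- The homology class of a cycle. -/
def homologyClass {n : ℕ} {F : Cosheaf n} {K L : SComplex n} {k : ℕ} (z : cycles F K L k) :
    Homology F K L k :=
  (boundaries F K L k).mkQ z

theorem cells_anti {n : ℕ} (K : SComplex n) {L L' : SComplex n} (h : L ⊆ L') (k : ℕ) :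
    cells K L' k ⊆ cells K L k := by
  intro σ hσ
  have := Finset.mem_filter.1 hσ
  exact Finset.mem_filter.2 ⟨this.1, fun h' => this.2.1 (h h'), this.2.2⟩

/-- The quotient map `C_k(K; L; F) → C_k(K; L'; F)` for `L ⊆ L'`. -/
def chainQuot {n : ℕ} (F : Cosheaf n) (K : SComplex n) {L L' : SComplex n} (h : L ⊆ L') (k : ℕ) :
    Chains F K L k →ₗ[ZMod 2] Chains F K L' k where
  toFun c σ := c ⟨σ.1, cells_anti K h k σ.2⟩
  map_add' _ _ := rfl
  map_smul' _ _ := rfl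

theorem boundary_chainQuot {n : ℕ} (F : Cosheaf n) (K : SComplex n) {L L' : SComplex n}
    (h : L ⊆ L') (hc : IsFaceClosed K L') (i j : ℕ) (c : Chains F K L i) :
    boundary F K L' i j (chainQuot F K h i c) = chainQuot F K h j (boundary F K L i j c) := by
  funext τ
  change (∑ σ : {σ // σ ∈ cells K L' i}, _) = (∑ σ : {σ // σ ∈ cells K L i}, _)
  refine Finset.sum_of_injOn (fun σ => ⟨σ.1, cells_anti K h i σ.2⟩) ?_ ?_ ?_ ?_
  · intro a _ b _ hab
    exact Subtype.ext (congrArg (fun x => x.1) hab)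
  · intro _ _
    exact Finset.mem_coe.2 (Finset.mem_univ _)
  · intro σ _ hσ
    refine dif_neg ?_
    rintro ⟨hs, -⟩
    apply hσ
    have h1 := Finset.mem_filter.1 σ.2
    have h2 := Finset.mem_filter.1 τ.2
    refine ⟨⟨σ.1, Finset.mem_filter.2 ⟨h1.1, fun hm => h2.2.1 (hc _ hm _ h2.1 hs), h1.2.2⟩⟩, ?_, rfl⟩
    exact Finset.mem_coe.2 (Finset.mem_univ _)
  · intro σ _
    rfl

/-- The map `H_k(K; L; F) → H_k(K; L'; F)` for subcomplexes `L ⊆ L'` of `K`. -/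
def homologyQuot {n : ℕ} (F : Cosheaf n) (K : SComplex n) {L L' : SComplex n} (h : L ⊆ L')
    (hc : IsFaceClosed K L') (k : ℕ) : Homology F K L k →ₗ[ZMod 2] Homology F K L' k :=
  Submodule.mapQ (boundaries F K L k) (boundaries F K L' k)
    ((chainQuot F K h k).restrict (p := cycles F K L k) (q := cycles F K L' k) (by
      intro c hz
      rw [LinearMap.mem_ker] at hz ⊢
      rw [boundary_chainQuot F K h hc, hz, map_zero]))
    (by
      rintro z ⟨b, hb⟩
      exact ⟨chainQuot F K h (k + 1) b, by
        rw [boundary_chainQuot F K h hc, hb]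
        rfl⟩)

/-! ### The normal and cotangent cosheaves -/

/-- The pairing of `a ∈ 𝔱*(ℤ)` with `𝔱(𝔽₂)`. -/
def pairing {n : ℕ} (a : Fin n → ℤ) : (Fin n → ZMod 2) →ₗ[ZMod 2] ZMod 2 :=
  ∑ i, (a i : ZMod 2) • LinearMap.proj i

/-- The map `v ↦ [edge {a, b} of σ ↦ ω({a, b})(v)]`, where `ω({a, b}) = b - a mod 2`. -/
def edgeEval {n : ℕ} (σ : Simplex n) :
    (Fin n → ZMod 2) →ₗ[ZMod 2] ({x // x ∈ σ} → {x // x ∈ σ} → ZMod 2) :=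
  LinearMap.pi fun a => LinearMap.pi fun b => pairing (b.1 - a.1)

/-- `N(σ) = (Tσ)^⊥(𝔽₂)`, the vectors of `𝔱(𝔽₂)` vanishing on all the edges of `σ` (which, for a
primitive simplex, generate the lattice of `Tσ`). -/
def normal {n : ℕ} (σ : Simplex n) : Submodule (ZMod 2) (Fin n → ZMod 2) :=
  LinearMap.ker (edgeEval σ)

theorem normal_anti {n : ℕ} {τ σ : Simplex n} (h : τ ⊆ σ) : normal σ ≤ normal τ := by
  intro v hv
  rw [normal, LinearMap.mem_ker] at hv ⊢
  funext a b
  exact congrFun (congrFun hv ⟨a.1, h a.2⟩) ⟨b.1, h b.2⟩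

/-- The normal cosheaf `N`; its extension morphisms are the inclusions. -/
def normalCosheaf (n : ℕ) : Cosheaf n where
  obj σ := normal σ
  addCommGroup _ := inferInstance
  module _ := inferInstance
  ext h := Submodule.inclusion (normal_anti h)
  ext_refl _ _ := rfl
  ext_trans _ _ _ := rfl

/-- The constant cosheaf with value `𝔱(𝔽₂)`. -/
def constCosheaf (n : ℕ) : Cosheaf n where
  obj _ := Fin n → ZMod 2
  addCommGroup _ := inferInstance
  module _ := inferInstance
  ext _ := LinearMap.id
  ext_refl _ _ := rfl
  ext_trans _ _ _ := rfl

/-- The cotangent cosheaf `T* = 𝔱(𝔽₂)/N`; its extension morphisms are the quotient maps. -/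
def cotangentCosheaf (n : ℕ) : Cosheaf n where
  obj σ := (Fin n → ZMod 2) ⧸ normal σ
  addCommGroup _ := inferInstance
  module _ := inferInstance
  ext {τ σ} h := Submodule.mapQ (normal σ) (normal τ) LinearMap.id (normal_anti h)
  ext_refl σ x := by
    obtain ⟨v, rfl⟩ := Submodule.Quotient.mk_surjective _ x
    rfl
  ext_trans h h' x := by
    obtain ⟨v, rfl⟩ := Submodule.Quotient.mk_surjective _ x
    rfl

/-- The inclusion of chains `C_k(K; L; N) → C_k(K; L; 𝔱(𝔽₂))`. -/
def normalIncl {n : ℕ} {K L : SComplex n} {k : ℕ} (c : Chains (normalCosheaf n) K L k) :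
    Chains (constCosheaf n) K L k :=
  fun σ => (normal σ.1).subtype (c σ)

/-- The projection of chains `C_k(K; L; 𝔱(𝔽₂)) → C_k(K; L; T*)`. -/
def cotangentProj {n : ℕ} {K L : SComplex n} {k : ℕ} (c : Chains (constCosheaf n) K L k) :
    Chains (cotangentCosheaf n) K L k :=
  fun σ => (normal σ.1).mkQ (c σ)

/-- `y` is the image of `x` under the connecting morphism `H_k(K; L; T*) → H_{k-1}(K; L; N)` of
`0 → N → 𝔱(𝔽₂) → T* → 0`: lift a cycle representing `x` to a `𝔱(𝔽₂)`-chain and take its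
boundary. -/
def IsConnecting {n : ℕ} {K L : SComplex n} {k : ℕ} (x : Homology (cotangentCosheaf n) K L k)
    (y : Homology (normalCosheaf n) K L (k - 1)) : Prop :=
  ∃ (z : cycles (cotangentCosheaf n) K L k) (b : Chains (constCosheaf n) K L k)
    (a : cycles (normalCosheaf n) K L (k - 1)),
    homologyClass z = x ∧ cotangentProj b = z.1 ∧
      boundary (constCosheaf n) K L k (k - 1) b = normalIncl a.1 ∧ homologyClass a = y

/-! ### Derivatives of sign distributions, and the class `ρ` -/

/-- The isomorphism `z¹_σ` from `T*(σ) = 𝔱(𝔽₂)/N(σ)` onto the `1`-cocycles of `σ`. -/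
def zOne {n : ℕ} (σ : Simplex n) :
    ((Fin n → ZMod 2) ⧸ normal σ) →ₗ[ZMod 2] ({x // x ∈ σ} → {x // x ∈ σ} → ZMod 2) :=
  (normal σ).liftQ (edgeEval σ) le_rfl

/-- The first derivative `(Dε)_σ = (z¹_σ)⁻¹(dε|_σ)` of a sign distribution, as a relative
`n`-chain. -/
noncomputable def firstDerivative {n : ℕ} (K : SComplex n) (ε : (Fin n → ℤ) → ZMod 2) :
    Chains (cotangentCosheaf n) K (bd K) n :=
  fun σ => Function.invFun (zOne σ.1) fun a b => ε b.1 - ε a.1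

open scoped Classical in
/-- The nonzero vector of a line of `𝔱(𝔽₂)`. -/
noncomputable def lineGenerator {n : ℕ} (W : Submodule (ZMod 2) (Fin n → ZMod 2)) :
    Fin n → ZMod 2 :=
  if h : ∃ w ∈ W, w ≠ 0 then h.choose else 0

/-- `e_σ(α)`, the generator of the line `N(lk(α; σ))`, for a vertex `α` of an `n`-simplex `σ`. -/
noncomputable def dualVector {n : ℕ} (σ : Simplex n) (α : Fin n → ℤ) : Fin n → ZMod 2 :=
  lineGenerator (normal (σ.erase α))

/-- An `(n-1)`-simplex is interior if it bounds two `n`-simplices. -/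
def IsInteriorFacet {n : ℕ} (K : SComplex n) (τ : Simplex n) : Prop :=
  τ ∈ K ∧ τ.card = n ∧ (topCofaces K τ).card = 2

/-- `ρ_τ(α) = e_{σ₊}(α) - e_{σ₋}(α)`, where `σ₊`, `σ₋` are the two `n`-simplices bounded by `τ`
(the difference is a sum since the coefficients are in `𝔽₂`). -/
noncomputable def rho {n : ℕ} (K : SComplex n) (τ : Simplex n) (α : Fin n → ℤ) : Fin n → ZMod 2 :=
  ∑ σ ∈ topCofaces K τ, dualVector σ α

/-- `α ∈ I(τ)`: a vertex of `τ` not in `∂K` whose link in `τ` is not contained in `∂K` either. -/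
def MemI {n : ℕ} (K : SComplex n) (τ : Simplex n) (α : Fin n → ℤ) : Prop :=
  α ∈ τ ∧ ¬ IsVertexOf (bd K) α ∧ τ.erase α ≠ ∅ ∧ τ.erase α ∉ bd K

/-- `K` is `ρ`-uniform: for all interior `(n-1)`-simplices `τ`, `ρ_τ` is constant on `I(τ)`. -/
def RhoUniform {n : ℕ} (K : SComplex n) : Prop :=
  ∀ τ, IsInteriorFacet K τ → ∀ α β, MemI K τ α → MemI K τ β → rho K τ α = rho K τ β

/-- `r` is the chain `ρ ∈ C_{n-1}(K; 𝓑₀K; N)`: its value at `τ ∉ 𝓑₁K` is `ρ_τ(α)` for any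
`α ∈ I(τ)`, and its value at `τ ∈ 𝓑₁K \ 𝓑₀K` is `ρ_τ(ap τ)`, where `ap τ` is the only vertex of
`τ` not in `∂K`. -/
def IsRhoChain {n : ℕ} (K : SComplex n)
    (r : Chains (normalCosheaf n) K (bdZero K) (n - 1)) : Prop :=
  ∀ τ, (τ.1 ∉ bdOne K → ∀ α, MemI K τ.1 α → (normal τ.1).subtype (r τ) = rho K τ.1 α) ∧
    (τ.1 ∈ bdOne K → ∀ α ∈ τ.1, ¬ IsVertexOf (bd K) α →
      (normal τ.1).subtype (r τ) = rho K τ.1 α)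

/-- `D²ε = ρ` in `H_{n-1}(K; 𝓑₀K; N)`. The second derivative `D²ε ∈ H_{n-1}(K; ∂K; N)` is the
image of the class of `Dε` under the connecting morphism; it is pushed to `H_{n-1}(K; 𝓑₀K; N)`. -/
def SolvesHarnackEquation {n : ℕ} (K : SComplex n) (ε : (Fin n → ℤ) → ZMod 2) : Prop :=
  ∃ (hD : firstDerivative K ε ∈ cycles (cotangentCosheaf n) K (bd K) n)
    (D2 : Homology (normalCosheaf n) K (bd K) (n - 1))
    (r : cycles (normalCosheaf n) K (bdZero K) (n - 1)),
    IsConnecting (homologyClass ⟨firstDerivative K ε, hD⟩) D2 ∧ IsRhoChain K r.1 ∧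
      homologyQuot (normalCosheaf n) K (bd_subset_bdZero K) (bdZero_faceClosed K) (n - 1) D2 =
        homologyClass r

/-- `K` is simply integrable: it is `ρ`-uniform and `D²ε = ρ` has a solution. -/
def SimplyIntegrable {n : ℕ} (K : SComplex n) : Prop :=
  RhoUniform K ∧ ∃ ε : (Fin n → ℤ) → ZMod 2, SolvesHarnackEquation K ε

/-! ### Itenberg–Viro triangulations -/

/-- Homogeneous coordinates on the size `d` standard simplex `[0, d e₁, …, d eₙ]`:
`(d - ∑ xᵢ, x₁, …, xₙ)`. -/
def homCoord {R : Type*} [CommRing R] {n : ℕ} (d : ℕ) (x : Fin n → R) : Fin (n + 1) → R :=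
  Fin.cons ((d : R) - ∑ i, x i) x

/-- The restriction of a triangulation of the size `d` standard simplex to its face spanned by the
`d eⱼ`, `j ∈ J` (where `e₀ = 0`). -/
def restrictFace {n : ℕ} (d : ℕ) (K : SComplex n) (J : Finset (Fin (n + 1))) : SComplex n :=
  K.filter fun σ => ∀ x ∈ σ, ∀ j, j ∉ J → homCoord d x j = 0

/-- The join of two complexes. -/
def join {n : ℕ} (A B : SComplex n) : SComplex n :=
  ((insert ∅ A ×ˢ insert ∅ B).image fun p => p.1 ∪ p.2).erase ∅

/-- The translation by `e_{n+1}` in `ℤⁿ⁺¹`. -/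
def translateUp {n : ℕ} (K : SComplex (n + 1)) : SComplex (n + 1) :=
  K.image fun σ => σ.image fun x => x + Pi.single (Fin.last n) 1

/-- The inclusion of `ℤⁿ` in `ℤⁿ⁺¹` as the hyperplane `x_{n+1} = 0`. -/
def inclBottom {n : ℕ} (L : SComplex n) : SComplex (n + 1) :=
  L.image fun σ => σ.image fun x => (Fin.snoc x 0 : Fin (n + 1) → ℤ)

/-- `K + (-1)^η L`, for `K` a triangulation of the size `d` standard `(n+1)`-simplex and `L` a
triangulation of the size `d + 1` standard `n`-simplex. It is made of the translation of `K` and,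
for `0 ≤ i ≤ n`, of the join of the translation of the restriction of `K` to `[d e₀, …, d eᵢ]` with
the restriction of `L` to `[(d+1) eᵢ, …, (d+1) eₙ]` if `η` is even, and of the join of the
translation of the restriction of `K` to `[d eᵢ, …, d eₙ]` with the restriction of `L` to
`[(d+1) e₀, …, (d+1) eᵢ]` if `η` is odd. -/
def addLayer {n : ℕ} (d η : ℕ) (K : SComplex (n + 1)) (L : SComplex n) : SComplex (n + 1) :=
  translateUp K ∪ Finset.univ.biUnion fun i : Fin (n + 1) =>
    if Even η then
      join (translateUp (restrictFace d K (Finset.Iic i.castSucc)))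
        (inclBottom (restrictFace (d + 1) L (Finset.Ici i)))
    else
      join (translateUp (restrictFace d K (Finset.Ico i.castSucc (Fin.last (n + 1)))))
        (inclBottom (restrictFace (d + 1) L (Finset.Iic i)))

/-- The simplex `[0, e₁, …, eₙ]` with all its nonempty faces. -/
def unitSimplex (n : ℕ) : SComplex n :=
  (insert 0 (Finset.univ.image fun i : Fin n => (Pi.single i 1 : Fin n → ℤ))).powerset.erase ∅

/-- The sequence of triangulations of standard `(n+1)`-simplices built from a sequence `L` of
triangulations of standard `n`-simplices. The value at `d = 0` is irrelevant. -/
def ivSequence {n : ℕ} (L : ℕ → SComplex n) : ℕ → SComplex (n + 1)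
  | 0 => ∅
  | 1 => unitSimplex (n + 1)
  | d + 2 => addLayer (d + 1) (d + 1) (ivSequence L (d + 1)) (L (d + 2))

/-- The Itenberg–Viro triangulation `IVⁿ_d` for `n, d ≥ 1` (the value at `n = 0` is irrelevant). -/
def itenbergViro : (n : ℕ) → ℕ → SComplex n
  | 0 => fun _ => {{0}}
  | 1 => fun d => (Finset.range d).biUnion fun k =>
      ({(fun _ => (k : ℤ)), (fun _ => (k : ℤ) + 1)} : Simplex 1).powerset.erase ∅
  | n + 2 => ivSequence (itenbergViro (n + 1))

/-- The Harnack distribution `hⁿ(x) = ∑_{i<j} xᵢ xⱼ mod 2`. -/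
def harnack (n : ℕ) (x : Fin n → ℤ) : ZMod 2 :=
  ∑ j : Fin n, ∑ i ∈ Finset.Iio j, (x i : ZMod 2) * (x j : ZMod 2)

/-! ### Primitive triangulations, real loci, T-hypersurfaces -/

/-- The inclusion `ℤⁿ ⊂ ℝⁿ`. -/
def toReal {n : ℕ} (x : Fin n → ℤ) : Fin n → ℝ := fun i => (x i : ℝ)

/-- The closed geometric simplex. -/
def hull {n : ℕ} (σ : Simplex n) : Set (Fin n → ℝ) := convexHull ℝ (toReal '' (σ : Set (Fin n → ℤ)))

/-- `K` is a primitive triangulation of the polytope `P ⊂ ℝⁿ`. -/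
structure IsPrimitiveTriangulation {n : ℕ} (P : Set (Fin n → ℝ)) (K : SComplex n) : Prop where
  nonempty : ∀ σ ∈ K, σ.Nonempty
  down_closed : ∀ σ ∈ K, ∀ τ ⊆ σ, τ.Nonempty → τ ∈ K
  pure : ∀ σ ∈ K, ∃ τ ∈ K, σ ⊆ τ ∧ τ.card = n + 1
  primitive : ∀ σ ∈ K, σ.card = n + 1 →
    ∀ a ∈ σ, Submodule.span ℤ {x : Fin n → ℤ | ∃ b ∈ σ, x = b - a} = ⊤
  inter : ∀ σ ∈ K, ∀ τ ∈ K, hull σ ∩ hull τ = hull (σ ∩ τ)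
  cover : (⋃ σ ∈ K, hull σ) = P

/-- The standard simplex `[0, d e₁, …, d eₙ]` of size `d`. -/
def sizedSimplex (n d : ℕ) : Set (Fin n → ℝ) := {x | (∀ i, 0 ≤ x i) ∧ ∑ i, x i ≤ d}

/-- `TQ ∩ 𝔱*(ℤ)`, where `Q` is the face of the convex set `P` containing `x` in its relative
interior. -/
def faceDirections {n : ℕ} (P : Set (Fin n → ℝ)) (x : Fin n → ℝ) : Set (Fin n → ℤ) :=
  {a | ∃ t : ℝ, 0 < t ∧ x + t • toReal a ∈ P ∧ x - t • toReal a ∈ P}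

/-- The sedentarity `Sed(x) ⊂ 𝔱(𝔽₂)`. -/
def sed {n : ℕ} (P : Set (Fin n → ℝ)) (x : Fin n → ℝ) : Submodule (ZMod 2) (Fin n → ZMod 2) :=
  ⨅ a ∈ faceDirections P x, LinearMap.ker (pairing a)

/-- `(x, v)` and `(y, w)` are identified if `x = y` and `v - w ∈ Sed(x)`. -/
def realSetoid {n : ℕ} (P : Set (Fin n → ℝ)) : Setoid (P × (Fin n → ZMod 2)) where
  r p q := p.1 = q.1 ∧ p.2 - q.2 ∈ sed P p.1
  iseqv :=
    { refl := fun p => ⟨rfl, by simp⟩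
      symm := by
        rintro p q ⟨h, h'⟩
        exact ⟨h.symm, by rw [← h, ← neg_sub]; exact neg_mem h'⟩
      trans := by
        rintro p q r ⟨h, h'⟩ ⟨k, k'⟩
        refine ⟨h.trans k, ?_⟩
        rw [← h] at k'
        simpa using add_mem h' k' }

/-- The real locus `ℝP` of the toric variety of `P`: the quotient of `P × 𝔱(𝔽₂)` by the above
identifications, with the quotient topology (`𝔱(𝔽₂)` is discrete). -/
abbrev RealLocus {n : ℕ} (P : Set (Fin n → ℝ)) := Quotient (realSetoid P)

/-- The point of `ℝP` above `x` in the quadrant `v`. -/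
def RealLocus.mk {n : ℕ} {P : Set (Fin n → ℝ)} (x : P) (v : Fin n → ZMod 2) : RealLocus P :=
  Quotient.mk (realSetoid P) (x, v)

/-- The barycentre of a simplex. -/
noncomputable def barycentre {n : ℕ} (σ : Simplex n) : Fin n → ℝ :=
  (σ.card : ℝ)⁻¹ • ∑ x ∈ σ, toReal x

/-- The closed cell `[σ; σ']` of the cubical subdivision: the union of the simplices of the
barycentric subdivision indexed by the flags of simplices between `σ` and `σ'`. -/
def closedCube {n : ℕ} (σ σ' : Simplex n) : Set (Fin n → ℝ) :=
  ⋃ C ∈ {C : Set (Simplex n) | IsChain (· ⊆ ·) C ∧ ∀ τ ∈ C, σ ⊆ τ ∧ τ ⊆ σ'},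
    convexHull ℝ (barycentre '' C)

/-- The T-hypersurface `ℝX_ε ⊂ ℝP`: the union of the closed cubes `[σ_ℝ; σ'_ℝ]` of `ℝK` such that
`σ_ℝ` has an edge on which the cochain `d|ε|* + ω_{ℝX}` is `1`. A lift of `[σ; σ']` is given by an
argument `v ∈ 𝔱(𝔽₂)` modulo `Sed(σ')`, and the value of `d|ε|* + ω_{ℝX}` at the corresponding lift
of the edge `{a, b}` is `ε(a) + ε(b) + (b - a)(v)`. -/
def tHypersurface {n : ℕ} (P : Set (Fin n → ℝ)) (K : SComplex n) (ε : (Fin n → ℤ) → ZMod 2) :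
    Set (RealLocus P) :=
  {q | ∃ σ ∈ K, ∃ σ' ∈ K, σ ⊆ σ' ∧ ∃ v : Fin n → ZMod 2,
    (∃ a ∈ σ, ∃ b ∈ σ, a ≠ b ∧ ε a + ε b + pairing (b - a) v = 1) ∧
    ∃ x : P, (x : Fin n → ℝ) ∈ closedCube σ σ' ∧ q = RealLocus.mk x v}

/-- The `n + 1` toric divisors of `ℝPⁿ`: the preimages in the real locus of the facets of the
standard simplex. -/
def toricDivisor (n d : ℕ) (i : Fin (n + 1)) : Set (RealLocus (sizedSimplex n d)) :=
  {q | ∃ (x : sizedSimplex n d) (v : Fin n → ZMod 2),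
    homCoord d (x : Fin n → ℝ) i = 0 ∧ q = RealLocus.mk x v}

/-- `h^{n-1,0}`: the number of interior lattice points of the moment polytope `P`. -/
noncomputable def geometricGenus {n : ℕ} (P : Set (Fin n → ℝ)) : ℕ :=
  Nat.card {x : Fin n → ℤ // toReal x ∈ interior P}

/-- `S` is a sphere bounding the `n`-ball `B` in `Y`: it is the frontier of `B`, and the pair
`(B, S)` is homeomorphic to the unit closed ball of `ℝⁿ` with its unit sphere. -/
def IsSphereBounding {Y : Type*} [TopologicalSpace Y] (n : ℕ) (S B : Set Y) : Prop :=
  S ⊆ B ∧ S = frontier B ∧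
    ∃ e : B ≃ₜ Metric.closedBall (0 : EuclideanSpace ℝ (Fin n)) 1,
      ∀ y : B, (y : Y) ∈ S ↔ (e y : EuclideanSpace ℝ (Fin n)) ∈ Metric.sphere 0 1

/-- `S` is a connected component of the subset `X`. -/
def IsComponentOf {Y : Type*} [TopologicalSpace Y] (X S : Set Y) : Prop :=
  ∃ q ∈ X, S = connectedComponentIn X q

end THyp

/-! In homogeneous coordinates `(x₀, …, xₙ)` of sum `d`, the triangulation is the clique complex of
an explicit graph. Two lattice points are joined when they lie in the same layer of the last
coordinate and their truncations are joined, or when they lie in consecutive layers and the supports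
of the truncations are weakly ordered, in a direction given by the parity of the size of the upper
truncation (`Compat`, `mem_itenbergViro`). A clique meets at most two layers, and their supports
share at most one index; hence the total weight and the moments of a signed combination determine
the contribution of each layer. By induction on the number of coordinates this gives affine
independence and unimodularity together (`mem_of_moments`). A nonnegative vector is in a unique way
the sum of two nonnegative vectors with ordered supports and prescribed totals, whence the existence
and uniqueness of barycentric coordinates (`exists_weights`, `weights_unique`).

The equation is solved at the level of chains. Let `V_σ` be the quadrant over which an `n`-simplex
`σ` is monochromatic, and suppose that in the quadrant `v` the vertex `α` has the sign opposite to
all its neighbours. Then `V_σ + v` vanishes on the edges of the face opposite to `α` and is `1` on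
the edges at `α`, so it is `e_σ(α)`. In `ρ_τ(α)` the vector `v` cancels and `V_{σ₊} + V_{σ₋}`
remains, which is the value at `τ` of the boundary of the lift `σ ↦ V_σ` of `Dε`. So any
distribution isolating every vertex off `∂K` is a solution (`dualVector_eq`,
`solvesHarnackEquation_of_isolated`). For the Harnack distribution only its dependence on parities
matters: the neighbours of a point with nonzero coordinates that lie outside its layer all have the
same parities, so one coefficient of a linear form deals with all of them, and induction deals with
the layer (`exists_isolating`).

For the topology, a point over `p` in the quadrant `v` is on the hypersurface exactly when two
vertices of maximal barycentric coordinate at `p` have opposite signs in `v`. The points at which an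
interior vertex has maximal coordinate form a star-shaped ball, and in the isolating quadrant its
boundary is open and closed in the hypersurface.

That there is only one further component is shown by duality. Let `Ψ` be an `𝔽₂`-valued function
constant on connected subsets of the hypersurface. Summing `Ψ` over the quadrants in which the
middle of an edge is on the hypersurface defines a `1`-cocycle (`edgeSum`). It vanishes on edges in
the facets of the polytope, where quadrants cancel in pairs. Every `1`-cocycle of the complex is a
coboundary (`exists_primitive`), here of a function `g` that may be taken to vanish on the boundary.
The sphere around `x` has as cocycle the coboundary of the indicator of `x`; subtracting the
combination of spheres with coefficients `g(x)` makes the cocycle zero. Then at each `n`-simplex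
`Ψ`, completed at the monochromatic quadrant to have total `0`, also has first moment `0`. Across a
facet it can change only on a coset of a line, that is at two quadrants, where the two moment
conditions forbid any change. So it is the same at all `n`-simplices, and the same argument at the
coordinate facets makes it invariant under all unit vectors, hence constant (`IsLocal.constant`). -/

namespace THyp

/-! ### The compatibility graph on lattice points -/

/-- Compatibility of a point `a` of a layer of size `∑ aᵢ` with a point `b` of the layer below. -/
def LayerCompat {N : ℕ} (a b : Fin N → ℤ) : Prop :=
  (Even (∑ i, a i) → ∀ i j, a i ≠ 0 → b j ≠ 0 → i ≤ j) ∧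
    (¬ Even (∑ i, a i) → ∀ i j, a i ≠ 0 → b j ≠ 0 → j ≤ i)

/-- All the coordinates except the last one. -/
def lower {R : Type*} {N : ℕ} (x : Fin (N + 1) → R) : Fin N → R := fun i => x i.castSucc

/-- Two lattice points, in homogeneous coordinates, are joined by an edge of the Itenberg–Viro
triangulation, or are equal. -/
def Compat : ∀ {N : ℕ}, (Fin N → ℤ) → (Fin N → ℤ) → Prop
  | 0, _, _ => True
  | N + 1, x, y => (x (Fin.last N) = y (Fin.last N) ∧ Compat (lower x) (lower y)) ∨
      (x (Fin.last N) = y (Fin.last N) + 1 ∧ LayerCompat (lower x) (lower y)) ∨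
      (y (Fin.last N) = x (Fin.last N) + 1 ∧ LayerCompat (lower y) (lower x))

theorem Compat.refl : ∀ {N : ℕ} (x : Fin N → ℤ), Compat x x
  | 0, _ => trivial
  | _ + 1, x => Or.inl ⟨rfl, Compat.refl (lower x)⟩

theorem Compat.symm : ∀ {N : ℕ} {x y : Fin N → ℤ}, Compat x y → Compat y x
  | 0, _, _, _ => trivial
  | _ + 1, _, _, Or.inl h => Or.inl ⟨h.1.symm, h.2.symm⟩
  | _ + 1, _, _, Or.inr (Or.inl h) => Or.inr (Or.inr h)
  | _ + 1, _, _, Or.inr (Or.inr h) => Or.inr (Or.inl h)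

theorem Compat.last_cases {N : ℕ} {x y : Fin (N + 1) → ℤ} (h : Compat x y) :
    x (Fin.last N) = y (Fin.last N) ∨ x (Fin.last N) = y (Fin.last N) + 1 ∨
      y (Fin.last N) = x (Fin.last N) + 1 := by
  rcases h with h | h | h
  exacts [Or.inl h.1, Or.inr (Or.inl h.1), Or.inr (Or.inr h.1)]

theorem Compat.lower_of_eq {N : ℕ} {x y : Fin (N + 1) → ℤ} (h : Compat x y)
    (e : x (Fin.last N) = y (Fin.last N)) : Compat (lower x) (lower y) := by
  rcases h with h | h | h
  · exact h.2
  · have := h.1; omega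
  · have := h.1; omega

theorem Compat.layer_of_eq {N : ℕ} {x y : Fin (N + 1) → ℤ} (h : Compat x y)
    (e : x (Fin.last N) = y (Fin.last N) + 1) : LayerCompat (lower x) (lower y) := by
  rcases h with h | h | h
  · have := h.1; omega
  · exact h.2
  · have := h.1; omega

theorem lower_injective {R : Type*} {N : ℕ} {x y : Fin (N + 1) → R}
    (h : x (Fin.last N) = y (Fin.last N)) (h' : lower x = lower y) : x = y := by
  funext i
  refine Fin.lastCases h (fun j => ?_) i
  exact congrFun h' j

theorem sum_lower {R : Type*} [AddCommGroup R] {N : ℕ} (x : Fin (N + 1) → R) :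
    ∑ i, lower x i = (∑ i, x i) - x (Fin.last N) := by
  rw [Fin.sum_univ_castSucc]
  simp [lower]

/-- The supports of two points of consecutive layers joined by an edge meet in at most one
index. -/
theorem LayerCompat.eq_of_mem {N : ℕ} {ι : Type*} {A B : Finset ι} {x : ι → Fin N → ℤ} {D : ℤ}
    (hD : ∀ a ∈ A, ∑ k, x a k = D) (h : ∀ a ∈ A, ∀ b ∈ B, LayerCompat (x a) (x b)) {j j' : Fin N}
    (hA : ∃ a ∈ A, x a j ≠ 0) (hB : ∃ b ∈ B, x b j ≠ 0) (hA' : ∃ a ∈ A, x a j' ≠ 0)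
    (hB' : ∃ b ∈ B, x b j' ≠ 0) : j = j' := by
  obtain ⟨a, ha, haj⟩ := hA
  obtain ⟨b, hb, hbj⟩ := hB
  obtain ⟨a', ha', haj'⟩ := hA'
  obtain ⟨b', hb', hbj'⟩ := hB'
  -- The pairs are crossed: `a` (using `j`) against `b'` (using `j'`), and `a'` (using `j'`) against
  -- `b` (using `j`), which gives both inequalities.
  have h1 := h a ha b' hb'
  have h2 := h a' ha' b hb
  rw [LayerCompat, hD a ha] at h1
  rw [LayerCompat, hD a' ha'] at h2
  by_cases hE : Even D
  · exact le_antisymm (h1.1 hE _ _ haj hbj') (h2.1 hE _ _ haj' hbj)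
  · exact le_antisymm (h2.2 hE _ _ haj' hbj) (h1.2 hE _ _ haj hbj')

/-- A family of pairwise compatible points is unimodular (take `H = ℤ`) and affinely independent
(take `H = 0`). -/
theorem mem_of_moments (H : AddSubgroup ℝ) {ι : Type*} : ∀ (N : ℕ) (s : Finset ι)
    (x : ι → Fin N → ℤ) (μ : ι → ℝ) (D : ℤ), Set.InjOn x s →
    (∀ i ∈ s, ∀ j ∈ s, Compat (x i) (x j)) → (∀ i ∈ s, ∑ k, x i k = D) → ∑ i ∈ s, μ i ∈ H →
    (∀ k, ∑ i ∈ s, μ i * (x i k : ℝ) ∈ H) → ∀ i ∈ s, μ i ∈ H := by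
  classical
  have hz : ∀ (k : ℤ) {r : ℝ}, r ∈ H → (k : ℝ) * r ∈ H := fun k r hr => by
    simpa using H.zsmul_mem hr k
  intro N
  induction N with
  | zero =>
    intro s x μ D hinj _ _ h0 _ i hi
    have : s = {i} := Finset.eq_singleton_iff_unique_mem.2
      ⟨hi, fun j hj => hinj hj hi (Subsingleton.elim _ _)⟩
    simpa [this] using h0
  | succ N ih =>
    intro s x μ D hinj hc hD h0 h1 i hi
    -- Heights in a clique differ by at most one, so if `k` is the lowest height all points have
    -- height `k` or `k + 1`.
    obtain ⟨m, hm, hmin⟩ := s.exists_min_image (fun i => x i (Fin.last N)) ⟨i, hi⟩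
    set k := x m (Fin.last N) with hk
    set A := s.filter fun i => x i (Fin.last N) = k + 1 with hA
    set B := s.filter fun i => x i (Fin.last N) = k with hB
    have hAm : ∀ {a}, a ∈ A → a ∈ s ∧ x a (Fin.last N) = k + 1 := fun h => Finset.mem_filter.1 h
    have hBm : ∀ {a}, a ∈ B → a ∈ s ∧ x a (Fin.last N) = k := fun h => Finset.mem_filter.1 h
    have hdisj : Disjoint A B := by
      rw [Finset.disjoint_left]
      intro a ha hb
      have := (hAm ha).2; have := (hBm hb).2; omega
    have hun : s = A ∪ B := by
      ext a
      simp only [Finset.mem_union, hA, hB, Finset.mem_filter]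
      refine ⟨fun ha => ?_, fun h => h.elim (·.1) (·.1)⟩
      have h2 := hmin a ha
      rcases (hc a ha m hm).last_cases with h3 | h3 | h3
      · exact Or.inr ⟨ha, h3⟩
      · exact Or.inl ⟨ha, h3⟩
      · omega
    have hsum : ∀ f : ι → ℝ, ∑ a ∈ s, f a = ∑ a ∈ A, f a + ∑ a ∈ B, f a := fun f => by
      rw [hun, Finset.sum_union hdisj]
    have hμA : ∑ a ∈ A, μ a ∈ H := by
      -- The last moment minus `k` times the total weight is the weight of the upper layer.
      have h2 := H.sub_mem (h1 (Fin.last N)) (hz k h0)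
      have eA : ∑ a ∈ A, μ a * (x a (Fin.last N) : ℝ) = (k + 1) * ∑ a ∈ A, μ a := by
        rw [Finset.mul_sum]
        refine Finset.sum_congr rfl fun a ha => ?_
        rw [(hAm ha).2]; push_cast; ring
      have eB : ∑ a ∈ B, μ a * (x a (Fin.last N) : ℝ) = k * ∑ a ∈ B, μ a := by
        rw [Finset.mul_sum]
        refine Finset.sum_congr rfl fun a ha => ?_
        rw [(hBm ha).2]; ring
      convert h2 using 1
      rw [hsum, hsum μ, eA, eB]
      ring
    have hμB : ∑ a ∈ B, μ a ∈ H := by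
      have := H.sub_mem h0 hμA
      rwa [hsum, add_sub_cancel_left] at this
    have hDA : ∀ a ∈ A, ∑ j, lower (x a) j = D - (k + 1) := fun a ha => by
      rw [sum_lower, hD a (hAm ha).1, (hAm ha).2]
    have hDB : ∀ a ∈ B, ∑ j, lower (x a) j = D - k := fun a ha => by
      rw [sum_lower, hD a (hBm ha).1, (hBm ha).2]
    have hAB : ∀ a ∈ A, ∀ b ∈ B, LayerCompat (lower (x a)) (lower (x b)) := fun a ha b hb =>
      (hc a (hAm ha).1 b (hBm hb).1).layer_of_eq (by rw [(hAm ha).2, (hBm hb).2])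
    -- At an index not used by both layers, the moment of the upper layer is either zero or the
    -- whole moment.
    have key : ∀ j, (¬ ((∃ a ∈ A, lower (x a) j ≠ 0) ∧ ∃ b ∈ B, lower (x b) j ≠ 0)) →
        ∑ a ∈ A, μ a * ((lower (x a) j : ℤ) : ℝ) ∈ H := by
      intro j hj
      rw [not_and_or] at hj
      push Not at hj
      rcases hj with hj | hj
      · rw [Finset.sum_eq_zero fun a ha => by rw [hj a ha]; simp]
        exact H.zero_mem
      · have h2 := h1 j.castSucc
        rw [hsum, Finset.sum_eq_zero (s := B) fun b hb => by
          have := hj b hb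
          rw [lower] at this
          rw [this]; simp, add_zero] at h2
        exact h2
    have hmA : ∀ j, ∑ a ∈ A, μ a * ((lower (x a) j : ℤ) : ℝ) ∈ H := by
      intro j
      -- At most one index is used by both layers; the moment there is recovered from the others,
      -- because all points of the upper layer have the same coordinate sum.
      by_cases hj : (∃ a ∈ A, lower (x a) j ≠ 0) ∧ ∃ b ∈ B, lower (x b) j ≠ 0
      · have htot : ∑ j, ∑ a ∈ A, μ a * ((lower (x a) j : ℤ) : ℝ) ∈ H := by
          rw [Finset.sum_comm]
          have : ∀ a ∈ A, ∑ j, μ a * ((lower (x a) j : ℤ) : ℝ) = (D - (k + 1) : ℤ) * μ a := by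
            intro a ha
            rw [← Finset.mul_sum, ← hDA a ha]
            push_cast
            ring
          rw [Finset.sum_congr rfl this, ← Finset.mul_sum]
          exact hz _ hμA
        rw [← Finset.add_sum_erase _ _ (Finset.mem_univ j)] at htot
        refine (H.add_mem_cancel_right (H.sum_mem fun j' hj' => key j' fun h => ?_)).1 htot
        exact Finset.ne_of_mem_erase hj' (LayerCompat.eq_of_mem hDA hAB h.1 h.2 hj.1 hj.2)
      · exact key j hj
    have hmB : ∀ j, ∑ a ∈ B, μ a * ((lower (x a) j : ℤ) : ℝ) ∈ H := by
      intro j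
      have := H.sub_mem (h1 j.castSucc) (hmA j)
      rwa [hsum, show ∑ a ∈ A, μ a * (x a j.castSucc : ℝ) = ∑ a ∈ A, μ a * ((lower (x a) j : ℤ) : ℝ)
        from rfl, add_sub_cancel_left] at this
    rw [hun, Finset.mem_union] at hi
    rcases hi with hi | hi
    · refine ih A (fun a => lower (x a)) μ _ ?_ ?_ hDA hμA hmA i hi
      · intro a ha b hb hab
        exact hinj (hAm ha).1 (hAm hb).1
          (lower_injective ((hAm ha).2.trans (hAm hb).2.symm) hab)
      · intro a ha b hb
        exact (hc a (hAm ha).1 b (hAm hb).1).lower_of_eq ((hAm ha).2.trans (hAm hb).2.symm)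
    · refine ih B (fun a => lower (x a)) μ _ ?_ ?_ hDB hμB hmB i hi
      · intro a ha b hb hab
        exact hinj (hBm ha).1 (hBm hb).1
          (lower_injective ((hBm ha).2.trans (hBm hb).2.symm) hab)
      · intro a ha b hb
        exact (hc a (hBm ha).1 b (hBm hb).1).lower_of_eq ((hBm ha).2.trans (hBm hb).2.symm)

/-- A decomposition of a vector as a sum of two nonnegative vectors with consecutive supports is
determined by the sum of the entries of the first one. -/
theorem split_unique {ι : Type*} [LinearOrder ι] [Fintype ι] {α β α' β' : ι → ℝ}
    (hα : ∀ i, 0 ≤ α i) (hβ : ∀ i, 0 ≤ β i) (hα' : ∀ i, 0 ≤ α' i) (hβ' : ∀ i, 0 ≤ β' i)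
    (h : ∀ i, α i + β i = α' i + β' i) (hs : ∑ i, α i = ∑ i, α' i)
    (ho : ∀ i j, α i ≠ 0 → β j ≠ 0 → i ≤ j) (ho' : ∀ i j, α' i ≠ 0 → β' j ≠ 0 → i ≤ j) :
    α = α' := by
  -- If neither vector dominated the other, the two order conditions applied at an index of each
  -- strict inequality would force these indices to coincide. Comparable vectors with equal sums are
  -- equal.
  have hor : (∀ i, α i ≤ α' i) ∨ ∀ i, α' i ≤ α i := by
    by_contra hcon
    push Not at hcon
    obtain ⟨⟨i, hi⟩, j, hj⟩ := hcon
    have h1 := ho i j (by linarith [hα' i]) (by linarith [h j, hβ' j])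
    have h2 := ho' j i (by linarith [hα j]) (by linarith [h i, hβ i])
    have := le_antisymm h1 h2
    subst this
    linarith
  rcases hor with hor | hor
  · funext i
    exact (Finset.sum_eq_sum_iff_of_le fun i _ => hor i).1 hs i (Finset.mem_univ i)
  · funext i
    exact ((Finset.sum_eq_sum_iff_of_le fun i _ => hor i).1 hs.symm i (Finset.mem_univ i)).symm

/-- The decompositions of `split_unique` exist. -/
theorem exists_split : ∀ {N : ℕ} (p : Fin N → ℝ) (c : ℝ), (∀ i, 0 ≤ p i) → 0 ≤ c →
    c ≤ ∑ i, p i → ∃ α : Fin N → ℝ, (∀ i, 0 ≤ α i) ∧ (∀ i, α i ≤ p i) ∧ ∑ i, α i = c ∧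
      ∀ i j, α i ≠ 0 → p j - α j ≠ 0 → i ≤ j
  | 0, p, c, _, h0, h1 => ⟨p, fun i => i.elim0, fun i => i.elim0, by
      simp at h1 ⊢; linarith, fun i => i.elim0⟩
  | N + 1, p, c, hp, h0, h1 => by
    have hs := sum_lower p
    -- Greedy filling from the lowest index: the last entry is touched only after all the others are
    -- used up.
    rcases le_or_gt c (∑ i, lower p i) with h | h
    · obtain ⟨α, hα, hαp, hαs, hαo⟩ := exists_split (lower p) c (fun i => hp _) h0 h
      refine ⟨Fin.snoc α 0, ?_, ?_, ?_, ?_⟩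
      · intro i; refine Fin.lastCases ?_ (fun j => ?_) i <;> simp [hα]
      · intro i; refine Fin.lastCases ?_ (fun j => ?_) i
        · simp [hp]
        · simpa [lower] using hαp j
      · simp [Fin.sum_univ_castSucc, hαs]
      · intro i j
        refine Fin.lastCases ?_ (fun i => ?_) i
        · simp
        · refine Fin.lastCases ?_ (fun j => ?_) j
          · intro _ _; exact Fin.le_last _
          · intro hi hj
            simp only [Fin.snoc_castSucc] at hi hj
            exact Fin.castSucc_le_castSucc_iff.2 (hαo i j hi hj)
    · refine ⟨Fin.snoc (lower p) (c - ∑ i, lower p i), ?_, ?_, ?_, ?_⟩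
      · intro i; refine Fin.lastCases ?_ (fun j => ?_) i
        · simp [h.le]
        · simpa [lower] using hp _
      · intro i; refine Fin.lastCases ?_ (fun j => ?_) i
        · simp only [Fin.snoc_last]; linarith
        · simp [lower]
      · simp [Fin.sum_univ_castSucc]
      · intro i j
        refine Fin.lastCases (fun _ _ => Fin.le_last _) (fun j => ?_) j
        intro _ hj
        simp [lower] at hj

/-! ### Uniqueness and existence of convex representations -/

section Layers

variable {ι : Type*} {s : Finset ι} {z : ι → ℤ} {w : ι → ℝ} {k : ℤ}

theorem sum_two_layers (h : ∀ i ∈ s, w i ≠ 0 → z i = k ∨ z i = k + 1) (f : ι → ℝ) :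
    ∑ i ∈ s, w i * f i =
      ∑ i ∈ s.filter (fun i => z i = k + 1), w i * f i +
        ∑ i ∈ s.filter (fun i => z i = k), w i * f i := by
  classical
  rw [← Finset.sum_union]
  · refine (Finset.sum_subset ?_ ?_).symm
    · intro i hi
      rcases Finset.mem_union.1 hi with hi | hi <;> exact (Finset.mem_filter.1 hi).1
    · intro i hi hi'
      by_cases h0 : w i = 0
      · simp [h0]
      · rcases h i hi h0 with h1 | h1
        · exact absurd (Finset.mem_union_right _ (Finset.mem_filter.2 ⟨hi, h1⟩)) hi'
        · exact absurd (Finset.mem_union_left _ (Finset.mem_filter.2 ⟨hi, h1⟩)) hi'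
  · rw [Finset.disjoint_left]
    intro a ha hb
    have := (Finset.mem_filter.1 ha).2
    have := (Finset.mem_filter.1 hb).2
    omega

/-- The weighted mean of the heights lies in `[k, k + 1)`, and heights of nonzero weight differ by
at most one. A height below `k` would keep all the others at most `k` and pull the mean under `k`; a
height above `k + 1` would keep all the others at least `k + 1`. -/
theorem layer_support (hw : ∀ i ∈ s, 0 ≤ w i)
    (hz : ∀ i ∈ s, ∀ j ∈ s, w i ≠ 0 → w j ≠ 0 → z i ≤ z j + 1)
    (h1 : (∑ i ∈ s, w i) * k ≤ ∑ i ∈ s, w i * (z i : ℝ))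
    (h2 : ∑ i ∈ s, w i * (z i : ℝ) < (∑ i ∈ s, w i) * (k + 1)) :
    ∀ i ∈ s, w i ≠ 0 → z i = k ∨ z i = k + 1 := by
  intro i hi h0
  by_contra hcon
  have hlt : z i + 1 ≤ k ∨ k + 2 ≤ z i := by omega
  rcases hlt with hlt | hlt
  · have h3 : ∀ j ∈ s, 0 ≤ w j * ((k : ℝ) - z j) := by
      intro j hj
      by_cases hj0 : w j = 0
      · simp [hj0]
      · have : (z j : ℝ) ≤ k := by exact_mod_cast (hz j hj i hi hj0 h0).trans hlt
        exact mul_nonneg (hw j hj) (by linarith)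
    have h4 := Finset.single_le_sum h3 hi
    simp only [mul_sub, Finset.sum_sub_distrib, ← Finset.sum_mul] at h4
    have h5 : 0 < w i := lt_of_le_of_ne (hw i hi) (Ne.symm h0)
    have h6 : (z i : ℝ) + 1 ≤ k := by exact_mod_cast hlt
    nlinarith
  · have h3 : ∀ j ∈ s, 0 ≤ w j * ((z j : ℝ) - (k + 1)) := by
      intro j hj
      by_cases hj0 : w j = 0
      · simp [hj0]
      · have h7 := hz i hi j hj h0 hj0
        have : ((k + 1 : ℤ) : ℝ) ≤ z j := by exact_mod_cast (by omega : k + 1 ≤ z j)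
        push_cast at this
        exact mul_nonneg (hw j hj) (by linarith)
    have h4 := Finset.sum_nonneg h3
    simp only [mul_sub, Finset.sum_sub_distrib, ← Finset.sum_mul] at h4
    linarith

/-- Only the upper layer contributes to the excess of the mean height over `k`. -/
theorem upper_layer_weight (h : ∀ i ∈ s, w i ≠ 0 → z i = k ∨ z i = k + 1) :
    ∑ i ∈ s.filter (fun i => z i = k + 1), w i =
      ∑ i ∈ s, w i * (z i : ℝ) - (∑ i ∈ s, w i) * k := by
  have h1 := sum_two_layers h (fun i => (z i : ℝ))
  have h2 := sum_two_layers h (fun _ => 1)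
  have eA : ∑ i ∈ s.filter (fun i => z i = k + 1), w i * (z i : ℝ) =
      (∑ i ∈ s.filter (fun i => z i = k + 1), w i) * (k + 1) := by
    rw [Finset.sum_mul]
    refine Finset.sum_congr rfl fun a ha => ?_
    rw [(Finset.mem_filter.1 ha).2]; push_cast; ring
  have eB : ∑ i ∈ s.filter (fun i => z i = k), w i * (z i : ℝ) =
      (∑ i ∈ s.filter (fun i => z i = k), w i) * k := by
    rw [Finset.sum_mul]
    refine Finset.sum_congr rfl fun a ha => ?_
    rw [(Finset.mem_filter.1 ha).2]
  simp only [mul_one] at h2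
  rw [h1, h2, eA, eB]
  ring

end Layers

/-- A point has at most one representation as a combination with positive coefficients of pairwise
compatible points. -/
theorem weights_unique {ι : Type*} : ∀ (N : ℕ) (s : Finset ι) (x : ι → Fin N → ℤ) (w u : ι → ℝ)
    (D : ℤ), Set.InjOn x s → (∀ i ∈ s, ∀ k, 0 ≤ x i k) → (∀ i ∈ s, ∑ k, x i k = D) →
    (∀ i ∈ s, 0 ≤ w i) → (∀ i ∈ s, 0 ≤ u i) →
    (∀ i ∈ s, ∀ j ∈ s, w i ≠ 0 → w j ≠ 0 → Compat (x i) (x j)) →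
    (∀ i ∈ s, ∀ j ∈ s, u i ≠ 0 → u j ≠ 0 → Compat (x i) (x j)) →
    ∑ i ∈ s, w i = ∑ i ∈ s, u i →
    (∀ k, ∑ i ∈ s, w i * (x i k : ℝ) = ∑ i ∈ s, u i * (x i k : ℝ)) → ∀ i ∈ s, w i = u i := by
  classical
  intro N
  induction N with
  | zero =>
    intro s x w u D hinj _ _ _ _ _ _ h0 _ i hi
    have : s = {i} := Finset.eq_singleton_iff_unique_mem.2
      ⟨hi, fun j hj => hinj hj hi (Subsingleton.elim _ _)⟩
    simpa [this] using h0
  | succ N ih =>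
    intro s x w u D hinj hx hD hw hu hcw hcu h0 h1
    rcases (Finset.sum_nonneg hw).eq_or_lt' with hm | hm
    · have e1 := (Finset.sum_eq_zero_iff_of_nonneg hw).1 hm
      have e2 := (Finset.sum_eq_zero_iff_of_nonneg hu).1 (h0 ▸ hm)
      intro i hi
      rw [e1 i hi, e2 i hi]
    set z : ι → ℤ := fun i => x i (Fin.last N) with hz
    set m := ∑ i ∈ s, w i with hmdef
    set M := ∑ i ∈ s, w i * (z i : ℝ) with hMdef
    -- The mean height is the same for `w` and for `u`, so its floor selects the same two layers for
    -- both.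
    set k : ℤ := ⌊M / m⌋ with hk
    have hk1 : m * k ≤ M := by
      have := Int.floor_le (M / m)
      rw [le_div_iff₀ hm] at this
      rw [mul_comm]; exact this
    have hk2 : M < m * (k + 1) := by
      have := Int.lt_floor_add_one (M / m)
      rw [div_lt_iff₀ hm] at this
      rw [mul_comm]; exact this
    have hM' : M = ∑ i ∈ s, u i * (z i : ℝ) := h1 (Fin.last N)
    have hlast : ∀ {y y' : Fin (N + 1) → ℤ}, Compat y y' → y (Fin.last N) ≤ y' (Fin.last N) + 1 :=
      fun h => by rcases h.last_cases with h | h | h <;> omega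
    have sw := layer_support (z := z) hw (fun i hi j hj a b => hlast (hcw i hi j hj a b)) hk1 hk2
    have su := layer_support (z := z) (k := k) hu
      (fun i hi j hj a b => hlast (hcu i hi j hj a b))
      (by rw [← hM', ← h0]; exact hk1) (by rw [← hM', ← h0]; exact hk2)
    set A := s.filter fun i => z i = k + 1 with hA
    set B := s.filter fun i => z i = k with hB
    have hAm : ∀ {a}, a ∈ A → a ∈ s ∧ x a (Fin.last N) = k + 1 := fun h => Finset.mem_filter.1 h
    have hBm : ∀ {a}, a ∈ B → a ∈ s ∧ x a (Fin.last N) = k := fun h => Finset.mem_filter.1 h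
    have hDA : ∀ a ∈ A, ∑ j, lower (x a) j = D - (k + 1) := fun a ha => by
      rw [sum_lower, hD a (hAm ha).1, (hAm ha).2]
    have hDB : ∀ a ∈ B, ∑ j, lower (x a) j = D - k := fun a ha => by
      rw [sum_lower, hD a (hBm ha).1, (hBm ha).2]
    have hwA : ∑ i ∈ A, w i = ∑ i ∈ A, u i := by
      rw [hA, upper_layer_weight sw, upper_layer_weight su, ← hM', ← h0]
    have hwB : ∑ i ∈ B, w i = ∑ i ∈ B, u i := by
      have e1 := sum_two_layers sw (fun _ => 1)
      have e2 := sum_two_layers su (fun _ => 1)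
      simp only [mul_one] at e1 e2
      rw [← hA, ← hB] at e1 e2
      linarith
    have tot : ∀ v : ι → ℝ, ∑ j, ∑ i ∈ A, v i * ((lower (x i) j : ℤ) : ℝ) =
        (∑ i ∈ A, v i) * (D - (k + 1) : ℤ) := by
      intro v
      rw [Finset.sum_comm, Finset.sum_mul]
      refine Finset.sum_congr rfl fun i hi => ?_
      rw [← Finset.mul_sum, ← hDA i hi]
      push_cast
      ring
    have nonneg : ∀ v : ι → ℝ, (∀ i ∈ s, 0 ≤ v i) → ∀ T ⊆ s, ∀ j,
        0 ≤ ∑ i ∈ T, v i * ((lower (x i) j : ℤ) : ℝ) := fun v hv T hT j =>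
      Finset.sum_nonneg fun i hi => mul_nonneg (hv i (hT hi)) (by exact_mod_cast hx i (hT hi) _)
    have hAs : A ⊆ s := Finset.filter_subset _ _
    have hBs : B ⊆ s := Finset.filter_subset _ _
    have hmoments : (fun j => ∑ i ∈ A, w i * ((lower (x i) j : ℤ) : ℝ)) =
        fun j => ∑ i ∈ A, u i * ((lower (x i) j : ℤ) : ℝ) := by
      have hsum : ∀ j, ∑ i ∈ A, w i * ((lower (x i) j : ℤ) : ℝ) +
          ∑ i ∈ B, w i * ((lower (x i) j : ℤ) : ℝ) =
          ∑ i ∈ A, u i * ((lower (x i) j : ℤ) : ℝ) +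
          ∑ i ∈ B, u i * ((lower (x i) j : ℤ) : ℝ) := fun j => by
        have e1 := sum_two_layers sw (fun i => ((lower (x i) j : ℤ) : ℝ))
        have e2 := sum_two_layers su (fun i => ((lower (x i) j : ℤ) : ℝ))
        rw [← hA, ← hB] at e1 e2
        rw [← e1, ← e2]
        exact h1 j.castSucc
      have ord : ∀ v : ι → ℝ, (∀ i ∈ s, ∀ j ∈ s, v i ≠ 0 → v j ≠ 0 → Compat (x i) (x j)) →
          ∀ a b, ∑ i ∈ A, v i * ((lower (x i) a : ℤ) : ℝ) ≠ 0 →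
            ∑ i ∈ B, v i * ((lower (x i) b : ℤ) : ℝ) ≠ 0 →
            (Even (D - (k + 1)) → a ≤ b) ∧ (¬ Even (D - (k + 1)) → b ≤ a) := by
        intro v hv a b ha hb
        obtain ⟨i, hi, hi'⟩ := Finset.exists_ne_zero_of_sum_ne_zero ha
        obtain ⟨j, hj, hj'⟩ := Finset.exists_ne_zero_of_sum_ne_zero hb
        have h2 := (hv i (hAs hi) j (hBs hj) (left_ne_zero_of_mul hi')
          (left_ne_zero_of_mul hj')).layer_of_eq (by rw [(hAm hi).2, (hBm hj).2])
        have hi2 : lower (x i) a ≠ 0 := by exact_mod_cast right_ne_zero_of_mul hi'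
        have hj2 : lower (x j) b ≠ 0 := by exact_mod_cast right_ne_zero_of_mul hj'
        rw [LayerCompat, hDA i hi] at h2
        exact ⟨fun hE => h2.1 hE a b hi2 hj2, fun hE => h2.2 hE a b hi2 hj2⟩
      -- The parity of the size of the upper layer gives the direction in which the supports are
      -- ordered; the odd case is the uniqueness of splittings for the reversed order on the
      -- indices.
      by_cases hE : Even (D - (k + 1))
      · exact split_unique (nonneg w hw A hAs) (nonneg w hw B hBs) (nonneg u hu A hAs)
          (nonneg u hu B hBs) hsum (by rw [tot, tot, hwA])
          (fun a b ha hb => (ord w hcw a b ha hb).1 hE)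
          (fun a b ha hb => (ord u hcu a b ha hb).1 hE)
      · exact split_unique (ι := (Fin N)ᵒᵈ) (nonneg w hw A hAs) (nonneg w hw B hBs)
          (nonneg u hu A hAs)
          (nonneg u hu B hBs) hsum ((tot w).trans ((congrArg (· * _) hwA).trans (tot u).symm))
          (fun a b ha hb => (ord w hcw a b ha hb).2 hE)
          (fun a b ha hb => (ord u hcu a b ha hb).2 hE)
    have hmomB : ∀ j, ∑ i ∈ B, w i * ((lower (x i) j : ℤ) : ℝ) =
        ∑ i ∈ B, u i * ((lower (x i) j : ℤ) : ℝ) := fun j => by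
      have e1 := sum_two_layers sw (fun i => ((lower (x i) j : ℤ) : ℝ))
      have e2 := sum_two_layers su (fun i => ((lower (x i) j : ℤ) : ℝ))
      have e3 := congrFun hmoments j
      have e4 := h1 j.castSucc
      simp only [lower] at e1 e2 e3 ⊢
      rw [← hA, ← hB] at e1 e2
      linarith
    have step : ∀ T : Finset ι, ∀ c : ℤ, (∀ i ∈ T, i ∈ s ∧ x i (Fin.last N) = c) →
        ∑ i ∈ T, w i = ∑ i ∈ T, u i →
        (∀ j, ∑ i ∈ T, w i * ((lower (x i) j : ℤ) : ℝ) =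
          ∑ i ∈ T, u i * ((lower (x i) j : ℤ) : ℝ)) → ∀ i ∈ T, w i = u i := by
      intro T c hT hT0 hT1
      refine ih T (fun a => lower (x a)) w u (D - c) ?_ ?_ ?_ ?_ ?_ ?_ ?_ hT0 hT1
      · intro a ha b hb hab
        exact hinj (hT a ha).1 (hT b hb).1
          (lower_injective ((hT a ha).2.trans (hT b hb).2.symm) hab)
      · exact fun i hi j => hx i (hT i hi).1 _
      · intro a ha
        rw [sum_lower, hD a (hT a ha).1, (hT a ha).2]
      · exact fun i hi => hw i (hT i hi).1
      · exact fun i hi => hu i (hT i hi).1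
      · exact fun a ha b hb h2 h3 => (hcw a (hT a ha).1 b (hT b hb).1 h2 h3).lower_of_eq
          ((hT a ha).2.trans (hT b hb).2.symm)
      · exact fun a ha b hb h2 h3 => (hcu a (hT a ha).1 b (hT b hb).1 h2 h3).lower_of_eq
          ((hT a ha).2.trans (hT b hb).2.symm)
    intro i hi
    by_cases hiA : z i = k + 1
    · exact step A (k + 1) (fun i hi => hAm hi) hwA (congrFun hmoments) i
        (Finset.mem_filter.2 ⟨hi, hiA⟩)
    by_cases hiB : z i = k
    · exact step B k (fun i hi => hBm hi) hwB hmomB i (Finset.mem_filter.2 ⟨hi, hiB⟩)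
    have e1 : w i = 0 := by
      by_contra h2
      exact (sw i hi h2).elim hiB hiA
    have e2 : u i = 0 := by
      by_contra h2
      exact (su i hi h2).elim hiB hiA
    rw [e1, e2]

/-- Every point of the size `d` simplex is a combination with positive coefficients of pairwise
compatible lattice points. -/
theorem exists_weights : ∀ (N : ℕ) (p : Fin N → ℝ) (d : ℕ), (∀ i, 0 ≤ p i) → ∑ i, p i = d →
    ∃ (s : Finset (Fin N → ℤ)) (w : (Fin N → ℤ) → ℝ),
      (∀ x ∈ s, ∀ y ∈ s, Compat x y) ∧ (∀ x ∈ s, ∀ k, 0 ≤ x k) ∧ (∀ x ∈ s, ∑ k, x k = d) ∧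
      (∀ x ∈ s, 0 < w x) ∧ ∑ x ∈ s, w x = 1 ∧ ∀ k, ∑ x ∈ s, w x * (x k : ℝ) = p k := by
  classical
  intro N
  induction N with
  | zero =>
    intro p d _ h
    have hd : d = 0 := by
      have : (0 : ℝ) = d := by simpa using h
      exact_mod_cast this.symm
    refine ⟨{Fin.elim0}, fun _ => 1, ?_, ?_, ?_, ?_, ?_, fun k => k.elim0⟩
    · intros; trivial
    · exact fun _ _ k => k.elim0
    · simp [hd]
    · simp
    · simp
  | succ N ih =>
    intro p d hp hpd
    have hpl := sum_lower p
    have hle : p (Fin.last N) ≤ d := by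
      rw [← hpd]; exact Finset.single_le_sum (fun i _ => hp i) (Finset.mem_univ _)
    set k : ℕ := ⌊p (Fin.last N)⌋₊ with hk
    have hk1 : (k : ℝ) ≤ p (Fin.last N) := Nat.floor_le (hp _)
    have hk2 : p (Fin.last N) < k + 1 := Nat.lt_floor_add_one _
    have inj : ∀ c : ℤ, Function.Injective fun x : Fin N → ℤ => (Fin.snoc x c : Fin (N + 1) → ℤ) :=
      fun c x y h => by
        funext i
        simpa using congrFun h i.castSucc
    have lsn : ∀ (c : ℤ) (x : Fin N → ℤ), lower (Fin.snoc x c : Fin (N + 1) → ℤ) = x := fun c x => by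
      funext i; simp [lower]
    -- A point of integral height lies in a layer and the recursion applies to it. Otherwise it is a
    -- mixture, with weights `t` and `1 - t`, of a point of the layer `k + 1` and a point of the
    -- layer `k`.
    rcases hk1.eq_or_lt with ht | ht
    · obtain ⟨s, w, h1, h2, h3, h4, h5, h6⟩ := ih (lower p) (d - k) (fun i => hp _) (by
        rw [hpl, hpd, ← ht, Nat.cast_sub (by exact_mod_cast ht ▸ hle)])
      have hkd : k ≤ d := by exact_mod_cast ht ▸ hle
      refine ⟨s.map ⟨_, inj k⟩, fun x => w (lower x), ?_, ?_, ?_, ?_, ?_, ?_⟩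
      · simp only [Finset.mem_map, Function.Embedding.coeFn_mk]
        rintro _ ⟨x, hx, rfl⟩ _ ⟨y, hy, rfl⟩
        refine Or.inl ⟨by simp, ?_⟩
        rw [lsn, lsn]
        exact h1 x hx y hy
      · simp only [Finset.mem_map, Function.Embedding.coeFn_mk]
        rintro _ ⟨x, hx, rfl⟩ i
        refine Fin.lastCases ?_ (fun j => ?_) i
        · simp
        · simpa using h2 x hx j
      · simp only [Finset.mem_map, Function.Embedding.coeFn_mk]
        rintro _ ⟨x, hx, rfl⟩
        simp only [Fin.sum_univ_castSucc, Fin.snoc_castSucc, Fin.snoc_last, h3 x hx]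
        push_cast [hkd]
        ring
      · simp only [Finset.mem_map, Function.Embedding.coeFn_mk]
        rintro _ ⟨x, hx, rfl⟩
        rw [lsn]
        exact h4 x hx
      · simpa [Finset.sum_map, lsn] using h5
      · intro i
        simp only [Finset.sum_map, Function.Embedding.coeFn_mk, lsn]
        refine Fin.lastCases ?_ (fun j => ?_) i
        · simp [← Finset.sum_mul, h5, ht]
        · simpa [lower] using h6 j
    · set t := p (Fin.last N) - k with htd
      have ht0 : 0 < t := by linarith
      have ht1 : 0 < 1 - t := by linarith
      have hkd : k + 1 ≤ d := by
        have : (k : ℝ) < d := lt_of_lt_of_le ht hle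
        exact_mod_cast this
      obtain ⟨q, hq⟩ : ∃ q : ℕ, d = q + (k + 1) := ⟨d - (k + 1), by omega⟩
      have hqr : (d : ℝ) = q + (k + 1) := by rw [hq]; push_cast; ring
      -- The truncated points have sum `q` in the upper layer and `q + 1` in the lower one; these
      -- are the totals prescribed for the two shares.
      have hsum : ∑ i, lower p i = t * q + (1 - t) * (q + 1) := by
        rw [hpl, hpd, hqr, htd]; ring
      obtain ⟨α, hα0, hαp, hαs, hαo⟩ : ∃ α : Fin N → ℝ, (∀ i, 0 ≤ α i) ∧ (∀ i, α i ≤ lower p i) ∧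
          ∑ i, α i = t * q ∧ ∀ i j, α i ≠ 0 → lower p j - α j ≠ 0 →
            ((Even (q : ℤ) → i ≤ j) ∧ (¬ Even (q : ℤ) → j ≤ i)) := by
        by_cases hE : Even (q : ℤ)
        · obtain ⟨α, h1, h2, h3, h4⟩ := exists_split (lower p) (t * q) (fun i => hp _)
            (by positivity) (by rw [hsum]; nlinarith [(Nat.cast_nonneg q : (0 : ℝ) ≤ q)])
          exact ⟨α, h1, h2, h3, fun i j hi hj => ⟨fun _ => h4 i j hi hj, fun h => absurd hE h⟩⟩
        -- For odd `q` the share of the lower layer comes first in the order, so it is the one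
        -- produced by the splitting, and the upper share is its complement.
        · obtain ⟨α, h1, h2, h3, h4⟩ := exists_split (lower p) ((1 - t) * (q + 1)) (fun i => hp _)
            (by positivity) (by rw [hsum]; nlinarith [(Nat.cast_nonneg q : (0 : ℝ) ≤ q)])
          refine ⟨fun i => lower p i - α i, fun i => by linarith [h2 i], fun i => by linarith [h1 i],
            ?_, fun i j hi hj => ⟨fun h => absurd h hE, fun _ => h4 j i ?_ hi⟩⟩
          · rw [Finset.sum_sub_distrib, h3, hsum]; ring
          · simpa using hj
      obtain ⟨sA, wA, a1, a2, a3, a4, a5, a6⟩ := ih (fun i => α i / t) q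
        (fun i => div_nonneg (hα0 i) ht0.le) (by rw [← Finset.sum_div, hαs]; field_simp)
      obtain ⟨sB, wB, b1, b2, b3, b4, b5, b6⟩ := ih (fun i => (lower p i - α i) / (1 - t)) (q + 1)
        (fun i => div_nonneg (by linarith [hαp i]) ht1.le) (by
          rw [← Finset.sum_div, Finset.sum_sub_distrib, hαs, hsum]; push_cast; field_simp; ring)
      -- There is no cancellation between nonnegative points: an index used by one point is used by
      -- the share, so the order of the shares is inherited by the individual points.
      have pos : ∀ (S : Finset (Fin N → ℤ)) (W : (Fin N → ℤ) → ℝ), (∀ x ∈ S, ∀ k, 0 ≤ x k) →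
          (∀ x ∈ S, 0 < W x) → ∀ x ∈ S, ∀ i, x i ≠ 0 → ∑ y ∈ S, W y * (y i : ℝ) ≠ 0 := by
        intro S W h1 h2 x hx i hi
        refine ne_of_gt (Finset.sum_pos' (fun y hy => ?_) ⟨x, hx, ?_⟩)
        · exact mul_nonneg (h2 y hy).le (by exact_mod_cast h1 y hy i)
        · refine mul_pos (h2 x hx) ?_
          exact_mod_cast lt_of_le_of_ne (h1 x hx i) (Ne.symm hi)
      have hAB : ∀ x ∈ sA, ∀ y ∈ sB, LayerCompat x y := by
        intro x hx y hy
        have h1 : ∀ i j, x i ≠ 0 → y j ≠ 0 →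
            ((Even (q : ℤ) → i ≤ j) ∧ (¬ Even (q : ℤ) → j ≤ i)) := by
          intro i j hi hj
          have h1 := pos sA wA a2 a4 x hx i hi
          have h2 := pos sB wB b2 b4 y hy j hj
          rw [a6] at h1
          rw [b6] at h2
          refine hαo i j (fun h => h1 (by simp [h])) (fun h => h2 (by simp [h]))
        rw [LayerCompat, a3 x hx]
        exact ⟨fun hE i j hi hj => (h1 i j hi hj).1 hE, fun hE i j hi hj => (h1 i j hi hj).2 hE⟩
      have hdisj : Disjoint (sA.map ⟨_, inj (k + 1)⟩) (sB.map ⟨_, inj k⟩) := by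
        rw [Finset.disjoint_left]
        simp only [Finset.mem_map, Function.Embedding.coeFn_mk]
        rintro _ ⟨x, hx, rfl⟩ ⟨y, hy, h⟩
        have := congrFun h (Fin.last N)
        simp at this
      set W : (Fin (N + 1) → ℤ) → ℝ := fun x =>
        if x (Fin.last N) = k then (1 - t) * wB (lower x) else t * wA (lower x) with hW
      have WA : ∀ x, W (Fin.snoc x ((k : ℤ) + 1)) = t * wA x := fun x => by simp [hW, lsn]
      have WB : ∀ x, W (Fin.snoc x (k : ℤ)) = (1 - t) * wB x := fun x => by simp [hW, lsn]
      have tot : ∀ f : (Fin (N + 1) → ℤ) → ℝ,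
          ∑ x ∈ sA.map ⟨_, inj (k + 1)⟩ ∪ sB.map ⟨_, inj k⟩, W x * f x =
          t * ∑ x ∈ sA, wA x * f (Fin.snoc x ((k : ℤ) + 1)) +
            (1 - t) * ∑ x ∈ sB, wB x * f (Fin.snoc x (k : ℤ)) := by
        intro f
        rw [Finset.sum_union hdisj, Finset.sum_map, Finset.sum_map, Finset.mul_sum, Finset.mul_sum]
        simp only [Function.Embedding.coeFn_mk, WA, WB, mul_assoc]
      refine ⟨sA.map ⟨_, inj (k + 1)⟩ ∪ sB.map ⟨_, inj k⟩, W, ?_, ?_, ?_, ?_, ?_, ?_⟩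
      · simp only [Finset.mem_union, Finset.mem_map, Function.Embedding.coeFn_mk]
        rintro _ (⟨x, hx, rfl⟩ | ⟨x, hx, rfl⟩) _ (⟨y, hy, rfl⟩ | ⟨y, hy, rfl⟩)
        · exact Or.inl ⟨by simp, by rw [lsn, lsn]; exact a1 x hx y hy⟩
        · exact Or.inr (Or.inl ⟨by simp, by rw [lsn, lsn]; exact hAB x hx y hy⟩)
        · exact Or.inr (Or.inr ⟨by simp, by rw [lsn, lsn]; exact hAB y hy x hx⟩)
        · exact Or.inl ⟨by simp, by rw [lsn, lsn]; exact b1 x hx y hy⟩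
      · simp only [Finset.mem_union, Finset.mem_map, Function.Embedding.coeFn_mk]
        rintro _ (⟨x, hx, rfl⟩ | ⟨x, hx, rfl⟩) i
        · refine Fin.lastCases ?_ (fun j => ?_) i
          · simp; omega
          · simpa using a2 x hx j
        · refine Fin.lastCases ?_ (fun j => ?_) i
          · simp
          · simpa using b2 x hx j
      · simp only [Finset.mem_union, Finset.mem_map, Function.Embedding.coeFn_mk]
        rintro _ (⟨x, hx, rfl⟩ | ⟨x, hx, rfl⟩)
        · simp only [Fin.sum_univ_castSucc, Fin.snoc_castSucc, Fin.snoc_last, a3 x hx]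
          rw [hq]; push_cast; ring
        · simp only [Fin.sum_univ_castSucc, Fin.snoc_castSucc, Fin.snoc_last, b3 x hx]
          rw [hq]; push_cast; ring
      · simp only [Finset.mem_union, Finset.mem_map, Function.Embedding.coeFn_mk]
        rintro _ (⟨x, hx, rfl⟩ | ⟨x, hx, rfl⟩)
        · rw [WA]; exact mul_pos ht0 (a4 x hx)
        · rw [WB]; exact mul_pos ht1 (b4 x hx)
      · have := tot fun _ => 1
        simp only [mul_one, a5, b5] at this
        rw [this]; ring
      · intro i
        rw [tot fun x => (x i : ℝ)]
        refine Fin.lastCases ?_ (fun j => ?_) i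
        · simp only [Fin.snoc_last, ← Finset.sum_mul, a5, b5]
          push_cast
          rw [htd]; ring
        · simp only [Fin.snoc_castSucc, a6, b6]
          rw [mul_div_cancel₀ _ ht0.ne', mul_div_cancel₀ _ ht1.ne']
          simp [lower]

/-! ### The Itenberg–Viro triangulation as a clique complex -/

/-- The cliques of the compatibility graph on the lattice points of the size `d` simplex. -/
def IsIVSimplex (n d : ℕ) (σ : Simplex n) : Prop :=
  σ.Nonempty ∧ (∀ x ∈ σ, ∀ i, 0 ≤ homCoord d x i) ∧
    ∀ x ∈ σ, ∀ y ∈ σ, Compat (homCoord d x) (homCoord d y)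

theorem homCoord_zero {R : Type*} [CommRing R] {n : ℕ} (d : ℕ) (x : Fin n → R) :
    homCoord d x 0 = d - ∑ i, x i := rfl

theorem homCoord_succ {R : Type*} [CommRing R] {n : ℕ} (d : ℕ) (x : Fin n → R) (i : Fin n) :
    homCoord d x i.succ = x i := rfl

theorem sum_homCoord {R : Type*} [CommRing R] {n : ℕ} (d : ℕ) (x : Fin n → R) :
    ∑ i, homCoord d x i = d := by
  rw [Fin.sum_univ_succ, homCoord_zero]
  simp [homCoord_succ]

theorem homCoord_injective {R : Type*} [CommRing R] {n : ℕ} (d : ℕ) :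
    Function.Injective (homCoord d : (Fin n → R) → Fin (n + 1) → R) := fun x y h => by
  funext i
  simpa [homCoord_succ] using congrFun h i.succ

theorem homCoord_last {R : Type*} [CommRing R] {n : ℕ} (d : ℕ) (x : Fin (n + 1) → R) :
    homCoord d x (Fin.last (n + 1)) = x (Fin.last n) := by
  rw [← Fin.succ_last, homCoord_succ]

/-- The size and the coordinate sum both increase by one, so `x₀` does not move: in homogeneous
coordinates the translation by `e_{n+1}` only raises the last entry. Compatibility depends on
heights only through their difference, so it is preserved. -/
theorem lower_homCoord_up {n : ℕ} (d : ℕ) (x : Fin (n + 1) → ℤ) :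
    lower (homCoord (d + 1) (x + Pi.single (Fin.last n) 1)) = lower (homCoord d x) := by
  funext i
  refine Fin.cases ?_ (fun i => ?_) i
  · simp only [lower, Fin.castSucc_zero, homCoord_zero, Pi.add_apply, Finset.sum_add_distrib]
    simp
  · simp only [lower, ← Fin.succ_castSucc, homCoord_succ, Pi.add_apply]
    rw [Pi.single_eq_of_ne (Fin.castSucc_lt_last i).ne, add_zero]

theorem last_homCoord_up {n : ℕ} (d : ℕ) (x : Fin (n + 1) → ℤ) :
    homCoord (d + 1) (x + Pi.single (Fin.last n) 1) (Fin.last (n + 1)) =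
      homCoord d x (Fin.last (n + 1)) + 1 := by
  simp [homCoord_last]

theorem lower_homCoord_snoc {n : ℕ} (d : ℕ) (x : Fin n → ℤ) :
    lower (homCoord d (Fin.snoc x 0 : Fin (n + 1) → ℤ)) = homCoord d x := by
  funext i
  refine Fin.cases ?_ (fun i => ?_) i
  · simp [lower, homCoord_zero, Fin.sum_univ_castSucc]
  · simp [lower, homCoord_succ]

theorem last_homCoord_snoc {n : ℕ} (d : ℕ) (x : Fin n → ℤ) :
    homCoord d (Fin.snoc x 0 : Fin (n + 1) → ℤ) (Fin.last (n + 1)) = 0 := by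
  simp [homCoord_last]

theorem compat_homCoord_up {n : ℕ} (d : ℕ) (x y : Fin (n + 1) → ℤ) :
    Compat (homCoord (d + 1) (x + Pi.single (Fin.last n) 1))
      (homCoord (d + 1) (y + Pi.single (Fin.last n) 1)) ↔
      Compat (homCoord d x) (homCoord d y) := by
  simp only [Compat, last_homCoord_up, lower_homCoord_up, add_left_inj]

theorem compat_homCoord_snoc {n : ℕ} (d : ℕ) (x y : Fin n → ℤ) :
    Compat (homCoord d (Fin.snoc x 0 : Fin (n + 1) → ℤ))
      (homCoord d (Fin.snoc y 0 : Fin (n + 1) → ℤ)) ↔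
      Compat (homCoord d x) (homCoord d y) := by
  simp only [Compat, last_homCoord_snoc, lower_homCoord_snoc]
  simp

theorem forall_fin_last {N : ℕ} {P : Fin (N + 1) → Prop} :
    (∀ i, P i) ↔ (∀ i : Fin N, P i.castSucc) ∧ P (Fin.last N) :=
  ⟨fun h => ⟨fun _ => h _, h _⟩, fun h i => Fin.lastCases h.2 h.1 i⟩

theorem homCoord_up_nonneg {n : ℕ} (d : ℕ) (x : Fin (n + 1) → ℤ)
    (h : ∀ i, 0 ≤ homCoord d x i) :
    ∀ i, 0 ≤ homCoord (d + 1) (x + Pi.single (Fin.last n) 1) i := by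
  rw [forall_fin_last] at h ⊢
  refine ⟨fun i => ?_, ?_⟩
  · change 0 ≤ lower (homCoord (d + 1) (x + Pi.single (Fin.last n) 1)) i
    rw [lower_homCoord_up]
    exact h.1 i
  · rw [last_homCoord_up]; have := h.2; omega

theorem homCoord_snoc_nonneg {n : ℕ} (d : ℕ) (x : Fin n → ℤ) :
    (∀ i, 0 ≤ homCoord d (Fin.snoc x 0 : Fin (n + 1) → ℤ) i) ↔ ∀ i, 0 ≤ homCoord d x i := by
  rw [forall_fin_last, last_homCoord_snoc]
  have : ∀ i : Fin (n + 1), homCoord d (Fin.snoc x 0 : Fin (n + 1) → ℤ) i.castSucc =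
    homCoord d x i := fun i => congrFun (lower_homCoord_snoc d x) i
  simp [this]

theorem eq_zero_of_sum_nonpos {N : ℕ} {x : Fin N → ℤ} (hx : ∀ i, 0 ≤ x i) (h : ∑ i, x i ≤ 0) :
    x = 0 := by
  funext i
  exact (Finset.sum_eq_zero_iff_of_nonneg fun i _ => hx i).1
    (le_antisymm h (Finset.sum_nonneg fun i _ => hx i)) i (Finset.mem_univ i)

/-- When the total is at most one, a point strictly higher than another has zero truncation, and the
order condition between the layers is void. This is the case of the simplex of size one, where all
vertices are joined. -/
theorem compat_of_sum_le_one : ∀ {N : ℕ} {x y : Fin N → ℤ}, (∀ i, 0 ≤ x i) → (∀ i, 0 ≤ y i) →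
    ∑ i, x i = ∑ i, y i → ∑ i, x i ≤ 1 → Compat x y
  | 0, _, _, _, _, _, _ => trivial
  | N + 1, x, y, hx, hy, hs, h1 => by
    have h2 := sum_lower x
    have h3 := sum_lower y
    have hx' : ∀ i, 0 ≤ lower x i := fun i => hx _
    have hy' : ∀ i, 0 ≤ lower y i := fun i => hy _
    have h4 := Finset.sum_nonneg fun i (_ : i ∈ Finset.univ) => hx' i
    have h5 := Finset.sum_nonneg fun i (_ : i ∈ Finset.univ) => hy' i
    have h6 := hx (Fin.last N)
    have h7 := hy (Fin.last N)
    rcases lt_trichotomy (x (Fin.last N)) (y (Fin.last N)) with h | h | h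
    · refine Or.inr (Or.inr ⟨by omega, ?_⟩)
      have : lower y = 0 := eq_zero_of_sum_nonpos hy' (by omega)
      rw [LayerCompat, this]
      exact ⟨fun _ _ _ h => absurd rfl h, fun _ _ _ h => absurd rfl h⟩
    · exact Or.inl ⟨h, compat_of_sum_le_one hx' hy' (by omega) (by omega)⟩
    · refine Or.inr (Or.inl ⟨by omega, ?_⟩)
      have : lower x = 0 := eq_zero_of_sum_nonpos hx' (by omega)
      rw [LayerCompat, this]
      exact ⟨fun _ _ _ h => absurd rfl h, fun _ _ _ h => absurd rfl h⟩

theorem homCoord_nonneg_iff {n d : ℕ} {x : Fin n → ℤ} :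
    (∀ i, 0 ≤ homCoord d x i) ↔ (∀ i, 0 ≤ x i) ∧ ∑ i, x i ≤ d := by
  constructor
  · intro h
    refine ⟨fun i => h i.succ, ?_⟩
    have := h 0
    rw [homCoord_zero] at this
    linarith
  · rintro ⟨h, h'⟩ i
    refine Fin.cases ?_ (fun i => h i) i
    rw [homCoord_zero]; linarith

theorem mem_unitSimplex {n : ℕ} (σ : Simplex n) : σ ∈ unitSimplex n ↔ IsIVSimplex n 1 σ := by
  have h1 : ∀ x : Fin n → ℤ, (x = 0 ∨ ∃ i, Pi.single i 1 = x) ↔ ∀ i, 0 ≤ homCoord 1 x i := by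
    intro x
    rw [homCoord_nonneg_iff]
    constructor
    · rintro (rfl | ⟨i, rfl⟩)
      · simp
      · refine ⟨fun j => ?_, by simp⟩
        rw [Pi.single_apply]; split_ifs <;> simp
    · rintro ⟨h, h'⟩
      by_cases h0 : ∃ i, x i ≠ 0
      · obtain ⟨i, hi⟩ := h0
        right
        refine ⟨i, ?_⟩
        have h2 := Finset.add_sum_erase Finset.univ x (Finset.mem_univ i)
        have h3 : ∀ j ∈ Finset.univ.erase i, 0 ≤ x j := fun j _ => h j
        have h4 := Finset.sum_nonneg h3
        have h5 := h i
        have h6 : x i = 1 := by push_cast at h'; omega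
        have h7 : ∑ j ∈ Finset.univ.erase i, x j = 0 := by push_cast at h'; omega
        funext j
        by_cases hj : j = i
        · subst hj; simp [h6]
        · rw [Pi.single_eq_of_ne hj]
          exact ((Finset.sum_eq_zero_iff_of_nonneg h3).1 h7 j (by simp [hj])).symm
      · push Not at h0
        exact Or.inl (funext h0)
  rw [unitSimplex, Finset.mem_erase, Finset.mem_powerset, IsIVSimplex, Finset.nonempty_iff_ne_empty]
  refine and_congr_right fun _ => ⟨fun h => ?_, fun h x hx => ?_⟩
  · have h2 : ∀ x ∈ σ, ∀ i, 0 ≤ homCoord 1 x i := fun x hx => (h1 x).1 (by simpa using h hx)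
    refine ⟨h2, fun x hx y hy => compat_of_sum_le_one (h2 x hx) (h2 y hy) ?_ ?_⟩
    · rw [sum_homCoord, sum_homCoord]
    · rw [sum_homCoord]; simp
  · simpa using (h1 x).2 (h.1 x hx)

theorem mem_join {n : ℕ} {A B : SComplex n} {σ : Simplex n} :
    σ ∈ join A B ↔ σ.Nonempty ∧ ∃ a ∈ insert ∅ A, ∃ b ∈ insert ∅ B, a ∪ b = σ := by
  rw [join, Finset.mem_erase, Finset.nonempty_iff_ne_empty, Finset.mem_image]
  refine and_congr_right fun _ => ⟨?_, ?_⟩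
  · rintro ⟨⟨a, b⟩, h, rfl⟩
    rw [Finset.mem_product] at h
    exact ⟨a, h.1, b, h.2, rfl⟩
  · rintro ⟨a, ha, b, hb, rfl⟩
    exact ⟨(a, b), Finset.mem_product.2 ⟨ha, hb⟩, rfl⟩

/-! ### One step of the recursion, for clique complexes -/

section AddLayer

variable {n d : ℕ} {K : SComplex (n + 1)} {L : SComplex n}

theorem mem_translateUp_iff (hK : ∀ σ, σ ∈ K ↔ IsIVSimplex (n + 1) d σ) {σ : Simplex (n + 1)} :
    σ ∈ translateUp K ↔ IsIVSimplex (n + 1) (d + 1) σ ∧ ∀ x ∈ σ, 1 ≤ x (Fin.last n) := by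
  rw [translateUp, Finset.mem_image]
  constructor
  · rintro ⟨τ, hτ, rfl⟩
    obtain ⟨h1, h2, h3⟩ := (hK τ).1 hτ
    refine ⟨⟨h1.image _, ?_, ?_⟩, ?_⟩
    · simp only [Finset.mem_image]
      rintro _ ⟨x, hx, rfl⟩
      exact homCoord_up_nonneg d x (h2 x hx)
    · simp only [Finset.mem_image]
      rintro _ ⟨x, hx, rfl⟩ _ ⟨y, hy, rfl⟩
      exact (compat_homCoord_up d x y).2 (h3 x hx y hy)
    · simp only [Finset.mem_image]
      rintro _ ⟨x, hx, rfl⟩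
      have := h2 x hx (Fin.last _)
      rw [homCoord_last] at this
      simpa using this
  · rintro ⟨⟨h1, h2, h3⟩, h4⟩
    refine ⟨σ.image fun x => x - Pi.single (Fin.last n) 1, (hK _).2 ⟨h1.image _, ?_, ?_⟩, ?_⟩
    · simp only [Finset.mem_image]
      rintro _ ⟨x, hx, rfl⟩
      have h5 := h2 x hx
      rw [forall_fin_last] at h5 ⊢
      refine ⟨fun i => ?_, ?_⟩
      · have h6 := lower_homCoord_up d (x - Pi.single (Fin.last n) 1)
        rw [sub_add_cancel] at h6
        have h7 := congrFun h6 i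
        simp only [lower] at h7
        rw [← h7]
        exact h5.1 i
      · rw [homCoord_last]
        simpa using h4 x hx
    · simp only [Finset.mem_image]
      rintro _ ⟨x, hx, rfl⟩ _ ⟨y, hy, rfl⟩
      rw [← compat_homCoord_up, sub_add_cancel, sub_add_cancel]
      exact h3 x hx y hy
    · rw [Finset.image_image]
      simp [Function.comp_def]

/-- Adjoining `∅` covers the joins in which one factor is absent. The face `J` never involves the
last vertex, so before the translation the height is `0`, and after it `1`. -/
theorem mem_upper_face (hK : ∀ σ, σ ∈ K ↔ IsIVSimplex (n + 1) d σ) {J : Finset (Fin (n + 1))}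
    {σ : Simplex (n + 1)} :
    σ ∈ insert ∅ (translateUp (restrictFace d K (J.map Fin.castSuccEmb))) ↔
      (∀ x ∈ σ, ∀ i, 0 ≤ homCoord (d + 1) x i) ∧
      (∀ x ∈ σ, ∀ y ∈ σ, Compat (homCoord (d + 1) x) (homCoord (d + 1) y)) ∧
      ∀ x ∈ σ, x (Fin.last n) = 1 ∧ ∀ j ∉ J, lower (homCoord (d + 1) x) j = 0 := by
  rcases σ.eq_empty_or_nonempty with rfl | hne
  · simp
  rw [Finset.mem_insert, or_iff_right hne.ne_empty]
  constructor
  · intro h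
    have h1 : σ ∈ translateUp K := by
      obtain ⟨τ, hτ, rfl⟩ := Finset.mem_image.1 h
      exact Finset.mem_image.2 ⟨τ, (Finset.mem_filter.1 hτ).1, rfl⟩
    obtain ⟨⟨-, h2, h3⟩, -⟩ := (mem_translateUp_iff hK).1 h1
    refine ⟨h2, h3, ?_⟩
    obtain ⟨τ, hτ, rfl⟩ := Finset.mem_image.1 h
    have h4 := (Finset.mem_filter.1 hτ).2
    simp only [Finset.mem_image]
    rintro _ ⟨x, hx, rfl⟩
    have h5 := h4 x hx (Fin.last _) (by simp [Fin.castSucc_ne_last])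
    rw [homCoord_last] at h5
    refine ⟨by simp [h5], fun j hj => ?_⟩
    rw [lower_homCoord_up]
    exact h4 x hx _ (by simpa using hj)
  · rintro ⟨h1, h2, h3⟩
    have h4 : σ ∈ translateUp K := (mem_translateUp_iff hK).2
      ⟨⟨hne, h1, h2⟩, fun x hx => (h3 x hx).1.ge⟩
    obtain ⟨τ, hτ, rfl⟩ := Finset.mem_image.1 h4
    refine Finset.mem_image.2 ⟨τ, Finset.mem_filter.2 ⟨hτ, fun x hx j hj => ?_⟩, rfl⟩
    have h5 := h3 _ (Finset.mem_image_of_mem _ hx)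
    rw [lower_homCoord_up] at h5
    revert hj
    refine Fin.lastCases (fun _ => ?_) (fun j hj => ?_) j
    · rw [homCoord_last]
      simpa using h5.1
    · exact h5.2 j (by simpa using hj)

theorem mem_lower_face (hL : ∀ σ, σ ∈ L ↔ IsIVSimplex n (d + 1) σ) {J : Finset (Fin (n + 1))}
    {σ : Simplex (n + 1)} :
    σ ∈ insert ∅ (inclBottom (restrictFace (d + 1) L J)) ↔
      (∀ x ∈ σ, ∀ i, 0 ≤ homCoord (d + 1) x i) ∧
      (∀ x ∈ σ, ∀ y ∈ σ, Compat (homCoord (d + 1) x) (homCoord (d + 1) y)) ∧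
      ∀ x ∈ σ, x (Fin.last n) = 0 ∧ ∀ j ∉ J, lower (homCoord (d + 1) x) j = 0 := by
  rcases σ.eq_empty_or_nonempty with rfl | hne
  · simp
  rw [Finset.mem_insert, or_iff_right hne.ne_empty]
  constructor
  · intro h
    obtain ⟨τ, hτ, rfl⟩ := Finset.mem_image.1 h
    obtain ⟨hτ, h4⟩ := Finset.mem_filter.1 hτ
    obtain ⟨-, h2, h3⟩ := (hL τ).1 hτ
    simp only [Finset.mem_image]
    refine ⟨?_, ?_, ?_⟩
    · rintro _ ⟨x, hx, rfl⟩
      exact (homCoord_snoc_nonneg _ x).2 (h2 x hx)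
    · rintro _ ⟨x, hx, rfl⟩ _ ⟨y, hy, rfl⟩
      exact (compat_homCoord_snoc _ x y).2 (h3 x hx y hy)
    · rintro _ ⟨x, hx, rfl⟩
      refine ⟨by simp, fun j hj => ?_⟩
      rw [lower_homCoord_snoc]
      exact h4 x hx j hj
  · rintro ⟨h1, h2, h3⟩
    have h5 : ∀ x ∈ σ, (Fin.snoc (lower x) 0 : Fin (n + 1) → ℤ) = x := fun x hx => by
      rw [← (h3 x hx).1]
      exact Fin.snoc_init_self x
    refine Finset.mem_image.2 ⟨σ.image lower, Finset.mem_filter.2 ⟨(hL _).2 ⟨hne.image _, ?_, ?_⟩,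
      ?_⟩, ?_⟩
    · simp only [Finset.mem_image]
      rintro _ ⟨x, hx, rfl⟩
      rw [← homCoord_snoc_nonneg, h5 x hx]
      exact h1 x hx
    · simp only [Finset.mem_image]
      rintro _ ⟨x, hx, rfl⟩ _ ⟨y, hy, rfl⟩
      rw [← compat_homCoord_snoc, h5 x hx, h5 y hy]
      exact h2 x hx y hy
    · simp only [Finset.mem_image]
      rintro _ ⟨x, hx, rfl⟩ j hj
      rw [← lower_homCoord_snoc, h5 x hx]
      exact (h3 x hx).2 j hj
    · rw [Finset.image_image]
      conv_rhs => rw [← Finset.image_id (s := σ)]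
      exact Finset.image_congr fun x hx => h5 x hx

/-- The recursion defining `addLayer` is satisfied by the clique complexes. -/
theorem mem_addLayer (hK : ∀ σ, σ ∈ K ↔ IsIVSimplex (n + 1) d σ)
    (hL : ∀ σ, σ ∈ L ↔ IsIVSimplex n (d + 1) σ) (σ : Simplex (n + 1)) :
    σ ∈ addLayer d d K L ↔ IsIVSimplex (n + 1) (d + 1) σ := by
  have hm : ∀ i : Fin (n + 1), (Finset.Iic i).map Fin.castSuccEmb = Finset.Iic i.castSucc := by
    intro i
    ext j
    simp only [Finset.mem_map, Finset.mem_Iic, Fin.coe_castSuccEmb]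
    constructor
    · rintro ⟨k, hk, rfl⟩; exact Fin.castSucc_le_castSucc_iff.2 hk
    · intro hj
      refine ⟨j.castPred (fun h => ?_), ?_, by simp⟩
      · rw [h] at hj; exact absurd hj (not_le.2 (Fin.castSucc_lt_last i))
      · rw [Fin.le_def] at hj ⊢; simpa using hj
  have hm' : ∀ i : Fin (n + 1), (Finset.Ici i).map Fin.castSuccEmb =
      Finset.Ico i.castSucc (Fin.last (n + 1)) := by
    intro i
    ext j
    simp only [Finset.mem_map, Finset.mem_Ici, Finset.mem_Ico, Fin.coe_castSuccEmb]
    constructor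
    · rintro ⟨k, hk, rfl⟩; exact ⟨Fin.castSucc_le_castSucc_iff.2 hk, Fin.castSucc_lt_last k⟩
    · intro hj
      refine ⟨j.castPred hj.2.ne, ?_, by simp⟩
      have := hj.1
      rw [Fin.le_def] at this ⊢; simpa using this
  have hsum : ∀ x : Fin (n + 1) → ℤ, x (Fin.last n) = 1 →
      ∑ i, lower (homCoord (d + 1) x) i = d := fun x hx => by
    rw [sum_lower, sum_homCoord, homCoord_last, hx]; push_cast; ring
  rw [addLayer, Finset.mem_union, mem_translateUp_iff hK, Finset.mem_biUnion]
  -- Parity enters only through the order hypothesis on `JA` and `JB`, so this covers both branches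
  -- of the definition.
  have aux : ∀ (A B : Simplex (n + 1)) (JA JB : Finset (Fin (n + 1))), (A ∪ B).Nonempty →
      A ∈ insert ∅ (translateUp (restrictFace d K (JA.map Fin.castSuccEmb))) →
      B ∈ insert ∅ (inclBottom (restrictFace (d + 1) L JB)) →
      (∀ i ∈ JA, ∀ j ∈ JB, (Even (d : ℤ) → i ≤ j) ∧ (¬ Even (d : ℤ) → j ≤ i)) →
      IsIVSimplex (n + 1) (d + 1) (A ∪ B) := by
    intro A B JA JB hne hA hB hJ
    obtain ⟨a1, a2, a3⟩ := (mem_upper_face hK).1 hA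
    obtain ⟨b1, b2, b3⟩ := (mem_lower_face hL).1 hB
    have hAB : ∀ x ∈ A, ∀ y ∈ B,
        LayerCompat (lower (homCoord (d + 1) x)) (lower (homCoord (d + 1) y)) := by
      intro x hx y hy
      rw [LayerCompat, hsum x (a3 x hx).1]
      have h1 : ∀ i j, lower (homCoord (d + 1) x) i ≠ 0 → lower (homCoord (d + 1) y) j ≠ 0 →
          (Even (d : ℤ) → i ≤ j) ∧ (¬ Even (d : ℤ) → j ≤ i) := fun i j hi hj =>
        hJ i (by by_contra h; exact hi ((a3 x hx).2 i h)) j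
          (by by_contra h; exact hj ((b3 y hy).2 j h))
      exact ⟨fun hE i j hi hj => (h1 i j hi hj).1 hE, fun hE i j hi hj => (h1 i j hi hj).2 hE⟩
    refine ⟨hne, ?_, ?_⟩
    · intro x hx
      exact (Finset.mem_union.1 hx).elim (a1 x) (b1 x)
    · intro x hx y hy
      have hl : ∀ x ∈ A, ∀ y ∈ B, homCoord (d + 1) x (Fin.last (n + 1)) =
          homCoord (d + 1) y (Fin.last (n + 1)) + 1 := fun x hx y hy => by
        rw [homCoord_last, homCoord_last, (a3 x hx).1, (b3 y hy).1]; rfl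
      rcases Finset.mem_union.1 hx with hx | hx <;> rcases Finset.mem_union.1 hy with hy | hy
      · exact a2 x hx y hy
      · exact Or.inr (Or.inl ⟨hl x hx y hy, hAB x hx y hy⟩)
      · exact Or.inr (Or.inr ⟨hl y hy x hx, hAB y hy x hx⟩)
      · exact b2 x hx y hy
  constructor
  · rintro (h | ⟨i, -, h⟩)
    · exact h.1
    · split_ifs at h with hE
      · obtain ⟨hne, A, hA, B, hB, rfl⟩ := mem_join.1 h
        refine aux A B (Finset.Iic i) (Finset.Ici i) hne (by rwa [hm]) hB fun j hj k hk =>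
          ⟨fun _ => ?_, fun h => absurd ((Int.even_coe_nat d).2 hE) h⟩
        exact (Finset.mem_Iic.1 hj).trans (Finset.mem_Ici.1 hk)
      · obtain ⟨hne, A, hA, B, hB, rfl⟩ := mem_join.1 h
        refine aux A B (Finset.Ici i) (Finset.Iic i) hne (by rwa [hm']) hB fun j hj k hk =>
          ⟨fun h => absurd ((Int.even_coe_nat d).1 h) hE, fun _ => ?_⟩
        exact (Finset.mem_Iic.1 hk).trans (Finset.mem_Ici.1 hj)
  · rintro ⟨h1, h2, h3⟩
    -- A clique off the bottom hyperplane is a translate. If some vertex has height `0`, all heights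
    -- are `0` or `1` and the clique is a join.
    by_cases h4 : ∀ x ∈ σ, 1 ≤ x (Fin.last n)
    · exact Or.inl ⟨⟨h1, h2, h3⟩, h4⟩
    right
    push Not at h4
    obtain ⟨z, hz, hz1⟩ := h4
    have hlast : ∀ x ∈ σ, 0 ≤ x (Fin.last n) := fun x hx => by
      have := h2 x hx (Fin.last _); rwa [homCoord_last] at this
    have hz0 : z (Fin.last n) = 0 := by have := hlast z hz; omega
    set A := σ.filter fun x => x (Fin.last n) = 1 with hA
    set B := σ.filter fun x => x (Fin.last n) = 0 with hB
    have hAB : A ∪ B = σ := by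
      ext x
      simp only [hA, hB, Finset.mem_union, Finset.mem_filter]
      refine ⟨fun h => h.elim (·.1) (·.1), fun hx => ?_⟩
      have := (h3 x hx z hz).last_cases
      rw [homCoord_last, homCoord_last, hz0] at this
      have := hlast x hx
      rcases (show x (Fin.last n) = 0 ∨ x (Fin.last n) = 1 by omega) with h | h
      · exact Or.inr ⟨hx, h⟩
      · exact Or.inl ⟨hx, h⟩
    have hlay : ∀ x ∈ A, ∀ y ∈ B,
        LayerCompat (lower (homCoord (d + 1) x)) (lower (homCoord (d + 1) y)) := by
      intro x hx y hy
      obtain ⟨hx, hx1⟩ := Finset.mem_filter.1 hx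
      obtain ⟨hy, hy1⟩ := Finset.mem_filter.1 hy
      exact (h3 x hx y hy).layer_of_eq (by rw [homCoord_last, homCoord_last, hx1, hy1]; rfl)
    have upper : ∀ J : Finset (Fin (n + 1)),
        (∀ x ∈ A, ∀ j, lower (homCoord (d + 1) x) j ≠ 0 → j ∈ J) →
        A ∈ insert ∅ (translateUp (restrictFace d K (J.map Fin.castSuccEmb))) := fun J hJ =>
      (mem_upper_face hK).2 ⟨fun x hx => h2 x (Finset.mem_filter.1 hx).1,
        fun x hx y hy => h3 x (Finset.mem_filter.1 hx).1 y (Finset.mem_filter.1 hy).1,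
        fun x hx => ⟨(Finset.mem_filter.1 hx).2, fun j hj => by
          by_contra h; exact hj (hJ x hx j h)⟩⟩
    have lowr : ∀ J : Finset (Fin (n + 1)),
        (∀ x ∈ B, ∀ j, lower (homCoord (d + 1) x) j ≠ 0 → j ∈ J) →
        B ∈ insert ∅ (inclBottom (restrictFace (d + 1) L J)) := fun J hJ =>
      (mem_lower_face hL).2 ⟨fun x hx => h2 x (Finset.mem_filter.1 hx).1,
        fun x hx y hy => h3 x (Finset.mem_filter.1 hx).1 y (Finset.mem_filter.1 hy).1,
        fun x hx => ⟨(Finset.mem_filter.1 hx).2, fun j hj => by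
          by_contra h; exact hj (hJ x hx j h)⟩⟩
    set T : Finset (Fin (n + 1)) :=
      Finset.univ.filter fun j => ∃ x ∈ A, lower (homCoord (d + 1) x) j ≠ 0 with hT
    have hTm : ∀ {j}, j ∈ T ↔ ∃ x ∈ A, lower (homCoord (d + 1) x) j ≠ 0 := by simp [hT]
    -- The pivot of the join is the extreme index used by the upper part, on the side of the lower
    -- part: the largest one for even `d`, the smallest one for odd `d`. If the upper part uses no
    -- index, the pivot is the end for which the lower face is everything.
    by_cases hE : Even d
    · obtain ⟨i, hi1, hi2⟩ : ∃ i, (∀ j ∈ T, j ≤ i) ∧ (i = 0 ∨ i ∈ T) := by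
        rcases T.eq_empty_or_nonempty with h | h
        · exact ⟨0, by simp [h], Or.inl rfl⟩
        · exact ⟨T.max' h, fun j hj => T.le_max' j hj, Or.inr (T.max'_mem h)⟩
      refine ⟨i, Finset.mem_univ _, ?_⟩
      rw [if_pos hE, mem_join]
      refine ⟨h1, A, ?_, B, lowr _ fun y hy j hj => Finset.mem_Ici.2 ?_, hAB⟩
      · rw [← hm]
        exact upper _ fun x hx j hj => Finset.mem_Iic.2 (hi1 j (hTm.2 ⟨x, hx, hj⟩))
      · rcases hi2 with rfl | hi2
        · exact Fin.zero_le _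
        · obtain ⟨x, hx, hxi⟩ := hTm.1 hi2
          have := hlay x hx y hy
          rw [LayerCompat, hsum x (Finset.mem_filter.1 hx).2] at this
          exact this.1 ((Int.even_coe_nat d).2 hE) _ _ hxi hj
    · obtain ⟨i, hi1, hi2⟩ : ∃ i, (∀ j ∈ T, i ≤ j) ∧ (i = Fin.last n ∨ i ∈ T) := by
        rcases T.eq_empty_or_nonempty with h | h
        · exact ⟨Fin.last n, by simp [h], Or.inl rfl⟩
        · exact ⟨T.min' h, fun j hj => T.min'_le j hj, Or.inr (T.min'_mem h)⟩
      refine ⟨i, Finset.mem_univ _, ?_⟩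
      rw [if_neg hE, mem_join]
      refine ⟨h1, A, ?_, B, lowr _ fun y hy j hj => Finset.mem_Iic.2 ?_, hAB⟩
      · rw [← hm']
        exact upper _ fun x hx j hj => Finset.mem_Ici.2 (hi1 j (hTm.2 ⟨x, hx, hj⟩))
      · rcases hi2 with rfl | hi2
        · exact Fin.le_last _
        · obtain ⟨x, hx, hxi⟩ := hTm.1 hi2
          have := hlay x hx y hy
          rw [LayerCompat, hsum x (Finset.mem_filter.1 hx).2] at this
          exact this.2 (fun h => hE ((Int.even_coe_nat d).1 h)) _ _ hxi hj

end AddLayer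

theorem mem_itenbergViro_one {d : ℕ} (hd : 1 ≤ d) (σ : Simplex 1) :
    σ ∈ itenbergViro 1 d ↔ IsIVSimplex 1 d σ := by
  have hc : ∀ x y : Fin 1 → ℤ, x 0 ≤ y 0 + 1 → y 0 ≤ x 0 + 1 →
      Compat (homCoord d x) (homCoord d y) := by
    intro x y h1 h2
    have ss : ∀ a b : Fin 1 → ℤ, LayerCompat a b := fun a b =>
      ⟨fun _ i j _ _ => (Subsingleton.elim i j).le, fun _ i j _ _ => (Subsingleton.elim j i).le⟩
    have e : ∀ x : Fin 1 → ℤ, homCoord d x (Fin.last 1) = x 0 := fun x => homCoord_last d x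
    simp only [Compat, e]
    rcases lt_trichotomy (x 0) (y 0) with h | h | h
    · exact Or.inr (Or.inr ⟨by omega, ss _ _⟩)
    · refine Or.inl ⟨h, Or.inl ⟨?_, trivial⟩⟩
      simp [lower, homCoord_zero, h]
    · exact Or.inr (Or.inl ⟨by omega, ss _ _⟩)
  have hn : ∀ x : Fin 1 → ℤ, (∀ i, 0 ≤ homCoord d x i) ↔ 0 ≤ x 0 ∧ x 0 ≤ d := fun x => by
    rw [homCoord_nonneg_iff]; simp
  rw [itenbergViro, Finset.mem_biUnion]
  constructor
  · rintro ⟨k, hk, h⟩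
    rw [Finset.mem_range] at hk
    obtain ⟨h1, h2⟩ := Finset.mem_erase.1 h
    rw [Finset.mem_powerset] at h2
    have h3 : ∀ x ∈ σ, x 0 = k ∨ x 0 = k + 1 := fun x hx => by
      have := h2 hx
      simp only [Finset.mem_insert, Finset.mem_singleton] at this
      rcases this with rfl | rfl
      exacts [Or.inl rfl, Or.inr rfl]
    refine ⟨Finset.nonempty_iff_ne_empty.2 h1, fun x hx => (hn x).2 ?_, fun x hx y hy => hc x y ?_ ?_⟩
    · rcases h3 x hx with h | h <;> omega
    · rcases h3 x hx with h | h <;> rcases h3 y hy with h' | h' <;> omega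
    · rcases h3 x hx with h | h <;> rcases h3 y hy with h' | h' <;> omega
  · rintro ⟨h1, h2, h3⟩
    obtain ⟨m, hm, hmin⟩ := σ.exists_min_image (fun x => x 0) h1
    have hm' := (hn m).1 (h2 m hm)
    have key : ∃ k : ℕ, k < d ∧ ∀ x ∈ σ, x 0 = k ∨ x 0 = k + 1 := by
      obtain ⟨q, hq⟩ := Int.eq_ofNat_of_zero_le hm'.1
      by_cases hqd : q < d
      · refine ⟨q, hqd, fun x hx => ?_⟩
        have h4 := hmin x hx
        have h5 := (h3 x hx m hm).last_cases
        rw [homCoord_last, homCoord_last] at h5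
        simp only [Fin.last_zero] at h5
        omega
      -- If the lowest vertex is the endpoint `d`, no segment starts there; it belongs to the last
      -- segment, which starts at `d - 1`.
      · refine ⟨d - 1, by omega, fun x hx => ?_⟩
        have h4 := hmin x hx
        have h5 := (hn x).1 (h2 x hx)
        omega
    obtain ⟨k, hk, hk'⟩ := key
    refine ⟨k, Finset.mem_range.2 hk, Finset.mem_erase.2 ⟨h1.ne_empty, Finset.mem_powerset.2 ?_⟩⟩
    intro x hx
    simp only [Finset.mem_insert, Finset.mem_singleton]
    rcases hk' x hx with h | h
    · exact Or.inl (funext fun i => by rw [Subsingleton.elim i 0, h])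
    · exact Or.inr (funext fun i => by rw [Subsingleton.elim i 0, h])

/-- The Itenberg–Viro triangulation is the clique complex of the compatibility graph. -/
theorem mem_itenbergViro : ∀ (n d : ℕ), 1 ≤ n → 1 ≤ d → ∀ σ : Simplex n,
    σ ∈ itenbergViro n d ↔ IsIVSimplex n d σ
  | 1, d, _, hd => mem_itenbergViro_one hd
  | n + 2, 1, _, _ => mem_unitSimplex
  | n + 2, d + 2, _, _ => mem_addLayer (d := d + 1)
      (mem_itenbergViro (n + 2) (d + 1) (by omega) (by omega))
      (mem_itenbergViro (n + 1) (d + 2) (by omega) (by omega))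
termination_by n d => (n, d)

/-! ### Barycentric coordinates with respect to a triangulation -/

section Tri

open Topology Filter

variable {n : ℕ}

/-- The vertices of a complex. -/
def verts (K : SComplex n) : Finset (Fin n → ℤ) := K.biUnion id

/-- The systems of barycentric coordinates supported by the simplex `σ`. -/
def simplexWeights (σ : Simplex n) : Set ((Fin n → ℤ) → ℝ) :=
  {w | (∀ a, 0 ≤ w a) ∧ (∀ a, a ∉ σ → w a = 0) ∧ ∑ a ∈ σ, w a = 1}

/-- The systems of barycentric coordinates supported by some simplex of `K`. -/
def weights (K : SComplex n) : Set ((Fin n → ℤ) → ℝ) := {w | ∃ σ ∈ K, w ∈ simplexWeights σ}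

/-- The point with given barycentric coordinates. -/
noncomputable def wsum (K : SComplex n) (w : (Fin n → ℤ) → ℝ) : Fin n → ℝ :=
  ∑ a ∈ verts K, w a • toReal a

/-- A triangulation of a convex set, in terms of barycentric coordinates. -/
structure IsTri (P : Set (Fin n → ℝ)) (K : SComplex n) : Prop where
  nonempty : ∀ σ ∈ K, σ.Nonempty
  down_closed : ∀ σ ∈ K, ∀ τ ⊆ σ, τ.Nonempty → τ ∈ K
  convex : Convex ℝ P
  vertex_mem : ∀ σ ∈ K, ∀ a ∈ σ, toReal a ∈ P
  exists_weights : ∀ p ∈ P, ∃ w ∈ weights K, wsum K w = p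
  unique : ∀ w ∈ weights K, ∀ u ∈ weights K, wsum K w = wsum K u → w = u
  indep : ∀ σ ∈ K, ∀ μ : (Fin n → ℤ) → ℝ, ∑ a ∈ σ, μ a = 0 → ∑ a ∈ σ, μ a • toReal a = 0 →
    ∀ a ∈ σ, μ a = 0

/-- The barycentric coordinates of a point. -/
noncomputable def coord (K : SComplex n) (p : Fin n → ℝ) : (Fin n → ℤ) → ℝ :=
  open scoped Classical in if h : ∃ w ∈ weights K, wsum K w = p then h.choose else 0

/-- The vertices of the simplex containing a point in its relative interior. -/
noncomputable def supp (K : SComplex n) (p : Fin n → ℝ) : Simplex n :=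
  open scoped Classical in (verts K).filter fun a => 0 < coord K p a

theorem subset_verts {K : SComplex n} {σ : Simplex n} (h : σ ∈ K) : σ ⊆ verts K := fun _ ha =>
  Finset.mem_biUnion.2 ⟨σ, h, ha⟩

theorem simplexWeights_mono {σ τ : Simplex n} (h : τ ⊆ σ) : simplexWeights τ ⊆ simplexWeights σ := by
  rintro w ⟨h1, h2, h3⟩
  refine ⟨h1, fun a ha => h2 a fun h' => ha (h h'), ?_⟩
  rw [← h3]
  exact (Finset.sum_subset h fun a _ ha => h2 a ha).symm

theorem wsum_eq {K : SComplex n} {σ : Simplex n} (hσ : σ ∈ K) {w : (Fin n → ℤ) → ℝ}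
    (hw : ∀ a, a ∉ σ → w a = 0) : wsum K w = ∑ a ∈ σ, w a • toReal a := by
  refine (Finset.sum_subset (subset_verts hσ) fun a _ ha => ?_).symm
  rw [hw a ha, zero_smul]

theorem convex_simplexWeights (σ : Simplex n) : Convex ℝ (simplexWeights σ) := by
  rintro w ⟨h1, h2, h3⟩ u ⟨k1, k2, k3⟩ s t hs ht hst
  refine ⟨fun a => ?_, fun a ha => ?_, ?_⟩
  · have := mul_nonneg hs (h1 a)
    have := mul_nonneg ht (k1 a)
    simp only [Pi.add_apply, Pi.smul_apply, smul_eq_mul]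
    linarith
  · simp [h2 a ha, k2 a ha]
  · simp only [Pi.add_apply, Pi.smul_apply, smul_eq_mul, Finset.sum_add_distrib, ← Finset.mul_sum,
      h3, k3, mul_one, hst]

theorem simplexWeights_le_one {σ : Simplex n} {w : (Fin n → ℤ) → ℝ} (h : w ∈ simplexWeights σ)
    (a : Fin n → ℤ) : w a ≤ 1 := by
  by_cases ha : a ∈ σ
  · rw [← h.2.2]
    exact Finset.single_le_sum (fun b _ => h.1 b) ha
  · rw [h.2.1 a ha]; exact zero_le_one

/-- Weights are functions on the whole lattice, and compactness comes from Tychonoff's theorem for a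
product of copies of `[0, 1]`. -/
theorem isCompact_simplexWeights (σ : Simplex n) : IsCompact (simplexWeights σ) := by
  refine IsCompact.of_isClosed_subset
    (isCompact_univ_pi fun _ : Fin n → ℤ => isCompact_Icc (a := (0 : ℝ)) (b := 1)) ?_ ?_
  · have e : simplexWeights σ = (⋂ a, {w | 0 ≤ w a}) ∩ ((⋂ a, ⋂ (_ : a ∉ σ), {w | w a = 0}) ∩
        {w | ∑ a ∈ σ, w a = 1}) := by
      ext w; simp [simplexWeights]
    rw [e]
    refine (isClosed_iInter fun a => isClosed_le continuous_const (continuous_apply a)).inter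
      (IsClosed.inter (isClosed_iInter fun a => isClosed_iInter fun _ =>
        isClosed_eq (continuous_apply a) continuous_const) (isClosed_eq ?_ continuous_const))
    exact continuous_finsetSum _ fun a _ => continuous_apply a
  · intro w hw a _
    exact ⟨hw.1 a, simplexWeights_le_one hw a⟩

theorem isCompact_weights (K : SComplex n) : IsCompact (weights K) := by
  have e : weights K = ⋃ σ ∈ K, simplexWeights σ := by ext w; simp [weights]
  rw [e]
  exact K.isCompact_biUnion fun σ _ => isCompact_simplexWeights σ

theorem continuous_wsum (K : SComplex n) : Continuous (wsum K) :=
  continuous_finsetSum _ fun a _ => (continuous_apply a).smul continuous_const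

namespace IsTri

variable {P : Set (Fin n → ℝ)} {K : SComplex n} (h : IsTri P K)
include h

theorem coord_mem {p : Fin n → ℝ} (hp : p ∈ P) : coord K p ∈ weights K := by
  rw [coord, dif_pos (h.exists_weights p hp)]
  exact (h.exists_weights p hp).choose_spec.1

theorem wsum_coord {p : Fin n → ℝ} (hp : p ∈ P) : wsum K (coord K p) = p := by
  rw [coord, dif_pos (h.exists_weights p hp)]
  exact (h.exists_weights p hp).choose_spec.2

theorem wsum_mem {w : (Fin n → ℤ) → ℝ} (hw : w ∈ weights K) : wsum K w ∈ P := by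
  obtain ⟨σ, hσ, hw⟩ := hw
  rw [wsum_eq hσ hw.2.1]
  exact h.convex.sum_mem (fun a _ => hw.1 a) hw.2.2 fun a ha => h.vertex_mem σ hσ a ha

theorem coord_wsum {w : (Fin n → ℤ) → ℝ} (hw : w ∈ weights K) : coord K (wsum K w) = w :=
  h.unique _ (h.coord_mem (h.wsum_mem hw)) _ hw (h.wsum_coord (h.wsum_mem hw))

/-- The map from weights to points is a continuous bijection from a compact space onto a Hausdorff
space, hence a homeomorphism, and the coordinates are its inverse. -/
theorem continuousOn_coord : ContinuousOn (coord K) P := by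
  have : CompactSpace (weights K) := isCompact_iff_compactSpace.1 (isCompact_weights K)
  let e : weights K ≃ P :=
    { toFun := fun w => ⟨wsum K w, h.wsum_mem w.2⟩
      invFun := fun p => ⟨coord K p, h.coord_mem p.2⟩
      left_inv := fun w => Subtype.ext (h.coord_wsum w.2)
      right_inv := fun p => Subtype.ext (h.wsum_coord p.2) }
  have he : Continuous e := ((continuous_wsum K).comp continuous_subtype_val).subtype_mk _
  rw [continuousOn_iff_continuous_domRestrict]
  exact continuous_subtype_val.comp (Continuous.homeoOfEquivCompactToT2 (f := e) he).symm.continuous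

theorem continuousOn_coord_apply (a : Fin n → ℤ) : ContinuousOn (fun p => coord K p a) P :=
  (continuous_apply a).comp_continuousOn h.continuousOn_coord

theorem coord_nonneg {p : Fin n → ℝ} (hp : p ∈ P) (a : Fin n → ℤ) : 0 ≤ coord K p a := by
  obtain ⟨σ, _, hw⟩ := h.coord_mem hp
  exact hw.1 a

theorem mem_supp {p : Fin n → ℝ} (hp : p ∈ P) {a : Fin n → ℤ} :
    a ∈ supp K p ↔ 0 < coord K p a := by
  classical
  rw [supp, Finset.mem_filter, and_iff_right_iff_imp]
  intro ha
  obtain ⟨σ, hσ, hw⟩ := h.coord_mem hp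
  by_contra hc
  rw [hw.2.1 a fun h' => hc (subset_verts hσ h')] at ha
  exact lt_irrefl _ ha

theorem coord_eq_zero {p : Fin n → ℝ} (hp : p ∈ P) {a : Fin n → ℤ} (ha : a ∉ supp K p) :
    coord K p a = 0 :=
  le_antisymm (not_lt.1 fun h' => ha ((h.mem_supp hp).2 h')) (h.coord_nonneg hp a)

theorem supp_subset {p : Fin n → ℝ} (hp : p ∈ P) {σ : Simplex n}
    (hw : coord K p ∈ simplexWeights σ) : supp K p ⊆ σ := by
  intro a ha
  by_contra hc
  have := (h.mem_supp hp).1 ha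
  rw [hw.2.1 a hc] at this
  exact lt_irrefl _ this

theorem coord_mem_supp {p : Fin n → ℝ} (hp : p ∈ P) : coord K p ∈ simplexWeights (supp K p) := by
  obtain ⟨σ, hσ, hw⟩ := h.coord_mem hp
  refine ⟨hw.1, fun a ha => h.coord_eq_zero hp ha, ?_⟩
  rw [← hw.2.2]
  exact Finset.sum_subset (h.supp_subset hp hw) fun a _ ha => h.coord_eq_zero hp ha

theorem supp_mem {p : Fin n → ℝ} (hp : p ∈ P) : supp K p ∈ K := by
  obtain ⟨σ, hσ, hw⟩ := h.coord_mem hp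
  refine h.down_closed σ hσ _ (h.supp_subset hp hw) ?_
  by_contra hc
  rw [Finset.not_nonempty_iff_eq_empty] at hc
  have := (h.coord_mem_supp hp).2.2
  rw [hc] at this
  simp at this

theorem supp_nonempty {p : Fin n → ℝ} (hp : p ∈ P) : (supp K p).Nonempty :=
  h.nonempty _ (h.supp_mem hp)

theorem sum_coord_smul {p : Fin n → ℝ} (hp : p ∈ P) :
    ∑ a ∈ supp K p, coord K p a • toReal a = p := by
  rw [← wsum_eq (h.supp_mem hp) (h.coord_mem_supp hp).2.1, h.wsum_coord hp]

theorem coord_eq {σ : Simplex n} (hσ : σ ∈ K) {w : (Fin n → ℤ) → ℝ} (hw : w ∈ simplexWeights σ) :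
    coord K (∑ a ∈ σ, w a • toReal a) = w := by
  rw [← wsum_eq hσ hw.2.1]
  exact h.coord_wsum ⟨σ, hσ, hw⟩

theorem sum_mem {σ : Simplex n} (hσ : σ ∈ K) {w : (Fin n → ℤ) → ℝ} (hw : w ∈ simplexWeights σ) :
    ∑ a ∈ σ, w a • toReal a ∈ P :=
  h.convex.sum_mem (fun a _ => hw.1 a) hw.2.2 fun a ha => h.vertex_mem σ hσ a ha

theorem sum_coord_smul_of_subset {p : Fin n → ℝ} (hp : p ∈ P) {σ : Simplex n}
    (hs : supp K p ⊆ σ) : ∑ a ∈ σ, coord K p a • toReal a = p := by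
  conv_rhs => rw [← h.sum_coord_smul hp]
  exact (Finset.sum_subset hs fun a _ ha => by rw [h.coord_eq_zero hp ha, zero_smul]).symm

/-- Barycentric coordinates are affine on each simplex. -/
theorem coord_combo {p q : Fin n → ℝ} (hp : p ∈ P) (hq : q ∈ P) {σ : Simplex n} (hσ : σ ∈ K)
    (hps : supp K p ⊆ σ) (hqs : supp K q ⊆ σ) {s t : ℝ} (hs : 0 ≤ s) (ht : 0 ≤ t)
    (hst : s + t = 1) : coord K (s • p + t • q) = s • coord K p + t • coord K q := by
  have hw := convex_simplexWeights σ (simplexWeights_mono hps (h.coord_mem_supp hp))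
    (simplexWeights_mono hqs (h.coord_mem_supp hq)) hs ht hst
  rw [← h.coord_eq hσ hw]
  congr 1
  simp only [Pi.add_apply, Pi.smul_apply, smul_eq_mul, add_smul, mul_smul, Finset.sum_add_distrib,
    ← Finset.smul_sum]
  rw [h.sum_coord_smul_of_subset hp hps, h.sum_coord_smul_of_subset hq hqs]

/-- The supports of the points near `p` contain the support of `p`. -/
theorem eventually_supp_subset {p : Fin n → ℝ} (hp : p ∈ P) :
    ∀ᶠ q in 𝓝[P] p, supp K p ⊆ supp K q := by
  have : ∀ᶠ q in 𝓝[P] p, ∀ a ∈ supp K p, 0 < coord K q a :=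
    (Finset.eventually_all _).2 fun a ha =>
      (h.continuousOn_coord_apply a p hp).eventually (lt_mem_nhds ((h.mem_supp hp).1 ha))
  filter_upwards [this, self_mem_nhdsWithin] with q hq hqP a ha
  exact (h.mem_supp hqP).2 (hq a ha)

/-- Geometric incidence becomes inclusion of supports; in particular two simplices intersect in
their common face because a point has only one support. -/
theorem mem_hull {σ : Simplex n} (hσ : σ ∈ K) {p : Fin n → ℝ} :
    p ∈ hull σ ↔ p ∈ P ∧ supp K p ⊆ σ := by
  constructor
  · intro hp
    have hsub : hull σ ⊆ (fun w : (Fin n → ℤ) → ℝ => ∑ a ∈ σ, w a • toReal a) ''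
        simplexWeights σ := by
      refine convexHull_min ?_ ((convex_simplexWeights σ).is_linear_image ⟨?_, ?_⟩)
      · rintro _ ⟨a, ha, rfl⟩
        rw [Finset.mem_coe] at ha
        refine ⟨Pi.single a 1, ⟨fun b => ?_, fun b hb => ?_, ?_⟩, ?_⟩
        · rw [Pi.single_apply]; split_ifs <;> norm_num
        · exact Pi.single_eq_of_ne (by rintro rfl; exact hb ha) _
        · simp [ha]
        · simp only [Pi.single_apply, ite_smul, one_smul, zero_smul]
          rw [Finset.sum_ite_eq' σ a, if_pos ha]
      · intro w u; simp [add_smul, Finset.sum_add_distrib]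
      · intro c w; simp [mul_smul, Finset.smul_sum]
    obtain ⟨w, hw, rfl⟩ := hsub hp
    have hP := h.sum_mem hσ hw
    refine ⟨hP, h.supp_subset hP ?_⟩
    rw [h.coord_eq hσ hw]
    exact hw
  · rintro ⟨hp, hs⟩
    rw [← h.sum_coord_smul_of_subset hp hs]
    have hw := simplexWeights_mono hs (h.coord_mem_supp hp)
    exact (convex_convexHull ℝ _).sum_mem (fun a _ => hw.1 a) hw.2.2
      fun a ha => subset_convexHull _ _ ⟨a, ha, rfl⟩

omit h in
theorem barycentre_eq (σ : Simplex n) : barycentre σ =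
    ∑ a ∈ σ, (if a ∈ σ then (σ.card : ℝ)⁻¹ else 0) • toReal a := by
  rw [barycentre, Finset.smul_sum]
  exact Finset.sum_congr rfl fun a ha => by rw [if_pos ha]

omit h in
theorem barycentre_weights {σ : Simplex n} (hσ : σ.Nonempty) :
    (fun a => if a ∈ σ then (σ.card : ℝ)⁻¹ else 0) ∈ simplexWeights σ := by
  refine ⟨fun a => ?_, fun a ha => if_neg ha, ?_⟩
  · dsimp only; split_ifs <;> positivity
  · rw [Finset.sum_congr rfl fun a ha => if_pos ha, Finset.sum_const, nsmul_eq_mul]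
    have := hσ.card_pos
    field_simp

theorem barycentre_mem {σ : Simplex n} (hσ : σ ∈ K) : barycentre σ ∈ P := by
  rw [barycentre_eq]
  exact h.sum_mem hσ (barycentre_weights (h.nonempty σ hσ))

theorem coord_barycentre {σ : Simplex n} (hσ : σ ∈ K) (a : Fin n → ℤ) :
    coord K (barycentre σ) a = if a ∈ σ then (σ.card : ℝ)⁻¹ else 0 := by
  rw [barycentre_eq, h.coord_eq hσ (barycentre_weights (h.nonempty σ hσ))]

theorem supp_barycentre {σ : Simplex n} (hσ : σ ∈ K) : supp K (barycentre σ) = σ := by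
  ext a
  rw [h.mem_supp (h.barycentre_mem hσ), h.coord_barycentre hσ]
  have := (h.nonempty σ hσ).card_pos
  split_ifs with ha
  · simp [ha, this]
  · simp [ha]

theorem isPrimitiveTriangulation (hpure : ∀ σ ∈ K, ∃ τ ∈ K, σ ⊆ τ ∧ τ.card = n + 1)
    (hprim : ∀ σ ∈ K, σ.card = n + 1 →
      ∀ a ∈ σ, Submodule.span ℤ {x : Fin n → ℤ | ∃ b ∈ σ, x = b - a} = ⊤) :
    IsPrimitiveTriangulation P K where
  nonempty := h.nonempty
  down_closed := h.down_closed
  pure := hpure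
  primitive := hprim
  inter σ hσ τ hτ := by
    apply Set.Subset.antisymm
    · rintro p ⟨h1, h2⟩
      obtain ⟨hp, h1⟩ := (h.mem_hull hσ).1 h1
      obtain ⟨-, h2⟩ := (h.mem_hull hτ).1 h2
      have h3 := Finset.subset_inter h1 h2
      exact (h.mem_hull (h.down_closed σ hσ _ Finset.inter_subset_left
        ((h.supp_nonempty hp).mono h3))).2 ⟨hp, h3⟩
    · refine Set.subset_inter (convexHull_mono ?_) (convexHull_mono ?_)
      · exact Set.image_mono (by simp)
      · exact Set.image_mono (by simp)
  cover := by
    ext p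
    rw [Set.mem_iUnion₂]
    constructor
    · rintro ⟨σ, hσ, hp⟩
      exact ((h.mem_hull hσ).1 hp).1
    · intro hp
      exact ⟨_, h.supp_mem hp, (h.mem_hull (h.supp_mem hp)).2 ⟨hp, subset_rfl⟩⟩

end IsTri

end Tri

open Topology Filter

/-! ### Triangulations of the standard simplices -/

section Sized

variable {n d : ℕ}

theorem homCoord_toReal (d : ℕ) (a : Fin n → ℤ) (k : Fin (n + 1)) :
    homCoord d (toReal a) k = (homCoord d a k : ℤ) := by
  refine Fin.cases ?_ (fun k => ?_) k
  · simp [homCoord_zero, toReal]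
  · simp [homCoord_succ, toReal]

theorem homCoord_tail {R : Type*} [CommRing R] {X : Fin (n + 1) → R} (h : ∑ i, X i = d) :
    homCoord d (fun i => X i.succ) = X := by
  funext k
  refine Fin.cases ?_ (fun k => rfl) k
  rw [homCoord_zero, ← h, Fin.sum_univ_succ]
  ring

theorem sum_mul_homCoord_zero {ι : Type*} (d : ℕ) (s : Finset ι) (w : ι → ℝ) (f : ι → Fin n → ℝ) :
    ∑ i ∈ s, w i * homCoord d (f i) 0 = d * ∑ i ∈ s, w i - ∑ j, (∑ i ∈ s, w i • f i) j := by
  simp only [homCoord_zero, mul_sub, Finset.sum_sub_distrib, Finset.sum_apply, Pi.smul_apply,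
    smul_eq_mul, Finset.mul_sum]
  rw [Finset.sum_comm (t := s)]
  simp only [mul_comm]

theorem sum_mul_homCoord_succ {ι : Type*} (d : ℕ) (s : Finset ι) (w : ι → ℝ) (f : ι → Fin n → ℝ)
    (k : Fin n) :
    ∑ i ∈ s, w i * homCoord d (f i) k.succ = (∑ i ∈ s, w i • f i) k := by
  simp [homCoord_succ]

theorem homCoord_sum {ι : Type*} (d : ℕ) (s : Finset ι) (w : ι → ℝ) (f : ι → Fin n → ℝ)
    (hw : ∑ i ∈ s, w i = 1) (k : Fin (n + 1)) :
    homCoord d (∑ i ∈ s, w i • f i) k = ∑ i ∈ s, w i * homCoord d (f i) k := by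
  refine Fin.cases ?_ (fun k => ?_) k
  · rw [sum_mul_homCoord_zero, hw, mul_one, homCoord_zero]
  · rw [sum_mul_homCoord_succ, homCoord_succ]

theorem mem_sizedSimplex {x : Fin n → ℝ} :
    x ∈ sizedSimplex n d ↔ ∀ k, 0 ≤ homCoord d x k := by
  constructor
  · rintro ⟨h1, h2⟩ k
    refine Fin.cases ?_ (fun k => h1 k) k
    rw [homCoord_zero]; linarith
  · intro h
    refine ⟨fun i => h i.succ, ?_⟩
    have := h 0
    rw [homCoord_zero] at this
    linarith

theorem toReal_mem_sizedSimplex {a : Fin n → ℤ} :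
    toReal a ∈ sizedSimplex n d ↔ ∀ k, 0 ≤ homCoord d a k := by
  rw [mem_sizedSimplex]
  refine forall_congr' fun k => ?_
  rw [homCoord_toReal]
  exact_mod_cast Iff.rfl

theorem convex_sizedSimplex (n d : ℕ) : Convex ℝ (sizedSimplex n d) := by
  rintro x ⟨h1, h2⟩ y ⟨k1, k2⟩ s t hs ht hst
  refine ⟨fun i => add_nonneg (mul_nonneg hs (h1 i)) (mul_nonneg ht (k1 i)), ?_⟩
  simp only [Pi.add_apply, Pi.smul_apply, smul_eq_mul, Finset.sum_add_distrib, ← Finset.mul_sum]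
  calc s * ∑ i, x i + t * ∑ i, y i ≤ s * d + t * d := by gcongr
    _ = d := by rw [← add_mul, hst, one_mul]

/-- The Itenberg–Viro triangulation triangulates the standard simplex. -/
theorem itenbergViro_isTri (hn : 1 ≤ n) (hd : 1 ≤ d) :
    IsTri (sizedSimplex n d) (itenbergViro n d) := by
  classical
  have hmem := mem_itenbergViro n d hn hd
  refine ⟨fun σ hσ => ((hmem σ).1 hσ).1, ?_, convex_sizedSimplex n d, ?_, ?_, ?_, ?_⟩
  · intro σ hσ τ hτ hne
    obtain ⟨-, h2, h3⟩ := (hmem σ).1 hσ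
    exact (hmem τ).2 ⟨hne, fun x hx => h2 x (hτ hx), fun x hx y hy => h3 x (hτ hx) y (hτ hy)⟩
  · intro σ hσ a ha
    exact toReal_mem_sizedSimplex.2 (((hmem σ).1 hσ).2.1 a ha)
  · intro p hp
    obtain ⟨s, w, h1, h2, h3, h4, h5, h6⟩ := exists_weights (n + 1) (homCoord d p) d
      (mem_sizedSimplex.1 hp) (sum_homCoord d p)
    have ht : ∀ x ∈ s, homCoord d (fun i => x i.succ) = x := fun x hx =>
      homCoord_tail (by rw [h3 x hx])
    set σ : Simplex n := s.image fun x i => x i.succ with hσ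
    have hinj : Set.InjOn (fun (x : Fin (n + 1) → ℤ) (i : Fin n) => x i.succ) s := by
      intro x hx y hy hxy
      rw [← ht x hx, ← ht y hy]
      exact congrArg (homCoord d) hxy
    have hσK : σ ∈ itenbergViro n d := by
      rw [hmem]
      refine ⟨Finset.Nonempty.image ?_ _, ?_, ?_⟩
      · rw [Finset.nonempty_iff_ne_empty]
        rintro rfl
        simp at h5
      · simp only [hσ, Finset.mem_image]
        rintro _ ⟨x, hx, rfl⟩
        rw [ht x hx]
        exact h2 x hx
      · simp only [hσ, Finset.mem_image]
        rintro _ ⟨x, hx, rfl⟩ _ ⟨y, hy, rfl⟩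
        rw [ht x hx, ht y hy]
        exact h1 x hx y hy
    have hw : (fun a => if a ∈ σ then w (homCoord d a) else 0) ∈ simplexWeights σ := by
      refine ⟨fun a => ?_, fun a ha => if_neg ha, ?_⟩
      · dsimp only
        split_ifs with ha
        · rw [hσ, Finset.mem_image] at ha
          obtain ⟨x, hx, rfl⟩ := ha
          rw [ht x hx]
          exact (h4 x hx).le
        · exact le_rfl
      · rw [Finset.sum_congr rfl fun a ha => if_pos ha, hσ, Finset.sum_image hinj, ← h5]
        exact Finset.sum_congr rfl fun x hx => by rw [ht x hx]
    refine ⟨_, ⟨σ, hσK, hw⟩, ?_⟩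
    rw [wsum_eq hσK hw.2.1]
    funext k
    simp only [Finset.sum_apply, Pi.smul_apply, smul_eq_mul]
    rw [Finset.sum_congr rfl fun a ha => by rw [if_pos ha], hσ, Finset.sum_image hinj]
    have := h6 k.succ
    rw [homCoord_succ] at this
    rw [← this]
    exact Finset.sum_congr rfl fun x hx => by rw [ht x hx]; rfl
  · rintro w ⟨σ, hσ, hw⟩ u ⟨τ, hτ, hu⟩ hwu
    have hsum : ∀ {v : (Fin n → ℤ) → ℝ} {κ}, κ ∈ itenbergViro n d → v ∈ simplexWeights κ →
        ∑ a ∈ verts (itenbergViro n d), v a = 1 := fun {v κ} hκ hv =>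
      (simplexWeights_mono (subset_verts hκ) hv).2.2
    have hclique : ∀ {v : (Fin n → ℤ) → ℝ} {κ}, κ ∈ itenbergViro n d → v ∈ simplexWeights κ →
        ∀ a b, v a ≠ 0 → v b ≠ 0 → Compat (homCoord d a) (homCoord d b) := fun {v κ} hκ hv a b ha hb =>
      ((hmem κ).1 hκ).2.2 a (by by_contra h; exact ha (hv.2.1 a h))
        b (by by_contra h; exact hb (hv.2.1 b h))
    have key := weights_unique (n + 1) (verts (itenbergViro n d)) (homCoord d) w u d
      (homCoord_injective d).injOn ?_ (fun a _ => sum_homCoord d a) (fun a _ => hw.1 a)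
      (fun a _ => hu.1 a) (fun a _ b _ => hclique hσ hw a b) (fun a _ b _ => hclique hτ hu a b)
      (by rw [hsum hσ hw, hsum hτ hu]) ?_
    · funext a
      by_cases ha : a ∈ verts (itenbergViro n d)
      · exact key a ha
      · rw [hw.2.1 a fun h => ha (subset_verts hσ h), hu.2.1 a fun h => ha (subset_verts hτ h)]
    · intro a ha
      obtain ⟨κ, hκ, ha⟩ := Finset.mem_biUnion.1 ha
      exact ((hmem κ).1 hκ).2.1 a ha
    · intro k
      simp only [← homCoord_toReal]
      rw [← homCoord_sum d _ w _ (hsum hσ hw), ← homCoord_sum d _ u _ (hsum hτ hu)]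
      exact congrArg (fun p => homCoord d p k) hwu
  · intro σ hσ μ h0 h1 a ha
    refine mem_of_moments ⊥ (n + 1) σ (homCoord d) μ d (homCoord_injective d).injOn
      ((hmem σ).1 hσ).2.2 (fun a _ => sum_homCoord d a) (by rw [h0]; exact AddSubgroup.zero_mem _)
      (fun k => ?_) a ha
    simp only [← homCoord_toReal]
    refine Fin.cases ?_ (fun k => ?_) k
    · rw [sum_mul_homCoord_zero, h0, h1]; simp
    · rw [sum_mul_homCoord_succ, h1]; simp

/-! ### Faces, facets and connectedness of triangulations of the standard simplex -/

namespace IsTri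

variable {K : SComplex n} (h : IsTri (sizedSimplex n d) K) (hd : 1 ≤ d)
include h

theorem homCoord_eq_sum {p : Fin n → ℝ} (hp : p ∈ sizedSimplex n d) (k : Fin (n + 1)) :
    homCoord d p k = ∑ a ∈ supp K p, coord K p a * homCoord d (toReal a) k := by
  rw [← homCoord_sum _ _ _ _ (h.coord_mem_supp hp).2.2, h.sum_coord_smul hp]

theorem vertex_homCoord_nonneg {σ : Simplex n} (hσ : σ ∈ K) {a : Fin n → ℤ} (ha : a ∈ σ)
    (k : Fin (n + 1)) : 0 ≤ homCoord d a k :=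
  toReal_mem_sizedSimplex.1 (h.vertex_mem σ hσ a ha) k

/-- A homogeneous coordinate of `p` is a combination, with positive weights, of the nonnegative
coordinates of the vertices of its support. Thus the face of the standard simplex containing `p` can
be read off its support. -/
theorem homCoord_eq_zero_iff {p : Fin n → ℝ} (hp : p ∈ sizedSimplex n d) (k : Fin (n + 1)) :
    homCoord d p k = 0 ↔ ∀ a ∈ supp K p, homCoord d a k = 0 := by
  rw [h.homCoord_eq_sum hp k]
  have hnn : ∀ a ∈ supp K p, 0 ≤ coord K p a * homCoord d (toReal a) k := fun a ha =>
    mul_nonneg (h.coord_nonneg hp a)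
      (mem_sizedSimplex.1 (h.vertex_mem _ (h.supp_mem hp) a ha) k)
  rw [Finset.sum_eq_zero_iff_of_nonneg hnn]
  refine forall₂_congr fun a ha => ?_
  have := (h.mem_supp hp).1 ha
  rw [homCoord_toReal, mul_eq_zero, or_iff_right this.ne']
  exact_mod_cast Iff.rfl

include hd

/-- The lifted vertices lie on the hyperplane of sum `d ≠ 0`, so a linear relation among them has
total coefficient zero and is an affine relation. -/
theorem linearIndependent_homCoord {σ : Simplex n} (hσ : σ ∈ K) :
    LinearIndependent ℝ fun a : σ => homCoord d (toReal a.1) := by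
  classical
  rw [Fintype.linearIndependent_iff]
  intro g hg
  set μ : (Fin n → ℤ) → ℝ := fun a => if ha : a ∈ σ then g ⟨a, ha⟩ else 0 with hμ
  have hsum : ∀ (f : (Fin n → ℤ) → ℝ), ∑ a ∈ σ, μ a * f a = ∑ a : σ, g a * f a.1 := fun f => by
    rw [← Finset.sum_attach]
    exact Finset.sum_congr rfl fun a _ => by simp [hμ]
  have hmom : ∀ k, ∑ a ∈ σ, μ a * homCoord d (toReal a) k = 0 := fun k => by
    rw [hsum]
    simpa using congrFun hg k
  have h0 : ∑ a ∈ σ, μ a = 0 := by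
    have e : ∑ k, ∑ a ∈ σ, μ a * homCoord d (toReal a) k = d * ∑ a ∈ σ, μ a := by
      rw [Finset.sum_comm, Finset.mul_sum]
      refine Finset.sum_congr rfl fun a _ => ?_
      rw [← Finset.mul_sum, sum_homCoord, mul_comm]
    rw [Finset.sum_congr rfl fun k _ => hmom k, Finset.sum_const_zero] at e
    have hd' : (d : ℝ) ≠ 0 := by positivity
    exact (mul_eq_zero.1 e.symm).resolve_left hd'
  have h1 : ∑ a ∈ σ, μ a • toReal a = 0 := by
    funext k
    rw [← sum_mul_homCoord_succ d, hmom]; rfl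
  intro a
  have := h.indep σ hσ μ h0 h1 a.1 a.2
  simpa [hμ] using this

theorem span_homCoord {σ : Simplex n} (hσ : σ ∈ K) (hc : σ.card = n + 1) :
    Submodule.span ℝ (Set.range fun a : σ => homCoord d (toReal a.1)) = ⊤ :=
  (h.linearIndependent_homCoord hd hσ).span_eq_top_of_card_eq_finrank' (by simp [hc])

theorem exists_homCoord_combination {σ : Simplex n} (hσ : σ ∈ K) (hc : σ.card = n + 1)
    (Z : Fin (n + 1) → ℝ) : ∃ μ : (Fin n → ℤ) → ℝ, (∀ a, a ∉ σ → μ a = 0) ∧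
      (∀ k, ∑ a ∈ σ, μ a * homCoord d (toReal a) k = Z k) ∧ d * ∑ a ∈ σ, μ a = ∑ k, Z k := by
  classical
  have hZ : Z ∈ Submodule.span ℝ (Set.range fun a : σ => homCoord d (toReal a.1)) := by
    rw [h.span_homCoord hd hσ hc]; trivial
  obtain ⟨g, hg⟩ := (Submodule.mem_span_range_iff_exists_fun ℝ).1 hZ
  set μ : (Fin n → ℤ) → ℝ := fun a => if ha : a ∈ σ then g ⟨a, ha⟩ else 0 with hμ
  have hk : ∀ k, ∑ a ∈ σ, μ a * homCoord d (toReal a) k = Z k := fun k => by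
    rw [← hg, ← Finset.sum_attach, Finset.sum_apply]
    exact Finset.sum_congr rfl fun a _ => by simp [hμ]
  refine ⟨μ, fun a ha => dif_neg ha, hk, ?_⟩
  rw [← Finset.sum_congr rfl fun k _ => hk k, Finset.sum_comm, Finset.mul_sum]
  refine Finset.sum_congr rfl fun a _ => ?_
  rw [← Finset.mul_sum, sum_homCoord, mul_comm]

omit h hd in
theorem exists_vertex_notMem_span (κ : Finset (Fin (n + 1) → ℝ)) (J : Finset (Fin (n + 1)))
    (hJ : κ.card < J.card) :
    ∃ j ∈ J, (Pi.single j 1 : Fin (n + 1) → ℝ) ∉ Submodule.span ℝ (κ : Set (Fin (n + 1) → ℝ)) := by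
  by_contra hcon
  push Not at hcon
  have hli : LinearIndependent ℝ fun j : J => (Pi.single j.1 1 : Fin (n + 1) → ℝ) := by
    have := (Pi.basisFun ℝ (Fin (n + 1))).linearIndependent.comp (fun j : J => j.1)
      Subtype.val_injective
    convert this using 1
    funext j
    simp
  have := linearIndependent_le_span_aux' _ hli (κ : Set (Fin (n + 1) → ℝ)) (by
    rintro _ ⟨j, rfl⟩
    exact hcon j.1 j.2)
  simp at this
  omega

/-- Within a face of the standard simplex, every simplex is a face of a simplex of maximal
dimension. -/
theorem exists_extension (J : Finset (Fin (n + 1))) : ∀ (m : ℕ) (τ : Simplex n), τ ∈ K →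
    (∀ a ∈ τ, ∀ j ∉ J, homCoord d a j = 0) → J.card ≤ τ.card + m →
    ∃ τ' ∈ K, τ ⊆ τ' ∧ (∀ a ∈ τ', ∀ j ∉ J, homCoord d a j = 0) ∧ J.card ≤ τ'.card := by
  classical
  intro m
  induction m with
  | zero => exact fun τ hτ hJ hc => ⟨τ, hτ, subset_rfl, hJ, hc⟩
  | succ m ih =>
    intro τ hτ hJ hc
    by_cases hle : J.card ≤ τ.card
    · exact ⟨τ, hτ, subset_rfl, hJ, hle⟩
    obtain ⟨j, hj, hspan⟩ := exists_vertex_notMem_span (τ.image fun a => homCoord d (toReal a)) J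
      (lt_of_le_of_lt Finset.card_image_le (not_le.1 hle))
    -- `y` is the vertex `d e_j` of the face spanned by `J`, chosen outside the span of `τ`.
    set y : Fin n → ℝ := fun i => (Pi.single j (d : ℝ) : Fin (n + 1) → ℝ) i.succ with hy
    have hyh : homCoord d y = Pi.single j (d : ℝ) := homCoord_tail (by simp)
    have hyP : y ∈ sizedSimplex n d := by
      rw [mem_sizedSimplex, hyh]
      intro k
      rw [Pi.single_apply]; split_ifs <;> positivity
    have hmP := h.barycentre_mem hτ
    set m0 := barycentre τ with hm0
    have hmJ : ∀ j ∉ J, homCoord d m0 j = 0 := fun j hj => by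
      rw [h.homCoord_eq_zero_iff hmP, h.supp_barycentre hτ]
      exact fun a ha => hJ a ha j hj
    -- A small displacement of the barycentre of `τ` towards `y` keeps all the vertices of `τ` in
    -- the support and stays in the face `J`.
    have hcont : Tendsto (fun t : ℝ => (1 - t) • m0 + t • y) (𝓝[>] 0) (𝓝[sizedSimplex n d] m0) := by
      refine tendsto_nhdsWithin_iff.2 ⟨?_, ?_⟩
      · have : Tendsto (fun t : ℝ => (1 - t) • m0 + t • y) (𝓝 0) (𝓝 ((1 - (0 : ℝ)) • m0 + (0 : ℝ) • y)) :=
          Continuous.tendsto (by fun_prop) 0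
        simp only [sub_zero, one_smul, zero_smul, add_zero] at this
        exact this.mono_left nhdsWithin_le_nhds
      · filter_upwards [Ioo_mem_nhdsGT (zero_lt_one' ℝ)] with t ht
        exact h.convex hmP hyP (by linarith [ht.2]) ht.1.le (by ring)
    obtain ⟨t, ht, hts⟩ := ((hcont.eventually (h.eventually_supp_subset hmP)).and
      (Ioo_mem_nhdsGT (zero_lt_one' ℝ))).exists
    rw [h.supp_barycentre hτ] at ht
    set q := (1 - t) • m0 + t • y with hq
    have hqP : q ∈ sizedSimplex n d :=
      h.convex hmP hyP (by linarith [hts.2]) hts.1.le (by ring)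
    have hqh : ∀ k, homCoord d q k = (1 - t) * homCoord d m0 k + t * homCoord d y k := by
      intro k
      refine Fin.cases ?_ (fun k => ?_) k
      · simp only [homCoord_zero, hq, Pi.add_apply, Pi.smul_apply, smul_eq_mul,
          Finset.sum_add_distrib, ← Finset.mul_sum]
        ring
      · simp [homCoord_succ, hq]
    have hqJ : ∀ a ∈ supp K q, ∀ j ∉ J, homCoord d a j = 0 := by
      intro a ha k hk
      refine (h.homCoord_eq_zero_iff hqP k).1 ?_ a ha
      rw [hqh, hmJ k hk, hyh, Pi.single_eq_of_ne (by rintro rfl; exact hk hj)]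
      ring
    -- The support has really grown: otherwise the displaced point and the barycentre would both be
    -- in the span of `τ`, and so would the direction `j`.
    have hne : τ ≠ supp K q := by
      intro e
      apply hspan
      have hsub : ∀ p ∈ sizedSimplex n d, supp K p ⊆ τ → homCoord d p ∈ Submodule.span ℝ
          ((τ.image fun a => homCoord d (toReal a) : Finset (Fin (n + 1) → ℝ)) : Set _) := by
        intro p hp hs
        have : homCoord d p = ∑ a ∈ supp K p, coord K p a • homCoord d (toReal a) := by
          funext k
          rw [h.homCoord_eq_sum hp]
          simp
        rw [this]
        refine Submodule.sum_mem _ fun a ha => Submodule.smul_mem _ _ (Submodule.subset_span ?_)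
        exact Finset.mem_coe.2 (Finset.mem_image_of_mem _ (hs ha))
      have e1 := hsub q hqP e.symm.subset
      have e2 := hsub m0 hmP (h.supp_barycentre hτ).subset
      have hd' : (d : ℝ) ≠ 0 := by positivity
      have e3 : (Pi.single j 1 : Fin (n + 1) → ℝ) =
          (t * d)⁻¹ • (homCoord d q - (1 - t) • homCoord d m0) := by
        funext k
        have ht0 := hts.1.ne'
        simp only [Pi.smul_apply, Pi.sub_apply, smul_eq_mul, hqh, hyh, Pi.single_apply]
        split_ifs <;> field_simp <;> ring
      rw [e3]
      exact Submodule.smul_mem _ _ (Submodule.sub_mem _ e1 (Submodule.smul_mem _ _ e2))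
    have hlt := Finset.card_lt_card (Finset.ssubset_iff_subset_ne.2 ⟨ht, hne⟩)
    obtain ⟨τ', h1, h2, h3, h4⟩ := ih (supp K q) (h.supp_mem hqP) hqJ (by omega)
    exact ⟨τ', h1, ht.trans h2, h3, h4⟩

theorem card_le {σ : Simplex n} (hσ : σ ∈ K) : σ.card ≤ n + 1 := by
  simpa using (h.linearIndependent_homCoord hd hσ).fintype_card_le_finrank

theorem pure {σ : Simplex n} (hσ : σ ∈ K) : ∃ τ ∈ K, σ ⊆ τ ∧ τ.card = n + 1 := by
  obtain ⟨τ, h1, h2, -, h3⟩ := h.exists_extension hd Finset.univ (n + 1) σ hσ (by simp) (by simp)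
  exact ⟨τ, h1, h2, le_antisymm (h.card_le hd h1) (by simpa using h3)⟩

/-- Two top-dimensional simplices with a common facet lying on the same side of it are equal. -/
theorem eq_of_same_side {τ : Simplex n} {c c' : Fin n → ℤ} (hτ : τ.card = n) (hne : τ.Nonempty)
    (hc : c ∉ τ) (hK : insert c τ ∈ K) (hK' : insert c' τ ∈ K)
    (f : (Fin (n + 1) → ℝ) →ₗ[ℝ] ℝ) (hf : ∀ a ∈ τ, f (homCoord d (toReal a)) = 0)
    (hfc : 0 < f (homCoord d (toReal c))) (hfc' : 0 < f (homCoord d (toReal c'))) : c = c' := by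
  classical
  by_contra hcc
  have hcard : (insert c τ).card = n + 1 := by rw [Finset.card_insert_of_notMem hc, hτ]
  -- `μ` gives the affine coordinates, possibly negative, of `c'` in the simplex `insert c τ`.
  -- Applying `f` shows that the one at `c` is positive.
  obtain ⟨μ, hμ0, hμ, hμs⟩ := h.exists_homCoord_combination hd hK hcard (homCoord d (toReal c'))
  rw [sum_homCoord] at hμs
  have hd' : (0 : ℝ) < d := by positivity
  have hμs : ∑ a ∈ insert c τ, μ a = 1 := by
    have := hμs
    field_simp at this
    exact this
  have hμc : 0 < μ c := by
    have e : homCoord d (toReal c') = ∑ a ∈ insert c τ, μ a • homCoord d (toReal a) := by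
      funext k; rw [← hμ k]; simp
    have e2 := congrArg f e
    rw [map_sum, Finset.sum_insert hc, Finset.sum_eq_zero (s := τ) fun a ha => by
      rw [map_smul, hf a ha, smul_zero], add_zero, map_smul, smul_eq_mul] at e2
    rw [e2] at hfc'
    exact pos_of_mul_pos_left hfc' hfc.le
  have hev : ∀ᶠ s in 𝓝[>] (0 : ℝ), ∀ a ∈ τ, 0 < (1 - s) * (τ.card : ℝ)⁻¹ + s * μ a := by
    refine (Finset.eventually_all _).2 fun a _ => ?_
    have hpos := hne.card_pos
    have : Tendsto (fun s : ℝ => (1 - s) * (τ.card : ℝ)⁻¹ + s * μ a) (𝓝[>] 0)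
        (𝓝 ((1 - 0) * (τ.card : ℝ)⁻¹ + 0 * μ a)) :=
      (Continuous.tendsto (by fun_prop) 0).mono_left nhdsWithin_le_nhds
    refine this.eventually (lt_mem_nhds ?_)
    simp only [sub_zero, one_mul, zero_mul, add_zero]
    positivity
  -- For small `s`, the point at parameter `s` from the barycentre of `τ` towards `c'` has
  -- nonnegative coordinates in both simplices. Uniqueness identifies the two systems of
  -- coordinates, although if `c ≠ c'` only the first one charges `c`.
  obtain ⟨s, hs, hs01⟩ := (hev.and (Ioo_mem_nhdsGT (zero_lt_one' ℝ))).exists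
  set bw : (Fin n → ℤ) → ℝ := fun a => if a ∈ τ then (τ.card : ℝ)⁻¹ else 0 with hbw
  have hbw1 := barycentre_weights hne
  have hu : (1 - s) • bw + s • (Pi.single c' 1) ∈ simplexWeights (insert c' τ) := by
    refine convex_simplexWeights _ (simplexWeights_mono (Finset.subset_insert _ _) hbw1) ?_
      (by linarith [hs01.2]) hs01.1.le (by ring)
    refine ⟨fun a => ?_, fun a ha => ?_, ?_⟩
    · rw [Pi.single_apply]; split_ifs <;> norm_num
    · exact Pi.single_eq_of_ne (fun e => ha (by rw [e]; exact Finset.mem_insert_self _ _)) _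
    · rw [Finset.sum_pi_single']; simp
  have hw : (1 - s) • bw + s • μ ∈ simplexWeights (insert c τ) := by
    refine ⟨fun a => ?_, fun a ha => ?_, ?_⟩
    · simp only [Pi.add_apply, Pi.smul_apply, smul_eq_mul]
      by_cases ha : a ∈ τ
      · rw [hbw]; dsimp only; rw [if_pos ha]; exact (hs a ha).le
      · rw [hbw]; dsimp only; rw [if_neg ha]
        by_cases hac : a = c
        · rw [hac]; have := mul_pos hs01.1 hμc; linarith
        · rw [hμ0 a (by simp [ha, hac])]; simp
    · have ha' : a ∉ τ := fun h' => ha (Finset.mem_insert_of_mem h')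
      simp [hbw, ha', hμ0 a ha]
    · simp only [Pi.add_apply, Pi.smul_apply, smul_eq_mul, Finset.sum_add_distrib, ← Finset.mul_sum]
      rw [hμs, (simplexWeights_mono (Finset.subset_insert c τ) hbw1).2.2]
      ring
  have hcoord : ∀ (v : (Fin n → ℤ) → ℝ) (e : Fin n → ℤ), v ∈ simplexWeights (insert e τ) →
      insert e τ ∈ K → wsum K v = ∑ a ∈ insert e τ, v a • toReal a := fun v e hv he =>
    wsum_eq he hv.2.1
  have hpt : wsum K μ = toReal c' := by
    rw [wsum_eq hK hμ0]
    funext k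
    rw [← sum_mul_homCoord_succ d, hμ, homCoord_succ]
  have hpt' : wsum K (Pi.single c' 1) = toReal c' := by
    rw [wsum_eq hK' fun a ha => Pi.single_eq_of_ne
      (fun e => ha (by rw [e]; exact Finset.mem_insert_self _ _)) _]
    simp only [Pi.single_apply, ite_smul, one_smul, zero_smul]
    simp
  have hlin : ∀ v : (Fin n → ℤ) → ℝ, wsum K ((1 - s) • bw + s • v) =
      (1 - s) • wsum K bw + s • wsum K v := fun v => by
    simp only [wsum, Pi.add_apply, Pi.smul_apply, smul_eq_mul, add_smul, mul_smul,
      Finset.sum_add_distrib, Finset.smul_sum]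
  have := h.unique _ ⟨_, hK, hw⟩ _ ⟨_, hK', hu⟩ (by rw [hlin, hlin, hpt, hpt'])
  have := congrFun this c
  simp only [Pi.add_apply, Pi.smul_apply, smul_eq_mul, hbw, if_neg hc, Pi.single_eq_of_ne hcc] at this
  have := mul_pos hs01.1 hμc
  linarith

omit h hd in
theorem exists_insert_of_mem_topCofaces {τ σ : Simplex n} (hτ : τ.card = n)
    (hσ : σ ∈ topCofaces K τ) : σ ∈ K ∧ ∃ c, c ∉ τ ∧ σ = insert c τ := by
  obtain ⟨h1, h2, h3⟩ := Finset.mem_filter.1 hσ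
  have : (σ \ τ).card = 1 := by rw [Finset.card_sdiff_of_subset h2]; omega
  obtain ⟨c, hc⟩ := Finset.card_eq_one.1 this
  refine ⟨h1, c, ?_, ?_⟩
  · have : c ∈ σ \ τ := by rw [hc]; simp
    exact (Finset.mem_sdiff.1 this).2
  · rw [← Finset.sdiff_union_of_subset h2, hc]; rfl

/-- A linear form vanishing on the facet is nonzero at the opposite vertex of any top simplex over
it. Of three such simplices two would be on the same side, hence equal. -/
theorem card_topCofaces_le_two {τ : Simplex n} (hne : τ.Nonempty) (hτ : τ.card = n) :
    (topCofaces K τ).card ≤ 2 := by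
  classical
  by_contra hcon
  obtain ⟨σ₁, σ₂, σ₃, h1, h2, h3, h12, h13, h23⟩ := Finset.two_lt_card_iff.1 (not_le.1 hcon)
  obtain ⟨k1, c₁, n1, rfl⟩ := exists_insert_of_mem_topCofaces hτ h1
  obtain ⟨k2, c₂, n2, rfl⟩ := exists_insert_of_mem_topCofaces hτ h2
  obtain ⟨k3, c₃, n3, rfl⟩ := exists_insert_of_mem_topCofaces hτ h3
  have hlt : Submodule.span ℝ (SetLike.coe (τ.image fun a =>
      (homCoord d (toReal a) : Fin (n + 1) → ℝ))) < ⊤ := by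
    refine lt_top_iff_ne_top.2 fun e => ?_
    obtain ⟨j, -, hj⟩ := exists_vertex_notMem_span (τ.image fun a => homCoord d (toReal a))
      Finset.univ (lt_of_le_of_lt Finset.card_image_le (by simp [hτ]))
    rw [e] at hj
    exact hj trivial
  obtain ⟨f, hf0, hf⟩ := Submodule.exists_le_ker_of_lt_top _ hlt
  have hfτ : ∀ a ∈ τ, f (homCoord d (toReal a)) = 0 := fun a ha =>
    hf (Submodule.subset_span (Finset.mem_coe.2 (Finset.mem_image_of_mem _ ha)))
  have hfc : ∀ c, c ∉ τ → insert c τ ∈ K → f (homCoord d (toReal c)) ≠ 0 := by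
    intro c hc hK e
    apply hf0
    have htop := h.span_homCoord hd hK (by rw [Finset.card_insert_of_notMem hc, hτ])
    refine LinearMap.ext_on htop ?_
    rintro _ ⟨⟨a, ha⟩, rfl⟩
    rcases Finset.mem_insert.1 ha with rfl | ha
    · simpa using e
    · simpa using hfτ a ha
  have pos : ∀ c c', c ∉ τ → c' ∉ τ → insert c τ ∈ K → insert c' τ ∈ K →
      0 < f (homCoord d (toReal c)) → 0 < f (homCoord d (toReal c')) → c = c' :=
    fun c c' hc _ hK hK' => h.eq_of_same_side hd hτ hne hc hK hK' f hfτ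
  have neg : ∀ c c', c ∉ τ → c' ∉ τ → insert c τ ∈ K → insert c' τ ∈ K →
      f (homCoord d (toReal c)) < 0 → f (homCoord d (toReal c')) < 0 → c = c' :=
    fun c c' hc _ hK hK' e e' => h.eq_of_same_side hd hτ hne hc hK hK' (-f)
      (fun a ha => by simp [hfτ a ha]) (by simpa using e) (by simpa using e')
  have e12 : c₁ ≠ c₂ := fun e => h12 (by rw [e])
  have e13 : c₁ ≠ c₃ := fun e => h13 (by rw [e])
  have e23 : c₂ ≠ c₃ := fun e => h23 (by rw [e])
  rcases (hfc c₁ n1 k1).lt_or_gt with s1 | s1 <;> rcases (hfc c₂ n2 k2).lt_or_gt with s2 | s2 <;>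
    rcases (hfc c₃ n3 k3).lt_or_gt with s3 | s3
  · exact e12 (neg _ _ n1 n2 k1 k2 s1 s2)
  · exact e12 (neg _ _ n1 n2 k1 k2 s1 s2)
  · exact e13 (neg _ _ n1 n3 k1 k3 s1 s3)
  · exact e23 (pos _ _ n2 n3 k2 k3 s2 s3)
  · exact e23 (neg _ _ n2 n3 k2 k3 s2 s3)
  · exact e13 (pos _ _ n1 n3 k1 k3 s1 s3)
  · exact e12 (pos _ _ n1 n2 k1 k2 s1 s2)
  · exact e12 (pos _ _ n1 n2 k1 k2 s1 s2)

/-- The lattice points on the boundary of the standard simplex are vertices of the boundary of the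
triangulation. -/
theorem isVertexOf_bd {σ : Simplex n} (hσ : σ ∈ K) {a : Fin n → ℤ} (ha : a ∈ σ)
    {i : Fin (n + 1)} (hi : homCoord d a i = 0) : IsVertexOf (bd K) a := by
  classical
  have haK : {a} ∈ K := h.down_closed σ hσ _ (by simpa using ha) (by simp)
  -- The vertex is extended to a simplex of dimension `n - 1` inside the facet `i` of the polytope;
  -- this simplex is then shown to have a single coface.
  obtain ⟨τ, hτ, haτ, hτJ, hτc⟩ := h.exists_extension hd (Finset.univ.erase i) (n + 1) {a} haK
    (by simpa using hi) (by simp; omega)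
  have hτi : ∀ b ∈ τ, homCoord d b i = 0 := fun b hb => hτJ b hb i (by simp)
  have hτc : n ≤ τ.card := by simpa using hτc
  have hτc : τ.card = n := by
    refine le_antisymm ?_ hτc
    by_contra hc
    have hc' : τ.card = n + 1 := le_antisymm (h.card_le hd hτ) (by omega)
    -- With `n + 1` vertices `τ` would span, and the vector with all entries `1` would be a
    -- combination of vectors with zero `i`-th entry.
    obtain ⟨μ, -, hμ, -⟩ := h.exists_homCoord_combination hd hτ hc' (fun _ => 1)
    have := hμ i
    rw [Finset.sum_eq_zero fun b hb => by rw [homCoord_toReal, hτi b hb]; simp] at this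
    exact zero_ne_one this
  have hne : τ.Nonempty := h.nonempty τ hτ
  refine ⟨τ, Finset.mem_filter.2 ⟨hτ, τ, hτ, subset_rfl, hτc, ?_⟩, haτ (by simp)⟩
  obtain ⟨σ', hσ', hτσ, hσc⟩ := h.pure hd hτ
  refine Finset.card_eq_one.2 ⟨σ', Finset.eq_singleton_iff_unique_mem.2
    ⟨Finset.mem_filter.2 ⟨hσ', hτσ, hσc⟩, fun σ'' hσ'' => ?_⟩⟩
  obtain ⟨k1, c, hc, rfl⟩ := exists_insert_of_mem_topCofaces hτc
    (Finset.mem_filter.2 ⟨hσ', hτσ, hσc⟩ : σ' ∈ topCofaces K τ)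
  obtain ⟨k2, c', hc', rfl⟩ := exists_insert_of_mem_topCofaces hτc hσ''
  -- All top simplices over `τ` lie on the side where the `i`-th coordinate is positive, so they
  -- coincide.
  have pos : ∀ c, c ∉ τ → insert c τ ∈ K → 0 < homCoord d (toReal c) i := by
    intro c hc hK
    have h0 := mem_sizedSimplex.1 (h.vertex_mem _ hK c (Finset.mem_insert_self _ _)) i
    refine lt_of_le_of_ne h0 fun e => ?_
    obtain ⟨μ, -, hμ, -⟩ := h.exists_homCoord_combination hd hK
      (by rw [Finset.card_insert_of_notMem hc, hτc]) (fun _ => 1)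
    have := hμ i
    rw [Finset.sum_eq_zero fun b hb => ?_] at this
    · exact zero_ne_one this
    · rcases Finset.mem_insert.1 hb with rfl | hb
      · rw [← e, mul_zero]
      · rw [homCoord_toReal, hτi b hb]; simp
  rw [h.eq_of_same_side hd hτc hne hc k1 k2 (LinearMap.proj i)
    (fun b hb => by simp [homCoord_toReal, hτi b hb]) (pos c hc k1) (pos c' hc' k2)]

-- A locally constant function on the connected interval is constant; the target carries the
-- discrete topology.
omit h hd in
theorem eq_of_eventually_eq {α : Type*} (f : ℝ → α)
    (hf : ∀ t ∈ Set.Icc (0 : ℝ) 1, ∀ᶠ s in 𝓝[Set.Icc 0 1] t, f s = f t) : f 0 = f 1 := by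
  let _ : TopologicalSpace α := ⊥
  have : DiscreteTopology α := ⟨rfl⟩
  refine isPreconnected_Icc.constant (f := f) (s := Set.Icc (0 : ℝ) 1) ?_ (by simp) (by simp)
  intro t ht
  exact tendsto_const_nhds.congr' ((hf t ht).mono fun s hs => hs.symm)

omit hd in
theorem interior_hull_nonempty {σ : Simplex n} (hσ : σ ∈ K) (hc : σ.card = n + 1) :
    (interior (hull σ)).Nonempty := by
  classical
  have hai : AffineIndependent ℝ fun a : σ => toReal a.1 := by
    rw [affineIndependent_iff]
    intro s w h0 h1 e he
    set μ : (Fin n → ℤ) → ℝ := fun a => if ha : a ∈ σ then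
      (if (⟨a, ha⟩ : σ) ∈ s then w ⟨a, ha⟩ else 0) else 0 with hμ
    have := h.indep σ hσ μ (by
        rw [← h0, ← Finset.sum_attach]
        simp only [hμ, Finset.coe_mem, dite_true, Subtype.coe_eta, Finset.sum_ite_mem]
        rw [Finset.inter_eq_right.2 fun x _ => Finset.mem_attach _ x]) (by
        rw [← h1, ← Finset.sum_attach]
        simp only [hμ, Finset.coe_mem, dite_true, Subtype.coe_eta, ite_smul, zero_smul, Finset.sum_ite_mem]
        rw [Finset.inter_eq_right.2 fun x _ => Finset.mem_attach _ x]) e.1 e.2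
    simpa [hμ, he] using this
  rw [hull, interior_convexHull_nonempty_iff_affineSpan_eq_top]
  have := hai.affineSpan_eq_top_iff_card_eq_finrank_add_one.2 (by simp [hc])
  have e : toReal '' (σ : Set (Fin n → ℤ)) = Set.range fun a : σ => toReal a.1 := by
    ext x; simp
  rw [e]
  exact this

/-- The top-dimensional simplices are connected through their facets. -/
theorem topSimplex_connected {α : Type*} (φ : Simplex n → α)
    (hφ : ∀ σ ∈ K, ∀ σ' ∈ K, σ.card = n + 1 → σ'.card = n + 1 → (σ ∩ σ').card = n → φ σ = φ σ')
    {σ σ' : Simplex n} (hσ : σ ∈ K) (hσ' : σ' ∈ K) (hc : σ.card = n + 1) (hc' : σ'.card = n + 1) :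
    φ σ' = φ σ := by
  classical
  set p := barycentre σ with hp
  have hpP := h.barycentre_mem hσ
  -- The joins of the starting point with the faces of codimension at least two span proper affine
  -- subspaces. Their union is negligible, and an endpoint `q` outside it gives a segment that meets
  -- only simplices with at least `n` vertices.
  have hnull : MeasureTheory.volume (⋃ κ ∈ K.filter (fun κ => κ.card < n),
      (affineSpan ℝ (insert p (toReal '' (κ : Set (Fin n → ℤ)))) : Set (Fin n → ℝ))) = 0 := by
    refine (MeasureTheory.measure_biUnion_null_iff (Finset.countable_toSet _)).2 fun κ hκ => ?_
    obtain ⟨hκ, hκc⟩ := Finset.mem_filter.1 hκ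
    refine MeasureTheory.Measure.addHaar_affineSubspace _ _ fun e => ?_
    have h1 := finrank_vectorSpan_insert_le_set ℝ (toReal '' (κ : Set (Fin n → ℤ))) p
    obtain ⟨m, hm⟩ : ∃ m, κ.card = m + 1 :=
      ⟨κ.card - 1, by have := (h.nonempty κ hκ).card_pos; omega⟩
    have h2 := finrank_vectorSpan_image_finset_le ℝ (toReal : (Fin n → ℤ) → Fin n → ℝ) κ hm
    rw [Finset.coe_image] at h2
    rw [← direction_affineSpan, e, AffineSubspace.direction_top, finrank_top,
      Module.finrank_fin_fun] at h1
    omega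
  obtain ⟨q, hq, hqA⟩ : ∃ q ∈ interior (hull σ'), q ∉ ⋃ κ ∈ K.filter (fun κ => κ.card < n),
      (affineSpan ℝ (insert p (toReal '' (κ : Set (Fin n → ℤ)))) : Set (Fin n → ℝ)) := by
    by_contra hcon
    push Not at hcon
    exact (isOpen_interior.measure_pos MeasureTheory.volume (h.interior_hull_nonempty hσ' hc')).ne'
      (MeasureTheory.measure_mono_null hcon hnull)
  obtain ⟨hqP, hqs⟩ := (h.mem_hull hσ').1 (interior_subset hq)
  set γ : ℝ → Fin n → ℝ := fun t => (1 - t) • p + t • q with hγ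
  have hγP : ∀ t ∈ Set.Icc (0 : ℝ) 1, γ t ∈ sizedSimplex n d := fun t ht =>
    h.convex hpP hqP (by linarith [ht.2]) ht.1 (by ring)
  have hγ0 : γ 0 = p := by simp [hγ]
  have hγ1 : γ 1 = q := by simp [hγ]
  have hγc : Continuous γ := by fun_prop
  -- For `t > 0`, the endpoint `q` is on the line through `p` and `γ t`, so a support with fewer
  -- than `n` vertices at `γ t` would put `q` in the excluded set.
  have hcard : ∀ t ∈ Set.Icc (0 : ℝ) 1, n ≤ (supp K (γ t)).card := by
    intro t ht
    by_contra hlt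
    rcases ht.1.eq_or_lt with rfl | ht0
    · rw [hγ0, hp, h.supp_barycentre hσ] at hlt
      omega
    · apply hqA
      refine Set.mem_iUnion₂.2 ⟨_, Finset.mem_filter.2 ⟨h.supp_mem (hγP t ht), not_le.1 hlt⟩, ?_⟩
      set κ := supp K (γ t)
      set A := affineSpan ℝ (insert p (toReal '' (κ : Set (Fin n → ℤ)))) with hA
      have e1 : p ∈ A := subset_affineSpan _ _ (Set.mem_insert _ _)
      have e2 : γ t ∈ A := by
        have : γ t ∈ hull κ := (h.mem_hull (h.supp_mem (hγP t ht))).2 ⟨hγP t ht, subset_rfl⟩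
        exact affineSpan_mono ℝ (Set.subset_insert _ _) (convexHull_subset_affineSpan _ this)
      have e3 := AffineMap.lineMap_mem (Q := A) t⁻¹ e1 e2
      have e4 : AffineMap.lineMap p (γ t) t⁻¹ = q := by
        rw [AffineMap.lineMap_apply_module]
        funext i
        simp only [hγ, Pi.add_apply, Pi.smul_apply, smul_eq_mul]
        field_simp
        ring
      rwa [e4] at e3
  have hadj : ∀ t ∈ Set.Icc (0 : ℝ) 1, ∀ σ₁ ∈ K, ∀ σ₂ ∈ K, σ₁.card = n + 1 → σ₂.card = n + 1 →
      supp K (γ t) ⊆ σ₁ → supp K (γ t) ⊆ σ₂ → φ σ₁ = φ σ₂ := by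
    intro t ht σ₁ h1 σ₂ h2 c1 c2 s1 s2
    by_cases he : σ₁ = σ₂
    · rw [he]
    refine hφ σ₁ h1 σ₂ h2 c1 c2 (le_antisymm ?_ ?_)
    · by_contra hlt
      have e1 := Finset.eq_of_subset_of_card_le (Finset.inter_subset_left (s₁ := σ₁) (s₂ := σ₂))
        (by omega)
      have e2 := Finset.eq_of_subset_of_card_le (Finset.inter_subset_right (s₁ := σ₁) (s₂ := σ₂))
        (by omega)
      exact he (e1.symm.trans e2)
    · exact (hcard t ht).trans (Finset.card_le_card (Finset.subset_inter s1 s2))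
  -- The property propagated along the segment is that every top simplex containing the point has
  -- the value `φ σ`. Near `t` supports can only grow, and two top simplices containing the same
  -- point share at least `n` vertices.
  have key := eq_of_eventually_eq (fun t => ∀ ς ∈ K, ς.card = n + 1 → supp K (γ t) ⊆ ς → φ ς = φ σ) (by
    intro t ht
    have hev : ∀ᶠ s in 𝓝[Set.Icc 0 1] t, supp K (γ t) ⊆ supp K (γ s) := by
      have : Tendsto γ (𝓝[Set.Icc 0 1] t) (𝓝[sizedSimplex n d] (γ t)) :=
        tendsto_nhdsWithin_iff.2 ⟨hγc.continuousWithinAt,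
          eventually_of_mem self_mem_nhdsWithin hγP⟩
      exact this.eventually (h.eventually_supp_subset (hγP t ht))
    filter_upwards [hev, self_mem_nhdsWithin] with s hs hsI
    refine propext ⟨fun H ς hς hςc hsub => ?_, fun H ς hς hςc hsub => H ς hς hςc (hs.trans hsub)⟩
    obtain ⟨σ₁, k1, k2, k3⟩ := h.pure hd (h.supp_mem (hγP s hsI))
    rw [← H σ₁ k1 k3 k2]
    exact hadj t ht ς hς σ₁ k1 hςc k3 hsub (hs.trans k2))
  rw [hγ0, hγ1, hp, h.supp_barycentre hσ] at key
  refine key.mp (fun ς hς hςc hsub => ?_) σ' hσ' hc' hqs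
  rw [Finset.eq_of_subset_of_card_le hsub (by omega)]

end IsTri

/-- The vertices span over `ℝ`, so an integral vector has real coefficients on them. Its moments are
integers, so `mem_of_moments` with `H = ℤ` makes the coefficients integers. -/
theorem itenbergViro_primitive (hn : 1 ≤ n) (hd : 1 ≤ d) {σ : Simplex n}
    (hσ : σ ∈ itenbergViro n d) (hc : σ.card = n + 1) (a : Fin n → ℤ) :
    Submodule.span ℤ {x : Fin n → ℤ | ∃ b ∈ σ, x = b - a} = ⊤ := by
  rw [eq_top_iff]
  intro z _
  have h := itenbergViro_isTri hn hd
  -- The homogeneous lift of `z` is completed to sum `0`, so that the coefficients have sum `0` and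
  -- can be placed on differences of vertices.
  obtain ⟨μ, -, hμ, hμs⟩ := h.exists_homCoord_combination hd hσ hc
    (fun k => ((Fin.cons (-∑ i, z i) z : Fin (n + 1) → ℤ) k : ℝ))
  have hd' : (d : ℝ) ≠ 0 := by positivity
  have h0 : ∑ a ∈ σ, μ a = 0 := by
    rw [Fin.sum_univ_succ] at hμs
    simp only [Fin.cons_zero, Fin.cons_succ] at hμs
    push_cast at hμs
    rw [neg_add_cancel] at hμs
    exact (mul_eq_zero.1 hμs).resolve_left hd'
  have hint := mem_of_moments (Int.castAddHom ℝ).range (n + 1) σ (homCoord d) μ d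
    (homCoord_injective d).injOn ((mem_itenbergViro n d hn hd σ).1 hσ).2.2
    (fun a _ => sum_homCoord d a) (by rw [h0]; exact AddSubgroup.zero_mem _) (fun k => by
      simp only [← homCoord_toReal]
      rw [hμ k]
      exact ⟨_, rfl⟩)
  choose! m hm using fun i hi => AddMonoidHom.mem_range.1 (hint i hi)
  have e : z = ∑ b ∈ σ, m b • (b - a) := by
    have h1 : ∑ b ∈ σ, m b = 0 := by
      have : ((∑ b ∈ σ, m b : ℤ) : ℝ) = 0 := by
        push_cast
        rw [← h0]
        exact Finset.sum_congr rfl fun b hb => hm b hb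
      exact_mod_cast this
    simp only [smul_sub, Finset.sum_sub_distrib, ← Finset.sum_smul, h1, zero_smul, sub_zero]
    funext i
    have h2 := hμ i.succ
    simp only [Fin.cons_succ, homCoord_succ] at h2
    rw [Finset.sum_congr rfl fun b hb => by rw [← hm b hb]] at h2
    simp only [Int.coe_castAddHom, toReal] at h2
    simp only [Finset.sum_apply, Pi.smul_apply, smul_eq_mul]
    exact_mod_cast h2.symm
  rw [e]
  exact Submodule.sum_mem _ fun b hb => Submodule.smul_mem _ _ (Submodule.subset_span ⟨b, hb, rfl⟩)

theorem itenbergViro_isPrimitiveTriangulation (hn : 1 ≤ n) (hd : 1 ≤ d) :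
    IsPrimitiveTriangulation (sizedSimplex n d) (itenbergViro n d) :=
  (itenbergViro_isTri hn hd).isPrimitiveTriangulation
    (fun _ hσ => (itenbergViro_isTri hn hd).pure hd hσ)
    (fun _ hσ hc a _ => itenbergViro_primitive hn hd hσ hc a)

end Sized

/-! ### Linear algebra modulo `2` on a primitive simplex -/

section ModTwo

variable {n : ℕ}

theorem pairing_apply (a : Fin n → ℤ) (v : Fin n → ZMod 2) :
    pairing a v = ∑ i, (a i : ZMod 2) * v i := by
  simp [pairing]

theorem pairing_add_left (a b : Fin n → ℤ) (v : Fin n → ZMod 2) :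
    pairing (a + b) v = pairing a v + pairing b v := by
  simp [pairing_apply, add_mul, Finset.sum_add_distrib]

theorem pairing_sub_left (a b : Fin n → ℤ) (v : Fin n → ZMod 2) :
    pairing (a - b) v = pairing a v - pairing b v := by
  simp [pairing_apply, sub_mul, Finset.sum_sub_distrib]

theorem mem_normal {σ : Simplex n} {v : Fin n → ZMod 2} :
    v ∈ normal σ ↔ ∀ a ∈ σ, ∀ b ∈ σ, pairing (b - a) v = 0 := by
  rw [normal, LinearMap.mem_ker]
  constructor
  · intro h a ha b hb
    exact congrFun (congrFun h ⟨a, ha⟩) ⟨b, hb⟩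
  · intro h
    funext a b
    exact h a.1 a.2 b.1 b.2

/-- The lattice generated by the edges of `σ` is the whole lattice. -/
def IsUnimodular (σ : Simplex n) : Prop :=
  σ.card = n + 1 ∧ ∀ a ∈ σ, Submodule.span ℤ {x : Fin n → ℤ | ∃ b ∈ σ, x = b - a} = ⊤

theorem IsUnimodular.eq_zero {σ : Simplex n} (h : IsUnimodular σ) {v : Fin n → ZMod 2} {a : Fin n → ℤ}
    (ha : a ∈ σ) (hv : ∀ b ∈ σ, pairing (b - a) v = 0) : v = 0 := by
  have key : ∀ z ∈ Submodule.span ℤ {x : Fin n → ℤ | ∃ b ∈ σ, x = b - a}, pairing z v = 0 := by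
    intro z hz
    induction hz using Submodule.span_induction with
    | mem x hx => obtain ⟨b, hb, rfl⟩ := hx; exact hv b hb
    | zero => simp [pairing_apply]
    | add x y _ _ hx hy => rw [pairing_add_left, hx, hy, add_zero]
    | smul c x _ hx =>
      rw [pairing_apply] at hx ⊢
      simp only [Pi.smul_apply, smul_eq_mul, Int.cast_mul, mul_assoc, ← Finset.mul_sum, hx, mul_zero]
  rw [h.2 a ha] at key
  funext i
  have := key (Pi.single i 1) trivial
  rw [pairing_apply, Finset.sum_eq_single i] at this
  · simpa using this
  · intro j _ hj; rw [Pi.single_eq_of_ne hj]; simp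
  · simp

/-- Evaluation on the `n` edges issued from one vertex is injective by unimodularity, and its source
and target both have dimension `n`, so it is bijective. -/
theorem IsUnimodular.exists_quadrant {σ : Simplex n} (h : IsUnimodular σ)
    (ε : (Fin n → ℤ) → ZMod 2) :
    ∃ v : Fin n → ZMod 2, ∀ a ∈ σ, ∀ b ∈ σ, pairing (b - a) v = ε b - ε a := by
  classical
  obtain ⟨a₀, ha₀⟩ : σ.Nonempty := Finset.card_pos.1 (by rw [h.1]; omega)
  let T : (Fin n → ZMod 2) →ₗ[ZMod 2] ({x // x ∈ σ.erase a₀} → ZMod 2) :=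
    LinearMap.pi fun b => pairing (b.1 - a₀)
  have hT : Function.Injective T := by
    rw [injective_iff_map_eq_zero]
    intro v hv
    refine h.eq_zero ha₀ fun b hb => ?_
    by_cases hba : b = a₀
    · subst hba; simp [pairing_apply]
    · exact congrFun hv ⟨b, Finset.mem_erase.2 ⟨hba, hb⟩⟩
  have hsurj : Function.Surjective T := by
    refine (LinearMap.injective_iff_surjective_of_finrank_eq_finrank ?_).1 hT
    simp [Finset.card_erase_of_mem ha₀, h.1]
  obtain ⟨v, hv⟩ := hsurj fun b => ε b.1 - ε a₀
  have hv' : ∀ b ∈ σ, pairing (b - a₀) v = ε b - ε a₀ := by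
    intro b hb
    by_cases hba : b = a₀
    · subst hba; simp [pairing_apply]
    · exact congrFun hv ⟨b, Finset.mem_erase.2 ⟨hba, hb⟩⟩
  refine ⟨v, fun a ha b hb => ?_⟩
  have h1 := hv' a ha
  have h2 := hv' b hb
  rw [pairing_sub_left] at h1 h2 ⊢
  linear_combination h2 - h1

open scoped Classical in
/-- The quadrant over which the simplex `σ` is monochromatic. -/
noncomputable def monoQuadrant (ε : (Fin n → ℤ) → ZMod 2) (σ : Simplex n) : Fin n → ZMod 2 :=
  if h : ∃ v : Fin n → ZMod 2, ∀ a ∈ σ, ∀ b ∈ σ, pairing (b - a) v = ε b - ε a then h.choose else 0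

theorem IsUnimodular.monoQuadrant_spec {σ : Simplex n} (h : IsUnimodular σ)
    (ε : (Fin n → ℤ) → ZMod 2) {a b : Fin n → ℤ} (ha : a ∈ σ) (hb : b ∈ σ) :
    pairing (b - a) (monoQuadrant ε σ) = ε b - ε a := by
  rw [monoQuadrant, dif_pos (h.exists_quadrant ε)]
  exact (h.exists_quadrant ε).choose_spec a ha b hb

/-- Over the quadrant `v`, the vertex `α` has the sign opposite to that of all its neighbours. -/
def Isolated (K : SComplex n) (ε : (Fin n → ℤ) → ZMod 2) (α : Fin n → ℤ) (v : Fin n → ZMod 2) :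
    Prop :=
  ∀ σ ∈ K, α ∈ σ → ∀ y ∈ σ, y ≠ α → ε α + ε y + pairing (y - α) v = 1

/-- Over `monoQuadrant ε σ` all signs agree, while over `v` only `α` differs. The sum of the two
quadrants thus pairs to `1` with the edges at `α` and to `0` with the others, which characterises
the generator of the line attached to `α`. -/
theorem dualVector_eq {K : SComplex n} {ε : (Fin n → ℤ) → ZMod 2} {α : Fin n → ℤ}
    {v : Fin n → ZMod 2} (hv : Isolated K ε α v) {σ : Simplex n} (hσ : σ ∈ K) (h : IsUnimodular σ)
    (hα : α ∈ σ) (hn : 1 ≤ n) : dualVector σ α = monoQuadrant ε σ + v := by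
  set V := monoQuadrant ε σ with hV
  have hVs : ∀ {a b}, a ∈ σ → b ∈ σ → pairing (b - a) V = ε b - ε a := h.monoQuadrant_spec ε
  have h1 : ∀ y ∈ σ, y ≠ α → pairing (y - α) (V + v) = 1 := by
    intro y hy hya
    rw [map_add, hVs hα hy]
    have := hv σ hσ hα y hy hya
    have dec : ∀ p q r : ZMod 2, p + q + r = 1 → q - p + r = 1 := by decide
    exact dec _ _ _ this
  obtain ⟨b, hb⟩ : (σ.erase α).Nonempty := by
    rw [← Finset.card_pos, Finset.card_erase_of_mem hα, h.1]; omega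
  obtain ⟨hbα, hbσ⟩ := Finset.mem_erase.1 hb
  have hmem : V + v ∈ normal (σ.erase α) := by
    rw [mem_normal]
    intro x hx y hy
    rw [Finset.mem_erase] at hx hy
    rw [show y - x = (y - α) - (x - α) by abel, pairing_sub_left, h1 y hy.2 hy.1, h1 x hx.2 hx.1,
      sub_self]
  have hne : V + v ≠ 0 := by
    intro e
    have := h1 b hbσ hbα
    rw [e, map_zero] at this
    exact zero_ne_one this
  have hex : ∃ w ∈ normal (σ.erase α), w ≠ 0 := ⟨_, hmem, hne⟩
  rw [dualVector, lineGenerator, dif_pos hex]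
  obtain ⟨hw, hw0⟩ := hex.choose_spec
  set w := hex.choose
  rw [mem_normal] at hw
  have hsplit : ∀ y ∈ σ.erase α, pairing (y - α) w = pairing (b - α) w := by
    intro y hy
    rw [show y - α = (y - b) + (b - α) by abel, pairing_add_left, hw b hb y hy, zero_add]
  have hw1 : pairing (b - α) w = 1 := by
    by_contra hc
    have h0 : pairing (b - α) w = 0 := by
      have dec : ∀ p : ZMod 2, p ≠ 1 → p = 0 := by decide
      exact dec _ hc
    refine hw0 (h.eq_zero hα fun y hy => ?_)
    by_cases hya : y = α
    · subst hya; simp [pairing_apply]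
    · rw [hsplit y (Finset.mem_erase.2 ⟨hya, hy⟩), h0]
  have : w - (V + v) = 0 := by
    refine h.eq_zero hα fun y hy => ?_
    by_cases hya : y = α
    · subst hya; simp [pairing_apply]
    · rw [map_sub, hsplit y (Finset.mem_erase.2 ⟨hya, hy⟩), hw1, h1 y hy hya, sub_self]
  exact sub_eq_zero.1 this

/-- The isolating quadrant occurs once for each of the two cofaces and cancels. What is left does
not depend on `α`, which gives `ρ`-uniformity. -/
theorem rho_eq {K : SComplex n} (hK : ∀ σ ∈ K, σ.card = n + 1 → IsUnimodular σ)
    {ε : (Fin n → ℤ) → ZMod 2} {α : Fin n → ℤ}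
    {v : Fin n → ZMod 2} (hv : Isolated K ε α v) (hn : 1 ≤ n) {τ : Simplex n} (hα : α ∈ τ)
    (hτ : (topCofaces K τ).card = 2) :
    rho K τ α = ∑ σ ∈ topCofaces K τ, monoQuadrant ε σ := by
  have : ∀ σ ∈ topCofaces K τ, dualVector σ α = monoQuadrant ε σ + v := by
    intro σ hσ
    obtain ⟨h1, h2, h3⟩ := Finset.mem_filter.1 hσ
    exact dualVector_eq hv h1 (hK σ h1 h3) (h2 hα) hn
  rw [rho, Finset.sum_congr rfl this, Finset.sum_add_distrib, Finset.sum_const, hτ, two_nsmul,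
    ZModModule.add_self, add_zero]

/-! ### The second derivative -/

theorem bd_faceClosed (K : SComplex n) : IsFaceClosed K (bd K) := by
  intro σ hσ τ hτ h
  obtain ⟨-, κ, h1, h2, h3⟩ := Finset.mem_filter.1 hσ
  exact Finset.mem_filter.2 ⟨hτ, κ, h1, h.trans h2, h3⟩

/-- The boundary operator on chains with constant coefficients in `𝔱(𝔽₂)`. -/
def constBoundary {K L : SComplex n} (i j : ℕ) (c : {σ // σ ∈ cells K L i} → Fin n → ZMod 2)
    (τ : {τ // τ ∈ cells K L j}) : Fin n → ZMod 2 :=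
  ∑ σ : {σ // σ ∈ cells K L i}, if τ.1 ⊆ σ.1 ∧ i = j + 1 then c σ else 0

theorem boundary_constCosheaf (K L : SComplex n) (i j : ℕ)
    (c : {σ // σ ∈ cells K L i} → Fin n → ZMod 2) :
    boundary (constCosheaf n) K L i j c = constBoundary i j c := by
  funext τ
  refine Finset.sum_congr rfl fun σ _ => ?_
  by_cases h : τ.1 ⊆ σ.1 ∧ i = j + 1
  · exact (dif_pos h).trans (if_pos h).symm
  · exact (dif_neg h).trans (if_neg h).symm

/-- Exactly two faces lie strictly between a simplex and a face of codimension two; their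
contributions are equal and cancel modulo `2`. -/
theorem constBoundary_constBoundary {K L : SComplex n} (hK : ∀ σ ∈ K, ∀ τ ⊆ σ, τ.Nonempty → τ ∈ K)
    (hL : IsFaceClosed K L) (i j k : ℕ) (c : {σ // σ ∈ cells K L i} → Fin n → ZMod 2)
    (ρ : {ρ // ρ ∈ cells K L k}) : constBoundary j k (constBoundary i j c) ρ = 0 := by
  classical
  unfold constBoundary
  by_cases hij : i = j + 1 ∧ j = k + 1
  swap
  · refine Finset.sum_eq_zero fun τ _ => ?_
    split_ifs with h1
    · refine Finset.sum_eq_zero fun σ _ => if_neg fun h2 => hij ⟨h2.2, h1.2⟩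
    · rfl
  obtain ⟨rfl, rfl⟩ := hij
  have e : ∀ τ : {τ // τ ∈ cells K L (k + 1)},
      (if ρ.1 ⊆ τ.1 ∧ k + 1 = k + 1 then ∑ σ : {σ // σ ∈ cells K L (k + 1 + 1)},
        (if τ.1 ⊆ σ.1 ∧ k + 1 + 1 = k + 1 + 1 then c σ else 0) else 0) =
      ∑ σ : {σ // σ ∈ cells K L (k + 1 + 1)},
        if ρ.1 ⊆ τ.1 ∧ τ.1 ⊆ σ.1 then c σ else 0 := by
    intro τ
    by_cases h : ρ.1 ⊆ τ.1 <;> simp [h]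
  rw [Finset.sum_congr rfl fun τ _ => e τ, Finset.sum_comm]
  refine Finset.sum_eq_zero fun σ _ => ?_
  obtain ⟨hσK, hσL, hσc⟩ := Finset.mem_filter.1 σ.2
  obtain ⟨hρK, hρL, hρc⟩ := Finset.mem_filter.1 ρ.2
  by_cases hρσ : ρ.1 ⊆ σ.1
  swap
  · exact Finset.sum_eq_zero fun τ _ => if_neg fun h => hρσ (h.1.trans h.2)
  obtain ⟨x, y, hxy, hd⟩ := Finset.card_eq_two.1
    (show (σ.1 \ ρ.1).card = 2 by rw [Finset.card_sdiff_of_subset hρσ]; omega)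
  have hmem : ∀ z, z ∈ σ.1 \ ρ.1 → insert z ρ.1 ∈ cells K L (k + 1) := by
    intro z hz
    obtain ⟨hzσ, hzρ⟩ := Finset.mem_sdiff.1 hz
    have h1 : insert z ρ.1 ∈ K :=
      hK σ.1 hσK _ (Finset.insert_subset hzσ hρσ) (Finset.insert_nonempty _ _)
    exact Finset.mem_filter.2 ⟨h1, fun h2 => hρL (hL _ h2 _ hρK (Finset.subset_insert _ _)),
      by rw [Finset.card_insert_of_notMem hzρ, hρc]⟩
  have hx : x ∈ σ.1 \ ρ.1 := by rw [hd]; simp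
  have hy : y ∈ σ.1 \ ρ.1 := by rw [hd]; simp
  have hxyne : (⟨_, hmem x hx⟩ : {τ // τ ∈ cells K L (k + 1)}) ≠ ⟨_, hmem y hy⟩ := by
    intro h
    have e : insert x ρ.1 = insert y ρ.1 := congrArg Subtype.val h
    have h1 : x ∈ insert y ρ.1 := by
      rw [← e]; exact Finset.mem_insert_self _ _
    rcases Finset.mem_insert.1 h1 with h1 | h1
    · exact hxy h1
    · exact (Finset.mem_sdiff.1 hx).2 h1
  rw [← Finset.sum_subset (Finset.subset_univ {⟨_, hmem x hx⟩, ⟨_, hmem y hy⟩}),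
    Finset.sum_pair hxyne]
  · rw [if_pos, if_pos, ZModModule.add_self]
    · exact ⟨Finset.subset_insert _ _, Finset.insert_subset (Finset.mem_sdiff.1 hy).1 hρσ⟩
    · exact ⟨Finset.subset_insert _ _, Finset.insert_subset (Finset.mem_sdiff.1 hx).1 hρσ⟩
  · intro τ _ hτ
    refine if_neg fun h => hτ ?_
    obtain ⟨-, -, hτc⟩ := Finset.mem_filter.1 τ.2
    obtain ⟨z, hz⟩ := Finset.card_eq_one.1
      (show (τ.1 \ ρ.1).card = 1 by rw [Finset.card_sdiff_of_subset h.1]; omega)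
    have hτz : τ.1 = insert z ρ.1 := by
      rw [← Finset.sdiff_union_of_subset h.1, hz]; rfl
    have hzd : z ∈ σ.1 \ ρ.1 := by
      have : z ∈ τ.1 \ ρ.1 := by rw [hz]; simp
      exact Finset.mem_sdiff.2 ⟨h.2 (Finset.mem_sdiff.1 this).1, (Finset.mem_sdiff.1 this).2⟩
    rw [hd] at hzd
    rcases Finset.mem_insert.1 hzd with rfl | hzd
    · exact Finset.mem_insert.2 (Or.inl (Subtype.ext hτz))
    · rw [Finset.mem_singleton] at hzd
      subst hzd
      exact Finset.mem_insert.2 (Or.inr (Finset.mem_singleton.2 (Subtype.ext hτz)))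

theorem boundary_cotangentProj {K L : SComplex n} (i j : ℕ)
    (b : {σ // σ ∈ cells K L i} → Fin n → ZMod 2) (τ : {τ // τ ∈ cells K L j}) :
    boundary (cotangentCosheaf n) K L i j (cotangentProj b) τ =
      (normal τ.1).mkQ (constBoundary i j b τ) := by
  refine Eq.trans ?_ (map_sum (normal τ.1).mkQ _ _).symm
  refine Finset.sum_congr rfl fun σ _ => ?_
  by_cases h : τ.1 ⊆ σ.1 ∧ i = j + 1
  · exact (dif_pos h).trans (congrArg (normal τ.1).mkQ (if_pos h)).symm
  · exact (dif_neg h).trans ((congrArg (normal τ.1).mkQ (if_neg h)).trans (map_zero _)).symm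

theorem subtype_boundary_normalCosheaf {K L : SComplex n} (i j : ℕ)
    (a : Chains (normalCosheaf n) K L i) (τ : {τ // τ ∈ cells K L j}) :
    (normal τ.1).subtype (boundary (normalCosheaf n) K L i j a τ) =
      constBoundary i j (normalIncl a) τ := by
  refine Eq.trans (map_sum (normal τ.1).subtype _ _) ?_
  refine Finset.sum_congr rfl fun σ _ => ?_
  by_cases h : τ.1 ⊆ σ.1 ∧ i = j + 1
  · exact (congrArg (normal τ.1).subtype (dif_pos h)).trans (if_pos h).symm
  · exact ((congrArg (normal τ.1).subtype (dif_neg h)).trans (map_zero _)).trans (if_neg h).symm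

/-- No `n`-simplex lies in `∂K`, so passing to relative chains loses none of the cofaces. -/
theorem constBoundary_top (hn : 1 ≤ n) {K : SComplex n} (V : Simplex n → Fin n → ZMod 2)
    (τ : {τ // τ ∈ cells K (bd K) (n - 1)}) :
    constBoundary (K := K) (L := bd K) n (n - 1) (fun σ => V σ.1) τ =
      ∑ σ ∈ topCofaces K τ.1, V σ := by
  have hn' : n = n - 1 + 1 := by omega
  unfold constBoundary
  rw [Finset.sum_coe_sort (cells K (bd K) n)
    (fun σ => if τ.1 ⊆ σ ∧ n = n - 1 + 1 then V σ else 0), ← Finset.sum_filter]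
  refine Finset.sum_congr ?_ fun _ _ => rfl
  ext σ
  simp only [Finset.mem_filter, cells, topCofaces]
  constructor
  · rintro ⟨⟨h1, -, h3⟩, h4, -⟩
    exact ⟨h1, h4, h3⟩
  · rintro ⟨h1, h2, h3⟩
    refine ⟨⟨h1, fun h4 => ?_, h3⟩, h2, hn'⟩
    obtain ⟨-, κ, -, h5, h6, -⟩ := Finset.mem_filter.1 h4
    have := Finset.card_le_card h5
    omega

/-- The monochromatic quadrants form an explicit lift of `Dε` to `𝔱(𝔽₂)`; the connecting morphism is
computed with this lift. -/
theorem firstDerivative_eq {K : SComplex n} (hK : ∀ σ ∈ K, σ.card = n + 1 → IsUnimodular σ)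
    (ε : (Fin n → ℤ) → ZMod 2) : firstDerivative K ε =
      cotangentProj (K := K) (L := bd K) (k := n) fun σ => monoQuadrant ε σ.1 := by
  funext σ
  obtain ⟨h1, -, h3⟩ := Finset.mem_filter.1 σ.2
  have hinj : Function.Injective (zOne σ.1) :=
    LinearMap.ker_eq_bot.1 (Submodule.ker_liftQ_eq_bot _ _ _ le_rfl)
  change Function.invFun (zOne σ.1) _ = (normal σ.1).mkQ (monoQuadrant ε σ.1)
  have : (fun a b : {x // x ∈ σ.1} => ε b.1 - ε a.1) =
      zOne σ.1 ((normal σ.1).mkQ (monoQuadrant ε σ.1)) := by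
    funext a b
    exact ((hK σ.1 h1 h3).monoQuadrant_spec ε a.2 b.2).symm
  rw [this]
  exact Function.leftInverse_invFun hinj _

/-- A sign distribution isolating every interior vertex solves the equation `D²ε = ρ`. -/
theorem solvesHarnackEquation_of_isolated (hn : 2 ≤ n) {K : SComplex n}
    (hK : ∀ σ ∈ K, σ.card = n + 1 → IsUnimodular σ)
    (hdown : ∀ σ ∈ K, ∀ τ ⊆ σ, τ.Nonempty → τ ∈ K)
    (hpure : ∀ σ ∈ K, ∃ τ ∈ K, σ ⊆ τ ∧ τ.card = n + 1)
    (htwo : ∀ τ ∈ K, τ.card = n → (topCofaces K τ).card ≤ 2)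
    {ε : (Fin n → ℤ) → ZMod 2}
    (hε : ∀ τ ∈ K, ∀ α ∈ τ, ¬ IsVertexOf (bd K) α → ∃ v, Isolated K ε α v) :
    RhoUniform K ∧ SolvesHarnackEquation K ε := by
  have hn1 : 1 ≤ n := by omega
  constructor
  · intro τ hτ α β hα hβ
    obtain ⟨v, hv⟩ := hε τ hτ.1 α hα.1 hα.2.1
    obtain ⟨u, hu⟩ := hε τ hτ.1 β hβ.1 hβ.2.1
    rw [rho_eq hK hv hn1 hα.1 hτ.2.2, rho_eq hK hu hn1 hβ.1 hτ.2.2]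
  let b : {σ // σ ∈ cells K (bd K) n} → Fin n → ZMod 2 := fun σ => monoQuadrant ε σ.1
  -- A facet outside `∂K` has at least one coface, at most two, and not exactly one.
  have hcard : ∀ τ : {τ // τ ∈ cells K (bd K) (n - 1)}, (topCofaces K τ.1).card = 2 := by
    intro τ
    obtain ⟨h1, h2, h3⟩ := Finset.mem_filter.1 τ.2
    have hc : τ.1.card = n := by omega
    have h4 := htwo τ.1 h1 hc
    obtain ⟨σ, h5, h6, h7⟩ := hpure τ.1 h1
    have h8 : 0 < (topCofaces K τ.1).card :=
      Finset.card_pos.2 ⟨σ, Finset.mem_filter.2 ⟨h5, h6, h7⟩⟩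
    have h9 : (topCofaces K τ.1).card ≠ 1 := fun h9 =>
      h2 (Finset.mem_filter.2 ⟨h1, τ.1, h1, subset_rfl, hc, h9⟩)
    omega
  have hbτ : ∀ τ, constBoundary n (n - 1) b τ =
      ∑ σ ∈ topCofaces K τ.1, monoQuadrant ε σ := fun τ =>
    constBoundary_top hn1 (monoQuadrant ε) τ
  -- On an edge of `τ` both monochromatic quadrants take the same value `ε y - ε x`, so their sum is
  -- normal to `τ`.
  have hbn : ∀ τ, constBoundary n (n - 1) b τ ∈ normal τ.1 := by
    intro τ
    rw [hbτ, mem_normal]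
    intro x hx y hy
    rw [map_sum, Finset.sum_congr rfl (g := fun _ => ε y - ε x) fun σ hσ => by
      obtain ⟨h1, h2, h3⟩ := Finset.mem_filter.1 hσ
      exact (hK σ h1 h3).monoQuadrant_spec ε (h2 hx) (h2 hy)]
    rw [Finset.sum_const, hcard τ, two_nsmul, ZModModule.add_self]
  let a : Chains (normalCosheaf n) K (bd K) (n - 1) := fun τ => ⟨_, hbn τ⟩
  have hab : normalIncl a = constBoundary n (n - 1) b := rfl
  have hac : a ∈ cycles (normalCosheaf n) K (bd K) (n - 1) := by
    rw [LinearMap.mem_ker]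
    funext τ
    refine Subtype.ext ((subtype_boundary_normalCosheaf _ _ a τ).trans ?_)
    rw [hab]
    exact constBoundary_constBoundary hdown (bd_faceClosed K) _ _ _ b τ
  have hD : firstDerivative K ε ∈ cycles (cotangentCosheaf n) K (bd K) n := by
    rw [LinearMap.mem_ker, firstDerivative_eq hK]
    funext τ
    exact (boundary_cotangentProj n (n - 1) b τ).trans
      ((Submodule.Quotient.mk_eq_zero _).2 (hbn τ))
  have hr : chainQuot (normalCosheaf n) K (bd_subset_bdZero K) (n - 1) a ∈
      cycles (normalCosheaf n) K (bdZero K) (n - 1) := by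
    rw [LinearMap.mem_ker, boundary_chainQuot _ _ _ (bdZero_faceClosed K), LinearMap.mem_ker.1 hac,
      map_zero]
  -- `ρ` and the chosen representative of `D²ε` agree as chains, at every vertex off `∂K`; no
  -- homology between them is needed.
  have hρ : ∀ τ : {τ // τ ∈ cells K (bdZero K) (n - 1)}, ∀ α ∈ τ.1, ¬ IsVertexOf (bd K) α →
      (normal τ.1).subtype (chainQuot (normalCosheaf n) K (bd_subset_bdZero K) (n - 1) a τ) =
        rho K τ.1 α := by
    intro τ α hα hαb
    obtain ⟨h1, -⟩ := Finset.mem_filter.1 τ.2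
    obtain ⟨v, hv⟩ := hε τ.1 h1 α hα hαb
    have hτ := cells_anti K (bd_subset_bdZero K) _ τ.2
    rw [rho_eq hK hv hn1 hα (hcard ⟨τ.1, hτ⟩)]
    exact hbτ ⟨τ.1, hτ⟩
  refine ⟨hD, homologyClass ⟨a, hac⟩, ⟨_, hr⟩, ⟨⟨_, hD⟩, b, ⟨a, hac⟩, rfl, ?_,
    (boundary_constCosheaf K (bd K) n (n - 1) b).trans hab.symm, rfl⟩, ?_, ?_⟩
  · exact (firstDerivative_eq hK ε).symm
  · intro τ
    exact ⟨fun _ α hα => hρ τ α hα.1 hα.2.1, fun _ α hα hαb => hρ τ α hα hαb⟩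
  · rfl

end ModTwo

/-! ### The Harnack distribution isolates the interior vertices -/

section Harnack

/-- Reduction modulo `2`. -/
def modTwo {N : ℕ} (x : Fin N → ℤ) : Fin N → ZMod 2 := fun i => (x i : ZMod 2)

theorem eq_single_of_support {N : ℕ} {y : Fin N → ℤ} {c : Fin N} (h : ∀ j, y j ≠ 0 → j = c) :
    y = Pi.single c (∑ j, y j) := by
  have h0 : ∀ j, j ≠ c → y j = 0 := fun j hj => by
    by_contra h1
    exact hj (h j h1)
  funext j
  by_cases hj : j = c
  · subst hj
    rw [Pi.single_eq_same, Finset.sum_eq_single j (fun i _ hi => h0 i hi) (by simp)]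
  · rw [Pi.single_eq_of_ne hj, h0 j hj]

/-- The neighbours of a point with nonzero coordinates which lie in another layer have the same
parities. -/
theorem modTwo_eq_of_last_ne {N : ℕ} {x y : Fin (N + 2) → ℤ} (hx : ∀ i, x i ≠ 0)
    (hs : ∑ i, y i = ∑ i, x i) (hc : Compat y x) (hne : y (Fin.last _) ≠ x (Fin.last _)) :
    modTwo y = Fin.snoc (α := fun _ => ZMod 2)
      (Pi.single (if Even (∑ i, lower x i) then Fin.last N else 0)
      ((∑ i, lower x i : ℤ) + 1 : ZMod 2)) (x (Fin.last _) + 1 : ZMod 2) := by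
  set s := ∑ i, lower x i with hs'
  set c := (if Even s then Fin.last N else 0) with hcc
  have hsx := sum_lower x
  have hsy := sum_lower y
  have hlx : ∀ i, lower x i ≠ 0 := fun i => hx _
  -- All indices are used by `x`, so the order condition leaves only an extreme index for `y`. Going
  -- from a neighbour above to a neighbour below exchanges the roles of the two points and also
  -- flips the parity of the size of the upper one, so the extreme index is the same.
  have key : (∀ j, lower y j ≠ 0 → j = c) ∧ ((∑ j, lower y j : ℤ) : ZMod 2) = (s : ZMod 2) + 1 ∧
      (y (Fin.last _) : ZMod 2) = x (Fin.last _) + 1 := by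
    rcases hc.last_cases with h | h | h
    · exact absurd h hne
    · have hl := hc.layer_of_eq h
      have hsy' : ∑ j, lower y j = s - 1 := by linarith
      refine ⟨fun j hj => ?_, ?_, ?_⟩
      · by_cases he : Even s
        · have ho : ¬ Even (∑ j, lower y j) := by rw [hsy']; simpa [parity_simps] using he
          rw [hcc, if_pos he]
          exact le_antisymm (Fin.le_last _) (hl.2 ho j _ hj (hlx _))
        · have ho : Even (∑ j, lower y j) := by
            rw [hsy']; exact Int.even_sub_one.2 he
          rw [hcc, if_neg he]
          exact le_antisymm (hl.1 ho j _ hj (hlx 0)) (Fin.zero_le _)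
      · rw [hsy']
        push_cast
        rw [sub_eq_add_neg, ZModModule.neg_eq_self]
      · rw [h]; push_cast; rfl
    · have hl := hc.symm.layer_of_eq h
      refine ⟨fun j hj => ?_, ?_, ?_⟩
      · by_cases he : Even s
        · rw [hcc, if_pos he]
          exact le_antisymm (Fin.le_last _) (hl.1 he _ j (hlx _) hj)
        · rw [hcc, if_neg he]
          exact le_antisymm (hl.2 he 0 j (hlx _) hj) (Fin.zero_le _)
      · rw [show ∑ j, lower y j = s + 1 by linarith]
        push_cast; rfl
      · rw [h]; push_cast
        rw [add_assoc, CharTwo.add_self_eq_zero, add_zero]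
  obtain ⟨k1, k2, k3⟩ := key
  have k4 := eq_single_of_support k1
  funext i
  refine Fin.lastCases ?_ (fun j => ?_) i
  · rw [Fin.snoc_last]; exact k3
  · rw [Fin.snoc_castSucc]
    change ((lower y j : ℤ) : ZMod 2) = _
    rw [k4]
    by_cases hj : j = c
    · rw [hj, Pi.single_eq_same, Pi.single_eq_same, k2]
    · rw [Pi.single_eq_of_ne hj, Pi.single_eq_of_ne hj, Int.cast_zero]

/-- Any function of the parities becomes isolating at a point with positive coordinates, after the
addition of a linear form. -/
theorem exists_isolating : ∀ {N : ℕ} (x : Fin N → ℤ), (∀ i, x i ≠ 0) →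
    ∀ ε : (Fin N → ZMod 2) → ZMod 2, ∃ v : Fin N → ZMod 2, ∀ y : Fin N → ℤ,
      ∑ i, y i = ∑ i, x i → Compat y x → y ≠ x →
      ∑ i, v i * (modTwo y i + modTwo x i) = 1 + ε (modTwo y) + ε (modTwo x)
  | 0, x, _, _ => ⟨0, fun y _ _ hne => absurd (Subsingleton.elim y x) hne⟩
  | N + 1, x, hx, ε => by
    -- Within the layer of `x` the last parity is fixed and the recursion applies to the
    -- truncations.
    obtain ⟨v', hv'⟩ := exists_isolating (lower x) (fun i => hx _)
      fun y => ε (Fin.snoc (α := fun _ => ZMod 2) y (x (Fin.last N) : ZMod 2))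
    have hsn : ∀ y : Fin (N + 1) → ℤ, Fin.snoc (α := fun _ => ZMod 2) (modTwo (lower y))
        (y (Fin.last N) : ZMod 2) = modTwo y := by
      intro y
      funext i
      refine Fin.lastCases ?_ (fun j => ?_) i
      · rw [Fin.snoc_last]; rfl
      · rw [Fin.snoc_castSucc]; rfl
    let f : (Fin (N + 1) → ZMod 2) → ZMod 2 := fun Y =>
      1 + ε Y + ε (modTwo x) + ∑ i : Fin N, v' i * (Y i.castSucc + modTwo x i.castSucc)
    -- `f` is the correction still needed at a neighbour. Outside the layer it takes a single value,
    -- and there the last parity differs from that of `x`, so `c` as last coefficient supplies it.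
    obtain ⟨c, hc⟩ : ∃ c : ZMod 2, ∀ y : Fin (N + 1) → ℤ,
        ∑ i, y i = ∑ i, x i → Compat y x → y (Fin.last N) ≠ x (Fin.last N) →
        f (modTwo y) = c ∧ (y (Fin.last N) : ZMod 2) = x (Fin.last N) + 1 := by
      cases N with
      | zero =>
        refine ⟨0, fun y hs _ hne => absurd ?_ hne⟩
        simpa using hs
      | succ N =>
        refine ⟨_, fun y hs hcy hne => ⟨congrArg f (modTwo_eq_of_last_ne hx hs hcy hne), ?_⟩⟩
        have := congrFun (modTwo_eq_of_last_ne hx hs hcy hne) (Fin.last _)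
        rwa [Fin.snoc_last] at this
    refine ⟨Fin.snoc (α := fun _ => ZMod 2) v' c, fun y hs hcy hne => ?_⟩
    rw [Fin.sum_univ_castSucc]
    simp only [Fin.snoc_castSucc, Fin.snoc_last]
    by_cases hl : y (Fin.last N) = x (Fin.last N)
    · have h1 := hv' (lower y) (by rw [sum_lower, sum_lower, hs, hl]) (hcy.lower_of_eq hl)
        fun h => hne (lower_injective hl h)
      rw [← hl, hsn, hl, hsn] at h1
      have h2 : modTwo y (Fin.last N) = modTwo x (Fin.last N) := by simp only [modTwo, hl]
      rw [h2, CharTwo.add_self_eq_zero, mul_zero, add_zero]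
      exact h1
    · obtain ⟨h1, h2⟩ := hc y hs hcy hl
      have h3 : modTwo y (Fin.last N) + modTwo x (Fin.last N) = 1 := by
        simp only [modTwo, h2]
        have dec : ∀ a : ZMod 2, a + 1 + a = 1 := by decide
        exact dec _
      rw [h3, mul_one, ← h1]
      have dec : ∀ a b : ZMod 2, a + (b + a) = b := by decide
      exact dec _ _

/-- The Harnack distribution isolates the lattice points in the interior of the simplex. -/
theorem exists_isolated_harnack {n d : ℕ} (hn : 1 ≤ n) (hd : 1 ≤ d) {α : Fin n → ℤ}
    (hα : ∀ k, homCoord d α k ≠ 0) : ∃ v, Isolated (itenbergViro n d) (harnack n) α v := by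
  let E : (Fin (n + 1) → ZMod 2) → ZMod 2 := fun z =>
    ∑ j : Fin n, ∑ i ∈ Finset.Iio j, z i.succ * z j.succ
  have hE : ∀ y, harnack n y = E (modTwo (homCoord d y)) := fun y => rfl
  obtain ⟨V, hV⟩ := exists_isolating (homCoord d α) hα E
  -- Modulo `2` the coordinate `x₀` is `d` plus the sum of the others, so its coefficient `V 0` is
  -- added to every other one.
  refine ⟨fun i => V i.succ + V 0, fun σ hσ hασ y hy hne => ?_⟩
  obtain ⟨-, -, hcomp⟩ := (mem_itenbergViro n d hn hd σ).1 hσ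
  have h1 := hV (homCoord d y) (by rw [sum_homCoord, sum_homCoord]) (hcomp y hy α hασ)
    fun h => hne (homCoord_injective d h)
  rw [← hE, ← hE, Fin.sum_univ_succ] at h1
  have h2 : ∀ z : Fin n → ℤ, modTwo (homCoord d z) 0 = (d : ZMod 2) + ∑ i, (z i : ZMod 2) := by
    intro z
    simp only [modTwo, homCoord_zero]
    push_cast
    rw [sub_eq_add_neg, ZModModule.neg_eq_self]
  have h3 : pairing (y - α) (fun i => V i.succ + V 0) =
      ∑ i : Fin n, V i.succ * (modTwo (homCoord d y) i.succ + modTwo (homCoord d α) i.succ) +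
        V 0 * (∑ i, (y i : ZMod 2) + ∑ i, (α i : ZMod 2)) := by
    rw [pairing_apply, ← Finset.sum_add_distrib, Finset.mul_sum, ← Finset.sum_add_distrib]
    refine Finset.sum_congr rfl fun i _ => ?_
    simp only [modTwo, homCoord_succ, Pi.sub_apply]
    push_cast
    rw [sub_eq_add_neg, ZModModule.neg_eq_self]
    ring
  rw [h3]
  rw [h2, h2] at h1
  have dec : ∀ a b S v0 D A B : ZMod 2, v0 * (D + B + (D + A)) + S = 1 + b + a →
    a + b + (S + v0 * (B + A)) = 1 := by decide
  exact dec _ _ _ _ _ _ _ h1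

theorem exists_isolated_of_not_isVertexOf_bd {n d : ℕ} (hn : 1 ≤ n) (hd : 1 ≤ d) {σ : Simplex n}
    (hσ : σ ∈ itenbergViro n d) {α : Fin n → ℤ} (hα : α ∈ σ)
    (hb : ¬ IsVertexOf (bd (itenbergViro n d)) α) :
    ∃ v, Isolated (itenbergViro n d) (harnack n) α v :=
  exists_isolated_harnack hn hd fun _ hk =>
    hb ((itenbergViro_isTri hn hd).isVertexOf_bd hd hσ hα hk)

theorem itenbergViro_solvesHarnackEquation {n d : ℕ} (hn : 2 ≤ n) (hd : 1 ≤ d) :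
    RhoUniform (itenbergViro n d) ∧ SolvesHarnackEquation (itenbergViro n d) (harnack n) := by
  have hn1 : 1 ≤ n := by omega
  have hT := itenbergViro_isTri hn1 hd
  refine solvesHarnackEquation_of_isolated hn
    (fun σ hσ hc => ⟨hc, fun a _ => itenbergViro_primitive hn1 hd hσ hc a⟩)
    hT.down_closed (fun σ hσ => hT.pure hd hσ)
    (fun τ hτ hc => hT.card_topCofaces_le_two hd (hT.nonempty τ hτ) hc)
    fun τ hτ α hα hb => exists_isolated_of_not_isVertexOf_bd hn1 hd hτ hα hb

end Harnack

/-! ### Connectivity and simple connectivity of the compatibility graph -/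

section Graph

/-- The lattice points of the standard simplex of size `d`, in homogeneous coordinates. -/
def IsPoint {N : ℕ} (d : ℕ) (a : Fin N → ℤ) : Prop := (∀ i, 0 ≤ a i) ∧ ∑ i, a i = d

theorem isPoint_single {N : ℕ} (d : ℕ) (c : Fin N) : IsPoint d (Pi.single c (d : ℤ)) := by
  refine ⟨fun i => ?_, by simp⟩
  by_cases h : i = c
  · subst h; simp
  · rw [Pi.single_eq_of_ne h]

theorem lower_snoc {R : Type*} {N : ℕ} (y : Fin N → R) (t : R) :
    lower (Fin.snoc (α := fun _ => R) y t : Fin (N + 1) → R) = y := by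
  funext i
  simp [lower]

theorem snoc_lower {R : Type*} {N : ℕ} (y : Fin (N + 1) → R) :
    (Fin.snoc (α := fun _ => R) (lower y) (y (Fin.last N)) : Fin (N + 1) → R) = y := by
  refine lower_injective ?_ (lower_snoc _ _)
  rw [Fin.snoc_last]

theorem isPoint_snoc {N d : ℕ} {y : Fin N → ℤ} {t e : ℕ} (hy : IsPoint e y) (h : e + t = d) :
    IsPoint d (Fin.snoc (α := fun _ => ℤ) y (t : ℤ) : Fin (N + 1) → ℤ) := by
  refine ⟨forall_fin_last.2 ⟨fun i => ?_, ?_⟩, ?_⟩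
  · rw [Fin.snoc_castSucc]; exact hy.1 i
  · rw [Fin.snoc_last]; positivity
  · rw [Fin.sum_univ_castSucc]
    simp only [Fin.snoc_castSucc, Fin.snoc_last, hy.2, ← h]
    push_cast; rfl

theorem IsPoint.lower {N d e : ℕ} {y : Fin (N + 1) → ℤ} (hy : IsPoint d y)
    (h : (e : ℤ) + y (Fin.last N) = d) : IsPoint e (THyp.lower y) := by
  refine ⟨fun i => hy.1 _, ?_⟩
  rw [sum_lower, hy.2]
  linarith

theorem compat_snoc {N : ℕ} {y z : Fin N → ℤ} {t : ℤ} (h : Compat y z) :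
    Compat (Fin.snoc (α := fun _ => ℤ) y t : Fin (N + 1) → ℤ) (Fin.snoc (α := fun _ => ℤ) z t) := by
  refine Or.inl ⟨?_, ?_⟩
  · rw [Fin.snoc_last, Fin.snoc_last]
  · rwa [lower_snoc, lower_snoc]

theorem compat_snoc_succ {N : ℕ} {y z : Fin N → ℤ} {s t : ℤ} (h : LayerCompat y z)
    (hst : s = t + 1) :
    Compat (Fin.snoc (α := fun _ => ℤ) y s : Fin (N + 1) → ℤ) (Fin.snoc (α := fun _ => ℤ) z t) := by
  refine Or.inr (Or.inl ⟨?_, ?_⟩)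
  · rw [Fin.snoc_last, Fin.snoc_last, hst]
  · rwa [lower_snoc, lower_snoc]

/-- In the layer above a nonzero point there is a multiple of a unit vector, in the face spanned
by this point, compatible with it. -/
theorem exists_layerCompat_single {N : ℕ} {y : Fin N → ℤ} (hy : y ≠ 0) (e : ℕ) :
    ∃ c, y c ≠ 0 ∧ LayerCompat (Pi.single c (e : ℤ)) y := by
  classical
  set s := Finset.univ.filter fun i => y i ≠ 0 with hs
  have hne : s.Nonempty := by
    obtain ⟨i, hi⟩ := Function.ne_iff.1 hy
    exact ⟨i, Finset.mem_filter.2 ⟨Finset.mem_univ _, hi⟩⟩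
  have hsupp : ∀ c i : Fin N, (Pi.single c (e : ℤ) : Fin N → ℤ) i ≠ 0 → i = c := by
    intro c i h
    by_contra hic
    exact h (Pi.single_eq_of_ne hic _)
  have hms : ∀ j, y j ≠ 0 → j ∈ s := fun j hj => Finset.mem_filter.2 ⟨Finset.mem_univ _, hj⟩
  by_cases he : Even (e : ℤ)
  · refine ⟨s.min' hne, (Finset.mem_filter.1 (s.min'_mem hne)).2, fun _ i j hi hj => ?_, fun h => ?_⟩
    · rw [hsupp _ i hi]; exact s.min'_le j (hms j hj)
    · simp [he] at h
  · refine ⟨s.max' hne, (Finset.mem_filter.1 (s.max'_mem hne)).2, fun h => ?_, fun _ i j hi hj => ?_⟩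
    · exact absurd (by simpa using h) he
    · rw [hsupp _ i hi]; exact s.le_max' j (hms j hj)

/-- The faces of the standard simplex have connected compatibility graphs. -/
theorem face_connected {α : Type*} (d : ℕ) : ∀ {N : ℕ} (J : Finset (Fin N)) (φ : (Fin N → ℤ) → α),
    (∀ a b, IsPoint d a → IsPoint d b → (∀ j ∉ J, a j = 0) → (∀ j ∉ J, b j = 0) → Compat a b →
      φ a = φ b) →
    ∀ a b, IsPoint d a → IsPoint d b → (∀ j ∉ J, a j = 0) → (∀ j ∉ J, b j = 0) → φ a = φ b
  | 0, _, φ, _, a, b, _, _, _, _ => congrArg φ (Subsingleton.elim a b)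
  | N + 1, J, φ, hφ, a, b, ha, hb, haJ, hbJ => by
    by_cases hJ : Fin.last N ∈ J
    -- If the face contains the last vertex, a point can climb one layer at a time, through a
    -- multiple of a unit vector in its own support, until it reaches that vertex.
    · have key : ∀ (s : ℕ) (a : Fin (N + 1) → ℤ), IsPoint d a → (∀ j ∉ J, a j = 0) →
          ∑ i, lower a i = s → φ a = φ (Pi.single (Fin.last N) (d : ℤ)) := by
        intro s
        induction s with
        | zero =>
          intro a ha _ hs
          have h0 : lower a = 0 := eq_zero_of_sum_nonpos (fun i => ha.1 _) (by rw [hs]; simp)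
          have hl := sum_lower a
          rw [hs, ha.2] at hl
          congr 1
          refine lower_injective ?_ ?_
          · rw [Pi.single_eq_same]; push_cast at hl; linarith
          · rw [h0]; funext i; simp [lower]
        | succ s ih =>
          intro a ha haJ hs
          have hl := sum_lower a
          rw [hs, ha.2] at hl
          have hne : lower a ≠ 0 := by
            intro h0
            rw [h0] at hs
            simp only [Pi.zero_apply, Finset.sum_const_zero] at hs
            push_cast at hs
            omega
          obtain ⟨c, hc, hcomp⟩ := exists_layerCompat_single hne s
          have hk := ha.1 (Fin.last N)
          obtain ⟨k, hk'⟩ := Int.eq_ofNat_of_zero_le hk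
          set b : Fin (N + 1) → ℤ := Fin.snoc (α := fun _ => ℤ) (Pi.single c (s : ℤ))
            ((k + 1 : ℕ) : ℤ) with hb
          have hbp : IsPoint d b := isPoint_snoc (isPoint_single s c) (by
            push_cast at hl; omega)
          have hcJ : c.castSucc ∈ J := by
            by_contra h
            exact hc (haJ _ h)
          have hbJ : ∀ j ∉ J, b j = 0 := by
            intro j hj
            induction j using Fin.lastCases with
            | last => exact absurd hJ hj
            | cast j =>
              rw [hb, Fin.snoc_castSucc, Pi.single_eq_of_ne]
              rintro rfl
              exact hj hcJ
          have hab : Compat b a := by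
            rw [← snoc_lower a]
            exact compat_snoc_succ hcomp (by rw [hk']; push_cast; rfl)
          rw [hφ a b ha hbp haJ hbJ hab.symm]
          refine ih b hbp hbJ ?_
          rw [hb, lower_snoc]
          simp
      obtain ⟨s, hs⟩ := Int.eq_ofNat_of_zero_le
        (Finset.sum_nonneg fun i (_ : i ∈ Finset.univ) => (ha.1 (Fin.castSucc i)))
      obtain ⟨t, ht⟩ := Int.eq_ofNat_of_zero_le
        (Finset.sum_nonneg fun i (_ : i ∈ Finset.univ) => (hb.1 (Fin.castSucc i)))
      rw [key s a ha haJ hs, key t b hb hbJ ht]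
    · have hz : ∀ a : Fin (N + 1) → ℤ, (∀ j ∉ J, a j = 0) →
          (Fin.snoc (α := fun _ => ℤ) (lower a) ((0 : ℕ) : ℤ) : Fin (N + 1) → ℤ) = a := by
        intro a haJ
        have := snoc_lower a
        rw [haJ _ hJ] at this
        simpa using this
      have hlow : ∀ a : Fin (N + 1) → ℤ, IsPoint d a → (∀ j ∉ J, a j = 0) →
          IsPoint d (lower a) := fun a ha haJ => ha.lower (by rw [haJ _ hJ, add_zero])
      have hup : ∀ a : Fin N → ℤ, IsPoint d a → IsPoint d
          (Fin.snoc (α := fun _ => ℤ) a ((0 : ℕ) : ℤ) : Fin (N + 1) → ℤ) :=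
        fun a ha => isPoint_snoc ha (by simp)
      have hupJ : ∀ a : Fin N → ℤ, (∀ j ∉ Finset.univ.filter fun j => j.castSucc ∈ J, a j = 0) →
          ∀ j ∉ J, (Fin.snoc (α := fun _ => ℤ) a ((0 : ℕ) : ℤ) : Fin (N + 1) → ℤ) j = 0 := by
        intro a ha j hj
        induction j using Fin.lastCases with
        | last => rw [Fin.snoc_last]; rfl
        | cast j => rw [Fin.snoc_castSucc]; exact ha j (by simpa using hj)
      have := face_connected d (Finset.univ.filter fun j : Fin N => j.castSucc ∈ J)
        (fun y => φ (Fin.snoc (α := fun _ => ℤ) y ((0 : ℕ) : ℤ)))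
        (fun a b ha hb haJ hbJ hab => hφ _ _ (hup a ha) (hup b hb) (hupJ a haJ) (hupJ b hbJ)
          (compat_snoc hab))
        (lower a) (lower b) (hlow a ha haJ) (hlow b hb hbJ)
        (fun j hj => haJ _ (by simpa using hj)) (fun j hj => hbJ _ (by simpa using hj))
      simpa only [hz a haJ, hz b hbJ] using this

/-- A `1`-cocycle modulo `2` on the clique complex of the compatibility graph is a coboundary. -/
theorem exists_primitive : ∀ (N d : ℕ) (q : (Fin N → ℤ) → (Fin N → ℤ) → ZMod 2),
    (∀ a b c, IsPoint d a → IsPoint d b → IsPoint d c → Compat a b → Compat b c → Compat a c →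
      q a b + q b c = q a c) →
    ∃ g : (Fin N → ℤ) → ZMod 2, ∀ a b, IsPoint d a → IsPoint d b → Compat a b →
      q a b = g a + g b := by
  have dec0 : ∀ a b : ZMod 2, a + b = b → a = 0 := by decide
  have dec1 : ∀ a b : ZMod 2, a + b = 0 → a = b := by decide
  have hself : ∀ {N d : ℕ} {q : (Fin N → ℤ) → (Fin N → ℤ) → ZMod 2},
      (∀ a b c, IsPoint d a → IsPoint d b → IsPoint d c → Compat a b → Compat b c → Compat a c →
        q a b + q b c = q a c) → ∀ a, IsPoint d a → q a a = 0 := fun h a ha =>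
    dec0 _ _ (h a a a ha ha ha (Compat.refl a) (Compat.refl a) (Compat.refl a))
  intro N
  induction N with
  | zero =>
    intro d q hq
    refine ⟨0, fun a b ha _ _ => ?_⟩
    obtain rfl : a = b := Subsingleton.elim a b
    simp [hself hq a ha]
  | succ N ihN =>
    intro d
    induction d with
    | zero =>
      intro q hq
      refine ⟨0, fun a b ha hb _ => ?_⟩
      have ha0 := eq_zero_of_sum_nonpos ha.1 ha.2.le
      have hb0 := eq_zero_of_sum_nonpos hb.1 hb.2.le
      rw [hb0, ← ha0]
      simp [hself hq a ha]
    | succ d ihd =>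
      intro q hq
      -- the upper layers
      let up : (Fin (N + 1) → ℤ) → Fin (N + 1) → ℤ := fun a =>
        Fin.snoc (α := fun _ => ℤ) (lower a) (a (Fin.last N) + 1)
      let down : (Fin (N + 1) → ℤ) → Fin (N + 1) → ℤ := fun a =>
        Fin.snoc (α := fun _ => ℤ) (lower a) (a (Fin.last N) - 1)
      have hupl : ∀ a, lower (up a) = lower a := fun a => lower_snoc _ _
      have hupt : ∀ a, up a (Fin.last N) = a (Fin.last N) + 1 := fun a => Fin.snoc_last _ _
      have hdownl : ∀ a, lower (down a) = lower a := fun a => lower_snoc _ _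
      have hdownt : ∀ a, down a (Fin.last N) = a (Fin.last N) - 1 := fun a => Fin.snoc_last _ _
      have hud : ∀ a, up (down a) = a := fun a => lower_injective
        (by rw [hupt, hdownt, sub_add_cancel]) (by rw [hupl, hdownl])
      have hupp : ∀ a, IsPoint d a → IsPoint (d + 1) (up a) := by
        intro a ha
        refine ⟨forall_fin_last.2 ⟨fun i => ?_, ?_⟩, ?_⟩
        · change 0 ≤ lower (up a) i; rw [hupl]; exact ha.1 _
        · rw [hupt]; have := ha.1 (Fin.last N); omega
        · have h1 := sum_lower a
          have h2 := sum_lower (up a)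
          rw [hupl, hupt] at h2
          rw [ha.2] at h1
          push_cast; linarith
      have hdownp : ∀ a, IsPoint (d + 1) a → 1 ≤ a (Fin.last N) → IsPoint d (down a) := by
        intro a ha ha1
        refine ⟨forall_fin_last.2 ⟨fun i => ?_, ?_⟩, ?_⟩
        · change 0 ≤ lower (down a) i; rw [hdownl]; exact ha.1 _
        · rw [hdownt]; omega
        · have h1 := sum_lower a
          have h2 := sum_lower (down a)
          rw [hdownl, hdownt] at h2
          rw [ha.2] at h1
          push_cast at h1; linarith
      have hupc : ∀ a b, Compat a b → Compat (up a) (up b) := by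
        intro a b hab
        simp only [Compat, hupl, hupt, add_left_inj] at hab ⊢
        exact hab
      have hdownc : ∀ a b, Compat a b → Compat (down a) (down b) := by
        intro a b hab
        have e : ∀ p r : ℤ, p - 1 = r - 1 + 1 ↔ p = r + 1 := fun p r => by omega
        simp only [Compat, hdownl, hdownt, sub_left_inj, e] at hab ⊢
        exact hab
      -- Lowering the last coordinate identifies the points off the bottom hyperplane with the
      -- points of size `d`, compatibility included, so they are covered by the induction on the
      -- size.
      obtain ⟨g1, hg1⟩ := ihd (fun a b => q (up a) (up b)) fun a b c ha hb hc hab hbc hac =>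
        hq _ _ _ (hupp a ha) (hupp b hb) (hupp c hc) (hupc a b hab) (hupc b c hbc) (hupc a c hac)
      -- the bottom layer
      let incl : (Fin N → ℤ) → Fin (N + 1) → ℤ := fun y =>
        Fin.snoc (α := fun _ => ℤ) y ((0 : ℕ) : ℤ)
      have hinp : ∀ y, IsPoint (d + 1) y → IsPoint (d + 1) (incl y) := fun y hy =>
        isPoint_snoc hy (by simp)
      have hinc : ∀ y z, Compat y z → Compat (incl y) (incl z) := fun y z h => compat_snoc h
      obtain ⟨g0, hg0⟩ := ihN (d + 1) (fun y z => q (incl y) (incl z))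
        fun a b c ha hb hc hab hbc hac => hq _ _ _ (hinp a ha) (hinp b hb) (hinp c hc)
          (hinc a b hab) (hinc b c hbc) (hinc a c hac)
      -- mixed edges
      let top : (Fin N → ℤ) → Fin (N + 1) → ℤ := fun y =>
        Fin.snoc (α := fun _ => ℤ) y ((1 : ℕ) : ℤ)
      have htopp : ∀ y, IsPoint d y → IsPoint (d + 1) (top y) := fun y hy =>
        isPoint_snoc hy rfl
      have htopc : ∀ y z, Compat y z → Compat (top y) (top z) := fun y z h => compat_snoc h
      have hmix : ∀ y z, LayerCompat y z → Compat (top y) (incl z) := fun y z h =>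
        compat_snoc_succ h (by simp)
      have hdt : ∀ y, IsPoint d y → IsPoint d (down (top y)) := fun y hy =>
        hdownp _ (htopp y hy) (by simp [top])
      -- `r` measures, on an edge between the bottom layer and the next, how far the two primitives
      -- are from gluing. The primitives glue, after adding a constant to one of them, once `r` is
      -- constant.
      let r : (Fin N → ℤ) → (Fin N → ℤ) → ZMod 2 := fun y z =>
        q (top y) (incl z) + g1 (down (top y)) + g0 z
      have hr1 : ∀ y y' z, IsPoint d y → IsPoint d y' → IsPoint (d + 1) z → Compat y y' →
          LayerCompat y z → LayerCompat y' z → r y z = r y' z := by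
        intro y y' z hy hy' hz hyy hyz hyz'
        have h1 := hq _ _ _ (htopp y hy) (htopp y' hy') (hinp z hz) (htopc _ _ hyy) (hmix _ _ hyz')
          (hmix _ _ hyz)
        have h2 := hg1 (down (top y)) (down (top y')) (hdt y hy) (hdt y' hy')
          (hdownc _ _ (htopc _ _ hyy))
        simp only [hud] at h2
        rw [h2] at h1
        have dec : ∀ A B C D E : ZMod 2, (A + B) + C = D → D + A + E = C + B + E := by decide
        exact dec _ _ _ _ _ h1
      have hr2 : ∀ y z z', IsPoint d y → IsPoint (d + 1) z → IsPoint (d + 1) z' → Compat z z' →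
          LayerCompat y z → LayerCompat y z' → r y z = r y z' := by
        intro y z z' hy hz hz' hzz hyz hyz'
        have h1 := hq _ _ _ (htopp y hy) (hinp z hz) (hinp z' hz') (hmix _ _ hyz) (hinc _ _ hzz)
          (hmix _ _ hyz')
        have h2 := hg0 z z' hz hz' hzz
        rw [h2] at h1
        have dec : ∀ A B C D E : ZMod 2, C + (A + B) = D → C + E + A = D + E + B := by decide
        exact dec _ _ _ _ _ h1
      obtain ⟨κ, hκ⟩ : ∃ κ : ZMod 2, ∀ y z, IsPoint d y → IsPoint (d + 1) z → LayerCompat y z →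
          r y z = κ := by
        rcases N with _ | M
        · refine ⟨0, fun y z _ hz _ => ?_⟩
          have := hz.2
          simp only [Finset.univ_eq_empty, Finset.sum_empty] at this
          push_cast at this
          omega
        classical
        -- For a fixed bottom point `z` the compatible points above it are all the lattice points of
        -- a face, so they are connected.
        have hcrit : ∀ y z : Fin (M + 1) → ℤ, IsPoint d y → (LayerCompat y z ↔
            ∀ i ∉ (Finset.univ.filter fun i => ∀ j, z j ≠ 0 →
              (Even (d : ℤ) → i ≤ j) ∧ (¬ Even (d : ℤ) → j ≤ i)), y i = 0) := by
          intro y z hy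
          rw [LayerCompat, hy.2]
          constructor
          · intro h i hi
            by_contra hyi
            exact hi (Finset.mem_filter.2 ⟨Finset.mem_univ _, fun j hj =>
              ⟨fun he => h.1 he i j hyi hj, fun he => h.2 he i j hyi hj⟩⟩)
          · intro h
            have h' : ∀ i j, y i ≠ 0 → z j ≠ 0 →
                (Even (d : ℤ) → i ≤ j) ∧ (¬ Even (d : ℤ) → j ≤ i) := by
              intro i j hyi hzj
              by_contra hc
              exact hyi (h i fun hi => hc ((Finset.mem_filter.1 hi).2 j hzj))
            exact ⟨fun he i j hyi hzj => (h' i j hyi hzj).1 he,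
              fun he i j hyi hzj => (h' i j hyi hzj).2 he⟩
        -- A corner of the upper layer that is compatible with the whole bottom layer. Any mixed
        -- edge is moved first to `y₀` with `z` fixed, then along the bottom layer to `z₀`.
        let y₀ : Fin (M + 1) → ℤ := Pi.single (if Even (d : ℤ) then 0 else Fin.last M) (d : ℤ)
        let z₀ : Fin (M + 1) → ℤ := Pi.single 0 ((d + 1 : ℕ) : ℤ)
        have hy₀ : IsPoint d y₀ := isPoint_single d _
        have hz₀ : IsPoint (d + 1) z₀ := isPoint_single _ _
        have hcone : ∀ z, LayerCompat y₀ z := by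
          intro z
          rw [hcrit y₀ z hy₀]
          intro i hi
          refine Pi.single_eq_of_ne ?_ _
          rintro rfl
          refine hi (Finset.mem_filter.2 ⟨Finset.mem_univ _, fun j _ => ⟨fun he => ?_, fun he => ?_⟩⟩)
          · rw [if_pos he]; exact Fin.zero_le _
          · rw [if_neg he]; exact Fin.le_last _
        refine ⟨r y₀ z₀, fun y z hy hz hyz => ?_⟩
        have e1 : r y z = r y₀ z := by
          refine face_connected d (Finset.univ.filter fun i => ∀ j, z j ≠ 0 →
              (Even (d : ℤ) → i ≤ j) ∧ (¬ Even (d : ℤ) → j ≤ i)) (fun y => r y z) ?_ y y₀ hy hy₀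
            ((hcrit y z hy).1 hyz) ((hcrit y₀ z hy₀).1 (hcone z))
          intro a b ha hb haJ hbJ hab
          exact hr1 a b z ha hb hz hab ((hcrit a z ha).2 haJ) ((hcrit b z hb).2 hbJ)
        rw [e1]
        exact face_connected (d + 1) Finset.univ (fun z => r y₀ z)
          (fun a b ha hb _ _ hab => hr2 y₀ a b hy₀ ha hb hab (hcone a) (hcone b)) z z₀ hz hz₀
          (by simp) (by simp)
      have htl : ∀ a : Fin (N + 1) → ℤ, a (Fin.last N) = 1 → top (lower a) = a := by
        intro a ha
        have := snoc_lower a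
        rw [ha] at this
        simpa [top] using this
      have hbl : ∀ a : Fin (N + 1) → ℤ, a (Fin.last N) = 0 → incl (lower a) = a := by
        intro a ha
        have := snoc_lower a
        rw [ha] at this
        simpa [incl] using this
      have hsymm : ∀ a b, IsPoint (d + 1) a → IsPoint (d + 1) b → Compat a b → q a b = q b a := by
        intro a b ha hb hab
        have := hq a b a ha hb ha hab hab.symm (Compat.refl a)
        rw [hself hq a ha] at this
        exact dec1 _ _ this
      let g : (Fin (N + 1) → ℤ) → ZMod 2 := fun a =>
        if a (Fin.last N) = 0 then g0 (lower a) + κ else g1 (down a)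
      have hmixed : ∀ a b, IsPoint (d + 1) a → IsPoint (d + 1) b → Compat a b →
          a (Fin.last N) ≠ 0 → b (Fin.last N) = 0 → q a b = g a + g b := by
        intro a b ha hb hab ha0 hb0
        have ha1 : a (Fin.last N) = 1 := by
          have := ha.1 (Fin.last N)
          rcases hab.last_cases with h | h | h <;> omega
        have hl := hab.layer_of_eq (by rw [ha1, hb0]; rfl)
        have := hκ (lower a) (lower b) (ha.lower (by rw [ha1]; push_cast; rfl))
          (hb.lower (by rw [hb0, add_zero])) hl
        simp only [r, htl a ha1, hbl b hb0] at this
        simp only [g, if_neg ha0, if_pos hb0]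
        have dec : ∀ A B C D : ZMod 2, A + B + C = D → A = B + (C + D) := by decide
        exact dec _ _ _ _ this
      refine ⟨g, fun a b ha hb hab => ?_⟩
      have ha' := ha.1 (Fin.last N)
      have hb' := hb.1 (Fin.last N)
      by_cases ha0 : a (Fin.last N) = 0 <;> by_cases hb0 : b (Fin.last N) = 0
      · have := hg0 (lower a) (lower b) (ha.lower (by rw [ha0, add_zero]))
          (hb.lower (by rw [hb0, add_zero])) (hab.lower_of_eq (by rw [ha0, hb0]))
        simp only [hbl a ha0, hbl b hb0] at this
        simp only [g, if_pos ha0, if_pos hb0, this]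
        have dec : ∀ A B C : ZMod 2, A + B = A + C + (B + C) := by decide
        exact dec _ _ _
      · rw [hsymm a b ha hb hab, hmixed b a hb ha hab.symm hb0 ha0, add_comm]
      · exact hmixed a b ha hb hab ha0 hb0
      · have := hg1 (down a) (down b) (hdownp a ha (by omega)) (hdownp b hb (by omega))
          (hdownc _ _ hab)
        simp only [hud] at this
        simp only [g, if_neg ha0, if_neg hb0, this]

end Graph

/-! ### Points of the T-hypersurface -/

section Peak

variable {n : ℕ}

/-- The vertices at which the barycentric coordinates of `p` are maximal. -/
noncomputable def peak (K : SComplex n) (p : Fin n → ℝ) : Simplex n :=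
  open scoped Classical in (supp K p).filter fun a => ∀ b, coord K p b ≤ coord K p a

theorem peak_subset (K : SComplex n) (p : Fin n → ℝ) : peak K p ⊆ supp K p :=
  open scoped Classical in Finset.filter_subset _ _

/-- A positive combination of the vertices of `τ` lies in the part of the barycentric subdivision
given by the flags ending with `τ` and starting with the vertices of maximal weight. -/
theorem exists_flag (M : Simplex n) (hM : M.Nonempty) : ∀ (m : ℕ) (τ : Simplex n)
    (w : (Fin n → ℤ) → ℝ), τ.card ≤ m → M ⊆ τ → (∀ a ∈ τ, 0 < w a) →
    (∀ a ∈ M, ∀ b ∈ τ, w b ≤ w a) → ∃ C : Set (Simplex n), IsChain (· ⊆ ·) C ∧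
      (∀ κ ∈ C, M ⊆ κ ∧ κ ⊆ τ) ∧
      (∑ a ∈ τ, w a)⁻¹ • ∑ a ∈ τ, w a • toReal a ∈ convexHull ℝ (barycentre '' C) := by
  classical
  intro m
  induction m with
  | zero =>
    intro τ w hm hMτ _ _
    obtain ⟨a, ha⟩ := hM
    have := Finset.card_pos.2 ⟨a, hMτ ha⟩
    omega
  | succ m ih =>
    intro τ w hm hMτ hpos hmax
    have hτ : τ.Nonempty := hM.mono hMτ
    have hcard : (0 : ℝ) < τ.card := by exact_mod_cast Finset.card_pos.2 hτ
    -- Subtracting the least weight everywhere splits off a multiple of the barycentre of `τ`. The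
    -- remaining combination is carried by the vertices strictly above the minimum, which gives the
    -- next simplex of the flag; unless they are all exhausted, the maximal vertices are among them.
    obtain ⟨z, hz, hmin⟩ := τ.exists_min_image w hτ
    set τ' := τ.filter fun a => w z < w a with hτ'
    have hsub : τ' ⊆ τ := Finset.filter_subset _ _
    have hzn : z ∉ τ' := fun h => lt_irrefl _ (Finset.mem_filter.1 h).2
    have hout : ∀ a ∈ τ, a ∉ τ' → w a - w z = 0 := fun a ha ha' => by
      have h1 := hmin a ha
      have h2 : ¬ w z < w a := fun h => ha' (Finset.mem_filter.2 ⟨ha, h⟩)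
      linarith
    have hb : ∑ a ∈ τ, toReal a = (τ.card : ℝ) • barycentre τ := by
      rw [barycentre, smul_smul, mul_inv_cancel₀ hcard.ne', one_smul]
    have hs1 : ∑ a ∈ τ, w a = w z * τ.card + ∑ a ∈ τ', (w a - w z) := by
      rw [Finset.sum_subset hsub hout, Finset.sum_sub_distrib, Finset.sum_const, nsmul_eq_mul]
      ring
    have hs2 : ∑ a ∈ τ, w a • toReal a =
        (w z * τ.card) • barycentre τ + ∑ a ∈ τ', (w a - w z) • toReal a := by
      rw [Finset.sum_subset hsub fun a ha ha' => by rw [hout a ha ha', zero_smul]]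
      rw [mul_smul, ← hb, Finset.smul_sum, ← Finset.sum_add_distrib]
      refine Finset.sum_congr rfl fun a _ => ?_
      rw [← add_smul]; congr 1; ring
    have hwz : 0 < w z * τ.card := mul_pos (hpos z hz) hcard
    rcases τ'.eq_empty_or_nonempty with he | hne
    · refine ⟨{τ}, Set.subsingleton_singleton.isChain, ?_, ?_⟩
      · rintro κ rfl
        exact ⟨hMτ, subset_rfl⟩
      · rw [hs1, hs2, he, Finset.sum_empty, Finset.sum_empty, add_zero, add_zero, smul_smul,
          inv_mul_cancel₀ hwz.ne', one_smul]
        exact subset_convexHull ℝ _ ⟨τ, rfl, rfl⟩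
    · have hMτ' : M ⊆ τ' := by
        intro a ha
        obtain ⟨b, hb⟩ := hne
        obtain ⟨hb1, hb2⟩ := Finset.mem_filter.1 hb
        exact Finset.mem_filter.2 ⟨hMτ ha, hb2.trans_le (hmax a ha b hb1)⟩
      have hlt := Finset.card_lt_card ((Finset.ssubset_iff_of_subset hsub).2 ⟨z, hz, hzn⟩)
      obtain ⟨C, hC, hCm, hCx⟩ := ih τ' (fun a => w a - w z) (by omega) hMτ'
        (fun a ha => sub_pos.2 (Finset.mem_filter.1 ha).2)
        (fun a ha b hb => sub_le_sub_right (hmax a ha b (hsub hb)) _)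
      have hW : 0 < ∑ a ∈ τ', (w a - w z) :=
        Finset.sum_pos (fun a ha => sub_pos.2 (Finset.mem_filter.1 ha).2) hne
      refine ⟨insert τ C, hC.insert fun κ hκ _ => Or.inr ((hCm κ hκ).2.trans hsub), ?_, ?_⟩
      · rintro κ (rfl | hκ)
        · exact ⟨hMτ, subset_rfl⟩
        · exact ⟨(hCm κ hκ).1, (hCm κ hκ).2.trans hsub⟩
      · set W' := ∑ a ∈ τ', (w a - w z) with hW'
        set Y := ∑ a ∈ τ', (w a - w z) • toReal a with hY
        have e : (w z * τ.card + W')⁻¹ • ((w z * τ.card) • barycentre τ + Y) =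
            ((w z * τ.card) / (w z * τ.card + W')) • barycentre τ +
              (W' / (w z * τ.card + W')) • (W'⁻¹ • Y) := by
          rw [smul_add, smul_smul, smul_smul]
          congr 2
          · rw [div_eq_inv_mul]
          · field_simp
        rw [hs1, hs2, e]
        refine convex_convexHull ℝ _ 
          (subset_convexHull ℝ _ (Set.mem_image_of_mem _ (Set.mem_insert τ C)))
          (convexHull_mono (Set.image_mono (Set.subset_insert _ _)) hCx) (by positivity)
          (by positivity) ?_
        rw [← add_div, div_self (by positivity)]

namespace IsTri

variable {P : Set (Fin n → ℝ)} {K : SComplex n} (h : IsTri P K)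
include h

theorem mem_peak {p : Fin n → ℝ} (hp : p ∈ P) {a : Fin n → ℤ} :
    a ∈ peak K p ↔ ∀ b, coord K p b ≤ coord K p a := by
  classical
  rw [peak, Finset.mem_filter]
  refine ⟨And.right, fun ha => ⟨?_, ha⟩⟩
  obtain ⟨b, hb⟩ := h.supp_nonempty hp
  exact (h.mem_supp hp).2 (((h.mem_supp hp).1 hb).trans_le (ha b))

theorem peak_nonempty {p : Fin n → ℝ} (hp : p ∈ P) : (peak K p).Nonempty := by
  obtain ⟨a, ha, hmax⟩ := (supp K p).exists_max_image (coord K p) (h.supp_nonempty hp)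
  refine ⟨a, (h.mem_peak hp).2 fun b => ?_⟩
  by_cases hb : b ∈ supp K p
  · exact hmax b hb
  · rw [h.coord_eq_zero hp hb]; exact h.coord_nonneg hp a

theorem sum_coord {p : Fin n → ℝ} (hp : p ∈ P) : ∑ a ∈ supp K p, coord K p a = 1 :=
  (h.coord_mem_supp hp).2.2

theorem mem_closedCube {p : Fin n → ℝ} (hp : p ∈ P) : p ∈ closedCube (peak K p) (supp K p) := by
  obtain ⟨C, h1, h2, h3⟩ := exists_flag (peak K p) (h.peak_nonempty hp) _ (supp K p) (coord K p)
    le_rfl (peak_subset K p) (fun a ha => (h.mem_supp hp).1 ha)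
    fun a ha b _ => (h.mem_peak hp).1 ha b
  rw [h.sum_coord hp, inv_one, one_smul, h.sum_coord_smul hp] at h3
  exact Set.mem_biUnion (show C ∈ _ from ⟨h1, h2⟩) h3

/-- At the barycentre of a simplex containing `σ` the coordinates of the vertices of `σ` are
maximal. This condition is convex on the points supported in `σ'`, where coordinates are affine. -/
theorem subset_peak_of_mem_closedCube {σ σ' : Simplex n} (hσ : σ ∈ K) (hσ' : σ' ∈ K)
    {p : Fin n → ℝ} (hp : p ∈ closedCube σ σ') : p ∈ P ∧ σ ⊆ peak K p := by
  obtain ⟨C, ⟨-, hC⟩, hpC⟩ := Set.mem_iUnion₂.1 hp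
  suffices hs : p ∈ {p | p ∈ P ∧ supp K p ⊆ σ' ∧ ∀ a ∈ σ, ∀ b, coord K p b ≤ coord K p a} from
    ⟨hs.1, fun a ha => (h.mem_peak hs.1).2 (hs.2.2 a ha)⟩
  refine convexHull_min ?_ ?_ hpC
  · rintro _ ⟨τ, hτ, rfl⟩
    obtain ⟨h1, h2⟩ := hC τ hτ
    have hτK := h.down_closed σ' hσ' τ h2 ((h.nonempty σ hσ).mono h1)
    refine ⟨h.barycentre_mem hτK, (h.supp_barycentre hτK).subset.trans h2, fun a ha b => ?_⟩
    rw [h.coord_barycentre hτK, h.coord_barycentre hτK, if_pos (h1 ha)]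
    split_ifs
    · exact le_rfl
    · positivity
  · rintro x ⟨hx, hxs, hxa⟩ y ⟨hy, hys, hya⟩ s t hs ht hst
    have hc := h.coord_combo hx hy hσ' hxs hys hs ht hst
    have hm : s • x + t • y ∈ P := h.convex hx hy hs ht hst
    refine ⟨hm, fun a ha => ?_, fun a ha b => ?_⟩
    · by_contra hn
      have := (h.mem_supp hm).1 ha
      rw [hc, Pi.add_apply, Pi.smul_apply, Pi.smul_apply, h.coord_eq_zero hx fun h => hn (hxs h),
        h.coord_eq_zero hy fun h => hn (hys h)] at this
      simp at this
    · rw [hc]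
      simp only [Pi.add_apply, Pi.smul_apply, smul_eq_mul]
      exact add_le_add (mul_le_mul_of_nonneg_left (hxa a ha b) hs)
        (mul_le_mul_of_nonneg_left (hya a ha b) ht)

/-- Moving a point in its simplex, parallel to an edge. -/
theorem move {p : Fin n → ℝ} (hp : p ∈ P) {a b : Fin n → ℤ} (ha : a ∈ supp K p)
    (hb : b ∈ supp K p) {t : ℝ} (ht : 0 ≤ t) (hta : t ≤ coord K p a) :
    p + t • (toReal b - toReal a) ∈ P ∧ coord K (p + t • (toReal b - toReal a)) =
      fun c => coord K p c + t * ((if c = b then 1 else 0) - if c = a then 1 else 0) := by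
  classical
  have hw : (fun c => coord K p c + t * ((if c = b then 1 else 0) - if c = a then 1 else 0)) ∈
      simplexWeights (supp K p) := by
    obtain ⟨h1, h2, h3⟩ := h.coord_mem_supp hp
    refine ⟨fun c => ?_, fun c hc => ?_, ?_⟩
    · have := h1 c
      beta_reduce
      by_cases hca : c = a
      · subst hca; split_ifs <;> linarith
      · rw [if_neg hca]; split_ifs <;> linarith
    · beta_reduce
      rw [h2 c hc, if_neg (show c ≠ b by rintro rfl; exact hc hb),
        if_neg (show c ≠ a by rintro rfl; exact hc ha)]
      simp
    · rw [Finset.sum_add_distrib, h3, ← Finset.mul_sum, Finset.sum_sub_distrib]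
      simp [ha, hb]
  have e : p + t • (toReal b - toReal a) = ∑ c ∈ supp K p,
      (coord K p c + t * ((if c = b then 1 else 0) - if c = a then 1 else 0)) • toReal c := by
    simp only [add_smul, mul_smul, sub_smul, Finset.sum_add_distrib, ← Finset.smul_sum,
      Finset.sum_sub_distrib, ite_smul, one_smul, zero_smul, Finset.sum_ite_eq', ha, hb, if_true,
      h.sum_coord_smul hp]
  rw [e]
  exact ⟨h.sum_mem (h.supp_mem hp) hw, h.coord_eq (h.supp_mem hp) hw⟩

/-- The differences of vertices of the supporting simplex of `p` are directions of the face of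
`p`. -/
theorem sub_mem_faceDirections {p : Fin n → ℝ} (hp : p ∈ P) {a b : Fin n → ℤ}
    (ha : a ∈ supp K p) (hb : b ∈ supp K p) : b - a ∈ faceDirections P p := by
  have hreal : toReal (b - a) = toReal b - toReal a := by
    funext i; simp [toReal]
  refine ⟨min (coord K p a) (coord K p b), lt_min ((h.mem_supp hp).1 ha) ((h.mem_supp hp).1 hb),
    ?_, ?_⟩
  · rw [hreal]
    exact (h.move hp ha hb (le_min (h.coord_nonneg hp a) (h.coord_nonneg hp b))
      (min_le_left _ _)).1
  · have := (h.move hp hb ha (le_min (h.coord_nonneg hp a) (h.coord_nonneg hp b))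
      (min_le_right _ _)).1
    rw [hreal, sub_eq_add_neg, ← smul_neg, neg_sub]
    exact this

theorem pairing_eq_zero_of_mem_sed {p : Fin n → ℝ} (hp : p ∈ P) {a b : Fin n → ℤ}
    (ha : a ∈ supp K p) (hb : b ∈ supp K p) {v : Fin n → ZMod 2} (hv : v ∈ sed P p) :
    pairing (b - a) v = 0 := by
  have := (Submodule.mem_iInf _).1 hv (b - a)
  exact (Submodule.mem_iInf _).1 this (h.sub_mem_faceDirections hp ha hb)

/-- The cubes through `p` have their lower simplex inside `peak K p`, and `p` is in the cube from
`peak K p` to `supp K p`. The criterion does not depend on the representative quadrant, since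
sedentary vectors vanish on the edges of the support. -/
theorem mk_mem_tHypersurface {ε : (Fin n → ℤ) → ZMod 2} (p : P) (v : Fin n → ZMod 2) :
    RealLocus.mk p v ∈ tHypersurface P K ε ↔
      ∃ a ∈ peak K p.1, ∃ b ∈ peak K p.1, ε a + ε b + pairing (b - a) v = 1 := by
  constructor
  · rintro ⟨σ, hσ, σ', hσ', -, w, ⟨a, ha, b, hb, -, hab⟩, x, hx, hq⟩
    obtain ⟨h1, h2⟩ := Quotient.exact hq
    change p = x at h1
    change v - w ∈ sed P p at h2
    subst h1
    obtain ⟨-, hs⟩ := h.subset_peak_of_mem_closedCube hσ hσ' hx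
    refine ⟨a, hs ha, b, hs hb, ?_⟩
    have := h.pairing_eq_zero_of_mem_sed p.2 (peak_subset K _ (hs ha)) (peak_subset K _ (hs hb)) h2
    rw [map_sub, sub_eq_zero] at this
    rw [this, hab]
  · rintro ⟨a, ha, b, hb, hab⟩
    have hs := h.supp_mem p.2
    refine ⟨peak K p.1, h.down_closed _ hs _ (peak_subset K _) ⟨a, ha⟩, supp K p.1, hs,
      peak_subset K _, v, ⟨a, ha, b, hb, ?_, hab⟩, p, h.mem_closedCube p.2, rfl⟩
    rintro rfl
    rw [sub_self, CharTwo.add_self_eq_zero, zero_add] at hab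
    simp [pairing_apply] at hab

end IsTri

end Peak

/-! ### The topology of the real locus over the interior of the polytope -/

section Locus

open Topology Filter

variable {n : ℕ} {P : Set (Fin n → ℝ)}

/-- The projection of the real locus to the polytope. -/
def RealLocus.base (q : RealLocus P) : P :=
  Quotient.lift (s := realSetoid P) (fun p => p.1) (fun p q (h : p.1 = q.1 ∧ _) => h.1) q

theorem RealLocus.continuous_base : Continuous (RealLocus.base : RealLocus P → P) :=
  continuous_fst.quotient_lift _

theorem RealLocus.continuous_mk (v : Fin n → ZMod 2) :
    Continuous fun p : P => RealLocus.mk p v :=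
  continuous_quotient_mk'.comp (Continuous.prodMk_left v)

theorem RealLocus.mk_eq_mk {p q : P} {v w : Fin n → ZMod 2} :
    RealLocus.mk p v = RealLocus.mk q w ↔ p = q ∧ v - w ∈ sed P p :=
  ⟨fun h => Quotient.exact h, fun h => Quotient.sound h⟩

theorem RealLocus.exists_mk (q : RealLocus P) : ∃ p v, q = RealLocus.mk p v := by
  obtain ⟨⟨p, v⟩, rfl⟩ := Quotient.exists_rep q
  exact ⟨p, v, rfl⟩

/-- The part of the quadrant `v` lying over `A`. -/
def overQuadrant (A : Set P) (v : Fin n → ZMod 2) : Set (RealLocus P) :=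
  (fun p => RealLocus.mk p v) '' A

theorem mk_mem_overQuadrant {A : Set P} (hA : ∀ p ∈ A, sed P p = ⊥) {v w : Fin n → ZMod 2} {p : P} :
    RealLocus.mk p w ∈ overQuadrant A v ↔ p ∈ A ∧ w = v := by
  constructor
  · rintro ⟨q, hq, h⟩
    obtain ⟨rfl, h2⟩ := RealLocus.mk_eq_mk.1 h
    rw [hA _ hq, Submodule.mem_bot, sub_eq_zero] at h2
    exact ⟨hq, h2.symm⟩
  · rintro ⟨hp, rfl⟩
    exact ⟨p, hp, rfl⟩

theorem preimage_overQuadrant {A : Set P} (hA : ∀ p ∈ A, sed P p = ⊥) (v : Fin n → ZMod 2) :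
    Quotient.mk (realSetoid P) ⁻¹' overQuadrant A v = A ×ˢ {v} := by
  ext ⟨p, w⟩
  exact mk_mem_overQuadrant hA

theorem isOpen_overQuadrant {A : Set P} (hA : ∀ p ∈ A, sed P p = ⊥) (v : Fin n → ZMod 2)
    (h : IsOpen A) : IsOpen (overQuadrant A v) := by
  refine (isQuotientMap_quotient_mk' (s := realSetoid P)).isOpen_preimage.1 ?_
  have := preimage_overQuadrant hA v
  exact this ▸ h.prod (isOpen_discrete _)

theorem isClosed_overQuadrant {A : Set P} (hA : ∀ p ∈ A, sed P p = ⊥) (v : Fin n → ZMod 2)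
    (h : IsClosed A) : IsClosed (overQuadrant A v) := by
  refine (isQuotientMap_quotient_mk' (s := realSetoid P)).isClosed_preimage.1 ?_
  have := preimage_overQuadrant hA v
  exact this ▸ h.prod (isClosed_discrete _)

/-- Over points of trivial sedentarity the quadrants are not glued, so a set in one quadrant has as
preimage a product with a point; openness and closedness, hence frontiers, are those of the base. -/
theorem frontier_overQuadrant {A : Set P} (hA : ∀ p ∈ A, sed P p = ⊥) (v : Fin n → ZMod 2)
    (h : IsClosed A) : frontier (overQuadrant A v) = overQuadrant (frontier A) v := by
  have hi : interior (overQuadrant A v) = overQuadrant (interior A) v := by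
    apply subset_antisymm
    · intro q hq
      obtain ⟨p, -, rfl⟩ := interior_subset hq
      refine ⟨p, ?_, rfl⟩
      refine mem_interior.2 ⟨(fun p => RealLocus.mk p v) ⁻¹' interior (overQuadrant A v), ?_,
        isOpen_interior.preimage (RealLocus.continuous_mk v), hq⟩
      intro p' hp'
      exact ((mk_mem_overQuadrant hA).1 (interior_subset hp')).1
    · exact interior_maximal (Set.image_mono interior_subset)
        (isOpen_overQuadrant (fun p hp => hA p (interior_subset hp)) v isOpen_interior)
  rw [(isClosed_overQuadrant hA v h).frontier_eq, hi, h.frontier_eq]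
  ext q
  constructor
  · rintro ⟨⟨p, hp, rfl⟩, h2⟩
    exact ⟨p, ⟨hp, fun h3 => h2 ⟨p, h3, rfl⟩⟩, rfl⟩
  · rintro ⟨p, ⟨hp, h2⟩, rfl⟩
    exact ⟨⟨p, hp, rfl⟩, fun h3 =>
      h2 ((mk_mem_overQuadrant fun p hp => hA p (interior_subset hp)).1 h3).1⟩

theorem base_mem_of_mem_overQuadrant {A : Set P} {v : Fin n → ZMod 2} {q : RealLocus P}
    (h : q ∈ overQuadrant A v) : q.base ∈ A := by
  obtain ⟨p, hp, rfl⟩ := h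
  exact hp

/-- A subset of the polytope is homeomorphic to its copy in any quadrant. -/
def overQuadrantHomeomorph (A : Set P) (v : Fin n → ZMod 2) : overQuadrant A v ≃ₜ A where
  toFun q := ⟨q.1.base, base_mem_of_mem_overQuadrant q.2⟩
  invFun p := ⟨RealLocus.mk p.1 v, p.1, p.2, rfl⟩
  left_inv := by rintro ⟨_, p, hp, rfl⟩; rfl
  right_inv _ := rfl
  continuous_toFun := (RealLocus.continuous_base.comp continuous_subtype_val).subtype_mk _
  continuous_invFun := ((RealLocus.continuous_mk v).comp continuous_subtype_val).subtype_mk _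

/-- `U` and `B` cut out the same set `S`, which is thus both open and closed in `X`. -/
theorem isComponentOf_of_clopen {Y : Type*} [TopologicalSpace Y] {X S U B : Set Y}
    (hne : S.Nonempty) (hc : IsPreconnected S) (hU : IsOpen U) (hB : IsClosed B) (h1 : X ∩ U = S)
    (h2 : X ∩ B = S) : IsComponentOf X S := by
  obtain ⟨q, hq⟩ := hne
  have hSX : S ⊆ X := h1 ▸ Set.inter_subset_left
  refine ⟨q, hSX hq, subset_antisymm (hc.subset_connectedComponentIn hq hSX) ?_⟩
  have hsub := connectedComponentIn_subset X q
  have hqc := mem_connectedComponentIn (hSX hq)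
  rcases isPreconnected_iff_subset_of_disjoint.1 isPreconnected_connectedComponentIn U Bᶜ hU
    hB.isOpen_compl
    (fun y hy => by
      by_cases hyB : y ∈ B
      · left
        have : y ∈ S := h2 ▸ ⟨hsub hy, hyB⟩
        rw [← h1] at this; exact this.2
      · exact Or.inr hyB)
    (by
      refine Set.eq_empty_of_forall_notMem fun y hy => hy.2.2 ?_
      have : y ∈ S := h1 ▸ ⟨hsub hy.1, hy.2.1⟩
      rw [← h2] at this; exact this.2) with h | h
  · intro y hy
    rw [← h1]; exact ⟨hsub hy, h hy⟩
  · rw [← h2] at hq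
    exact absurd hq.2 (h hqc)

theorem IsSphereBounding.isPreconnected {Y : Type*} [TopologicalSpace Y] (hn : 2 ≤ n) {S B : Set Y}
    (h : IsSphereBounding n S B) : S.Nonempty ∧ IsPreconnected S := by
  obtain ⟨hSB, -, e, he⟩ := h
  have hrank : 1 < Module.rank ℝ (EuclideanSpace ℝ (Fin n)) := by
    rw [← Module.finrank_eq_rank, finrank_euclideanSpace, Fintype.card_fin]
    exact_mod_cast hn
  have hs := isConnected_sphere hrank (0 : EuclideanSpace ℝ (Fin n)) zero_le_one
  have hS : S = (fun z : Metric.closedBall (0 : EuclideanSpace ℝ (Fin n)) 1 => (e.symm z : Y)) ''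
      (Subtype.val ⁻¹' Metric.sphere 0 1) := by
    ext y
    constructor
    · intro hy
      exact ⟨e ⟨y, hSB hy⟩, (he ⟨y, hSB hy⟩).1 hy, by simp⟩
    · rintro ⟨z, hz, rfl⟩
      exact (he (e.symm z)).2 (by simpa using hz)
  have himg : Subtype.val '' (Subtype.val ⁻¹' Metric.sphere 0 1 :
      Set (Metric.closedBall (0 : EuclideanSpace ℝ (Fin n)) 1)) = Metric.sphere 0 1 := by
    rw [Subtype.image_preimage_coe]
    exact Set.inter_eq_right.2 Metric.sphere_subset_closedBall
  have hs' : IsConnected (Subtype.val ⁻¹' Metric.sphere 0 1 :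
      Set (Metric.closedBall (0 : EuclideanSpace ℝ (Fin n)) 1)) := by
    refine ⟨?_, ?_⟩
    · rw [← himg] at hs
      exact hs.nonempty.of_image
    · rw [← Topology.IsInducing.subtypeVal.isPreconnected_image, himg]
      exact hs.isPreconnected
  rw [hS]
  exact ⟨hs'.nonempty.image _, hs'.isPreconnected.image _
    (continuous_subtype_val.comp e.symm.continuous).continuousOn⟩

end Locus

/-! ### The star-shaped balls around interior vertices -/

section Ball

open Topology Filter

variable {n : ℕ} {P : Set (Fin n → ℝ)} {K : SComplex n}

/-- The points nearest to the vertex `x`. -/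
def cap (P : Set (Fin n → ℝ)) (K : SComplex n) (x : Fin n → ℤ) : Set P := {p | x ∈ peak K p.1}

/-- The points nearest to the vertex `x` and to some other vertex. -/
def rim (P : Set (Fin n → ℝ)) (K : SComplex n) (x : Fin n → ℤ) : Set P :=
  {p | x ∈ peak K p.1 ∧ ∃ a ∈ peak K p.1, a ≠ x}

/-- The barycentric coordinates other than that of `x`. -/
noncomputable def otherCoord (K : SComplex n) (x : Fin n → ℤ) (p : Fin n → ℝ) :
    {a // a ∈ (verts K).erase x} → ℝ := fun a => coord K p a.1

/-- The radial function of `p` seen from the vertex `x`. -/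
noncomputable def radial (K : SComplex n) (x : Fin n → ℤ) (p : Fin n → ℝ) : ℝ :=
  1 - coord K p x + ‖otherCoord K x p‖

/-- The vector from the vertex `x` to `p`. -/
noncomputable def displacement (x : Fin n → ℤ) (p : Fin n → ℝ) : EuclideanSpace ℝ (Fin n) :=
  WithLp.toLp 2 (p - toReal x)

/-- The radial projection of the set of points nearest to `x` to the unit ball. -/
noncomputable def toBall (K : SComplex n) (x : Fin n → ℤ) (p : Fin n → ℝ) :
    EuclideanSpace ℝ (Fin n) :=
  (radial K x p / ‖displacement x p‖) • displacement x p

theorem displacement_eq_zero {x : Fin n → ℤ} {p : Fin n → ℝ} :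
    displacement x p = 0 ↔ p = toReal x := by
  rw [displacement, WithLp.toLp_eq_zero, sub_eq_zero]

theorem displacement_add_smul (x : Fin n → ℤ) (p : Fin n → ℝ) (κ : ℝ) :
    displacement x (toReal x + κ • (p - toReal x)) = κ • displacement x p := by
  rw [displacement, displacement, add_sub_cancel_left, WithLp.toLp_smul]

theorem eq_add_smul_of_displacement {x : Fin n → ℤ} {p q : Fin n → ℝ} {κ : ℝ}
    (h : displacement x q = κ • displacement x p) : q = toReal x + κ • (p - toReal x) := by
  rw [displacement, displacement, ← WithLp.toLp_smul] at h
  have := (WithLp.toLp_injective 2) h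
  rw [← this, add_sub_cancel]

theorem continuous_displacement (x : Fin n → ℤ) : Continuous (displacement x) := by
  unfold displacement
  fun_prop

namespace IsTri

variable (h : IsTri P K)
include h

theorem continuous_coord (a : Fin n → ℤ) : Continuous fun p : P => coord K p.1 a :=
  continuousOn_iff_continuous_domRestrict.1 (h.continuousOn_coord_apply a)

theorem isClosed_cap (x : Fin n → ℤ) : IsClosed (cap P K x) := by
  have : cap P K x = ⋂ b, {p : P | coord K p.1 b ≤ coord K p.1 x} := by
    ext p
    simp only [cap, Set.mem_ofPred_eq, h.mem_peak p.2, Set.mem_iInter]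
  rw [this]
  exact isClosed_iInter fun b => isClosed_le (h.continuous_coord b) (h.continuous_coord x)

theorem coord_pos_of_mem_peak {p : Fin n → ℝ} (hp : p ∈ P) {x : Fin n → ℤ} (hx : x ∈ peak K p) :
    0 < coord K p x :=
  (h.mem_supp hp).1 (peak_subset K p hx)

/-- If `x` is the only maximum, this persists nearby. If another vertex `a` ties with `x`, an
arbitrarily small move from `x` towards `a` leaves the cap. -/
theorem frontier_cap (x : Fin n → ℤ) : frontier (cap P K x) = rim P K x := by
  classical
  rw [(h.isClosed_cap x).frontier_eq]
  ext p
  constructor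
  · rintro ⟨hp, hpi⟩
    refine ⟨hp, ?_⟩
    by_contra hc
    push Not at hc
    have hpx := (h.mem_peak p.2).1 hp
    refine hpi (mem_interior.2
      ⟨⋂ b ∈ (verts K).erase x, {p : P | coord K p.1 b < coord K p.1 x}, ?_, ?_, ?_⟩)
    · intro q hq
      refine (h.mem_peak q.2).2 fun b => ?_
      by_cases hbx : b = x
      · rw [hbx]
      by_cases hb : b ∈ verts K
      · exact (Set.mem_iInter₂.1 hq b (Finset.mem_erase.2 ⟨hbx, hb⟩)).le
      · rw [h.coord_eq_zero q.2 fun hb' => hb (subset_verts (h.supp_mem q.2) hb')]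
        exact h.coord_nonneg q.2 x
    · exact isOpen_biInter_finset fun b _ =>
        isOpen_lt (h.continuous_coord b) (h.continuous_coord x)
    · refine Set.mem_iInter₂.2 fun b hb => ?_
      refine lt_of_le_of_ne (hpx b) fun e => (Finset.mem_erase.1 hb).1 (hc b ?_)
      exact (h.mem_peak p.2).2 fun c => by rw [e]; exact hpx c
  · rintro ⟨hp, a, ha, hax⟩
    refine ⟨hp, fun hi => ?_⟩
    obtain ⟨u, hu, hsub⟩ := mem_nhds_subtype P p _ |>.1 (mem_interior_iff_mem_nhds.1 hi)
    have hpx := h.coord_pos_of_mem_peak p.2 hp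
    have hc : Continuous fun t : ℝ => p.1 + t • (toReal a - toReal x) := by fun_prop
    have h1 : ∀ᶠ t in 𝓝[>] (0 : ℝ), p.1 + t • (toReal a - toReal x) ∈ u := by
      refine nhdsWithin_le_nhds (hc.continuousAt.eventually_mem ?_)
      simpa using hu
    obtain ⟨t, ht, ht0, htx⟩ := (h1.and (Ioc_mem_nhdsGT hpx)).exists
    obtain ⟨hm, hcoord⟩ := h.move p.2 (peak_subset K _ hp) (peak_subset K _ ha) ht0.le htx
    have := (h.mem_peak hm).1 (hsub (show (⟨_, hm⟩ : P) ∈ Subtype.val ⁻¹' u from ht)) a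
    rw [hcoord] at this
    simp only [if_true, if_neg hax, if_neg hax.symm] at this
    have h2 := (h.mem_peak p.2).1 ha x
    linarith

theorem coord_le_norm {p : Fin n → ℝ} (hp : p ∈ P) {a x : Fin n → ℤ} (hax : a ≠ x) :
    coord K p a ≤ ‖otherCoord K x p‖ := by
  by_cases ha : a ∈ verts K
  · exact (Real.le_norm_self _).trans
      (norm_le_pi_norm (otherCoord K x p) ⟨a, Finset.mem_erase.2 ⟨hax, ha⟩⟩)
  · rw [h.coord_eq_zero hp fun ha' => ha (subset_verts (h.supp_mem hp) ha')]
    exact norm_nonneg _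

theorem coord_le_one {p : Fin n → ℝ} (hp : p ∈ P) (a : Fin n → ℤ) : coord K p a ≤ 1 :=
  simplexWeights_le_one (h.coord_mem_supp hp) a

theorem radial_nonneg {p : Fin n → ℝ} (hp : p ∈ P) (x : Fin n → ℤ) : 0 ≤ radial K x p :=
  add_nonneg (sub_nonneg.2 (h.coord_le_one hp x)) (norm_nonneg _)

theorem eq_of_radial_eq_zero {p : Fin n → ℝ} (hp : p ∈ P) {x : Fin n → ℤ}
    (h0 : radial K x p = 0) : p = toReal x := by
  have h1 := sub_nonneg.2 (h.coord_le_one hp x)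
  have h2 := norm_nonneg (otherCoord K x p)
  rw [radial] at h0
  have h3 : coord K p x = 1 := by linarith
  have h4 : ‖otherCoord K x p‖ = 0 := by linarith
  have h5 : ∀ a, a ≠ x → coord K p a = 0 := fun a ha =>
    le_antisymm (h4 ▸ h.coord_le_norm hp ha) (h.coord_nonneg hp a)
  rw [← h.sum_coord_smul hp, Finset.sum_eq_single x]
  · rw [h3, one_smul]
  · intro a _ ha
    rw [h5 a ha, zero_smul]
  · intro hx
    rw [h.coord_eq_zero hp hx, zero_smul]

theorem coord_vertex {x : Fin n → ℤ} (hx : {x} ∈ K) (a : Fin n → ℤ) :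
    coord K (toReal x) a = if a = x then 1 else 0 := by
  have : barycentre {x} = toReal x := by simp [barycentre]
  rw [← this, h.coord_barycentre hx]
  simp

theorem radial_vertex {x : Fin n → ℤ} (hx : {x} ∈ K) : radial K x (toReal x) = 0 := by
  have : otherCoord K x (toReal x) = 0 := by
    funext a
    rw [otherCoord, h.coord_vertex hx, if_neg (Finset.mem_erase.1 a.2).1, Pi.zero_apply]
  rw [radial, this, h.coord_vertex hx, if_pos rfl, norm_zero]
  norm_num

/-- A homothety centred at `x` multiplies by `κ` the other coordinates and the defect `1 - coord K p
x`, so the radial function is homogeneous. The bound on `κ` says that the coordinate at `x` stays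
nonnegative. -/
theorem scale {p : Fin n → ℝ} (hp : p ∈ P) {x : Fin n → ℤ} (hx : x ∈ supp K p) {κ : ℝ}
    (hκ : 0 ≤ κ) (hκ1 : κ * (1 - coord K p x) ≤ 1) :
    toReal x + κ • (p - toReal x) ∈ P ∧
      radial K x (toReal x + κ • (p - toReal x)) = κ * radial K x p := by
  classical
  have hw : (fun c => κ * coord K p c + (1 - κ) * if c = x then 1 else 0) ∈
      simplexWeights (supp K p) := by
    obtain ⟨h1, h2, h3⟩ := h.coord_mem_supp hp
    refine ⟨fun c => ?_, fun c hc => ?_, ?_⟩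
    · have := h1 c
      beta_reduce
      split_ifs with hcx
      · subst hcx; linarith
      · rw [mul_zero, add_zero]; positivity
    · beta_reduce
      rw [h2 c hc, if_neg (show c ≠ x by rintro rfl; exact hc hx)]
      simp
    · rw [Finset.sum_add_distrib, ← Finset.mul_sum, h3, ← Finset.mul_sum]
      simp [hx]
  have e : toReal x + κ • (p - toReal x) =
      ∑ c ∈ supp K p, (κ * coord K p c + (1 - κ) * if c = x then 1 else 0) • toReal c := by
    simp only [add_smul, mul_smul, Finset.sum_add_distrib, ← Finset.smul_sum, ite_smul, one_smul,
      zero_smul, Finset.sum_ite_eq', hx, if_true, h.sum_coord_smul hp]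
    rw [smul_sub, sub_smul, one_smul]
    abel
  have hc := h.coord_eq (h.supp_mem hp) hw
  rw [e]
  refine ⟨h.sum_mem (h.supp_mem hp) hw, ?_⟩
  have ho : otherCoord K x (∑ c ∈ supp K p,
      (κ * coord K p c + (1 - κ) * if c = x then 1 else 0) • toReal c) = κ • otherCoord K x p := by
    funext a
    rw [otherCoord, hc]
    simp [(Finset.mem_erase.1 a.2).1, otherCoord]
  rw [radial, ho, hc, norm_smul, Real.norm_of_nonneg hκ, radial]
  simp only [if_true]
  ring

/-- The norm on the other coordinates is the supremum norm, so the inequality compares their maximum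
with the coordinate at `x`. -/
theorem mem_cap_iff {p : Fin n → ℝ} (hp : p ∈ P) (x : Fin n → ℤ) :
    x ∈ peak K p ↔ radial K x p ≤ 1 := by
  rw [h.mem_peak hp, radial]
  constructor
  · intro hx
    have : ‖otherCoord K x p‖ ≤ coord K p x := by
      rw [pi_norm_le_iff_of_nonneg (h.coord_nonneg hp x)]
      intro a
      rw [otherCoord, Real.norm_of_nonneg (h.coord_nonneg hp _)]
      exact hx a
    linarith
  · intro hr b
    by_cases hb : b = x
    · rw [hb]
    · have := h.coord_le_norm hp hb
      linarith

theorem mem_rim_iff {p : Fin n → ℝ} (hp : p ∈ P) {x : Fin n → ℤ} (hx : x ∈ peak K p) :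
    (∃ a ∈ peak K p, a ≠ x) ↔ radial K x p = 1 := by
  have hmax := (h.mem_peak hp).1 hx
  constructor
  · rintro ⟨a, ha, hax⟩
    refine le_antisymm ((h.mem_cap_iff hp x).1 hx) ?_
    have h1 := h.coord_le_norm hp hax
    have h2 := (h.mem_peak hp).1 ha x
    rw [radial]
    linarith
  · intro hr
    rw [radial] at hr
    by_contra hc
    push Not at hc
    have : ‖otherCoord K x p‖ < coord K p x := by
      rw [pi_norm_lt_iff (h.coord_pos_of_mem_peak hp hx)]
      intro a
      rw [otherCoord, Real.norm_of_nonneg (h.coord_nonneg hp _)]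
      refine lt_of_le_of_ne (hmax a) fun e => (Finset.mem_erase.1 a.2).1 (hc a ?_)
      exact (h.mem_peak hp).2 fun c => by rw [e]; exact hmax c
    linarith

theorem norm_toBall {p : Fin n → ℝ} (hp : p ∈ P) {x : Fin n → ℤ} (hx : {x} ∈ K) :
    ‖toBall K x p‖ = radial K x p := by
  rw [toBall, norm_smul, norm_div, norm_norm, Real.norm_of_nonneg (h.radial_nonneg hp x)]
  by_cases h0 : displacement x p = 0
  · rw [displacement_eq_zero.1 h0, h.radial_vertex hx]; simp
  · rw [div_mul_cancel₀ _ (norm_ne_zero_iff.2 h0)]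

theorem continuous_radial (x : Fin n → ℤ) : Continuous fun p : P => radial K x p.1 :=
  (continuous_const.sub (h.continuous_coord x)).add
    (continuous_pi fun a : {a // a ∈ (verts K).erase x} => h.continuous_coord a.1).norm

/-- Only the centre needs care, where the direction is undefined; the norm of the image is the
radial function, which tends to `0` there. -/
theorem continuous_toBall {x : Fin n → ℤ} (hx : {x} ∈ K) :
    Continuous fun p : P => toBall K x p.1 := by
  have hd : Continuous fun p : P => displacement x p.1 :=
    (continuous_displacement x).comp continuous_subtype_val
  rw [continuous_iff_continuousAt]
  intro p
  by_cases h0 : displacement x p.1 = 0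
  · have hp := displacement_eq_zero.1 h0
    have hz : toBall K x p.1 = 0 := by rw [toBall, h0, smul_zero]
    rw [ContinuousAt, hz, tendsto_zero_iff_norm_tendsto_zero]
    have := (h.continuous_radial x).tendsto p
    rw [hp, h.radial_vertex hx] at this
    exact this.congr fun q => (h.norm_toBall q.2 hx).symm
  · exact (((h.continuous_radial x).continuousAt).div hd.continuousAt.norm
      (norm_ne_zero_iff.2 h0)).smul hd.continuousAt

theorem eq_of_displacement_eq_smul {p q : Fin n → ℝ} (hp : p ∈ P) {x : Fin n → ℤ}
    (hx : x ∈ supp K p) {κ : ℝ} (hκ : 0 ≤ κ) (hκ1 : κ ≤ 1)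
    (hd : displacement x q = κ • displacement x p) (hr : radial K x p = radial K x q)
    (h0 : radial K x p ≠ 0) : p = q := by
  have hq := eq_add_smul_of_displacement hd
  have h1 := sub_nonneg.2 (h.coord_le_one hp x)
  have h2 := h.coord_nonneg hp x
  obtain ⟨-, hs⟩ := h.scale hp hx hκ (by nlinarith)
  rw [← hq, ← hr] at hs
  have hk : κ = 1 := by
    have : (1 - κ) * radial K x p = 0 := by linarith
    rcases mul_eq_zero.1 this with h3 | h3
    · linarith
    · exact absurd h3 h0
  rw [hq, hk, one_smul, add_sub_cancel]

/-- Equal images have equal radial values and lie on a common ray from `x`. The point nearer to `x`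
is a rescaling of the other, and homogeneity of the radial function makes the factor `1`. -/
theorem toBall_injOn {x : Fin n → ℤ} (hx : {x} ∈ K) {p q : Fin n → ℝ} (hp : p ∈ P) (hq : q ∈ P)
    (hpx : x ∈ peak K p) (hqx : x ∈ peak K q) (he : toBall K x p = toBall K x q) : p = q := by
  have hr : radial K x p = radial K x q := by
    rw [← h.norm_toBall hp hx, ← h.norm_toBall hq hx, he]
  by_cases h0 : radial K x p = 0
  · rw [h.eq_of_radial_eq_zero hp h0, h.eq_of_radial_eq_zero hq (hr ▸ h0)]
  have hne : ∀ p, radial K x p ≠ 0 → displacement x p ≠ 0 := fun p h1 h2 => by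
    rw [displacement_eq_zero.1 h2] at h1
    exact h1 (h.radial_vertex hx)
  have hP := norm_pos_iff.2 (hne p h0)
  have hQ := norm_pos_iff.2 (hne q (hr ▸ h0))
  have hpq : displacement x q = (‖displacement x q‖ / ‖displacement x p‖) • displacement x p := by
    rw [toBall, toBall, ← hr] at he
    have := congrArg (fun z => (‖displacement x q‖ / radial K x p) • z) he
    simp only [smul_smul] at this
    rw [show ‖displacement x q‖ / radial K x p * (radial K x p / ‖displacement x q‖) = 1 by
      field_simp, one_smul] at this
    refine this.symm.trans (congrArg (· • displacement x p) ?_)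
    field_simp
  rcases le_total ‖displacement x q‖ ‖displacement x p‖ with hle | hle
  · exact h.eq_of_displacement_eq_smul hp (peak_subset K p hpx) (by positivity)
      ((div_le_one hP).2 hle) hpq hr h0
  · refine (h.eq_of_displacement_eq_smul hq (peak_subset K q hqx) (by positivity)
      ((div_le_one hQ).2 hle) ?_ hr.symm (hr ▸ h0)).symm
    nth_rewrite 2 [hpq]
    rw [smul_smul]
    rw [show ‖displacement x p‖ / ‖displacement x q‖ * (‖displacement x q‖ / ‖displacement x p‖) = 1
      by field_simp, one_smul]

/-- As `x` is interior, a short step in the direction `y` stays in `P` and keeps `x` in the support.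
Rescaling this point gives the radial value `‖y‖`. -/
theorem toBall_surjOn {x : Fin n → ℤ} (hx : {x} ∈ K) (hxi : toReal x ∈ interior P)
    {y : EuclideanSpace ℝ (Fin n)} (hy : ‖y‖ ≤ 1) : ∃ p ∈ P, x ∈ peak K p ∧ toBall K x p = y := by
  have hxP : toReal x ∈ P := interior_subset hxi
  have hxs : x ∈ supp K (toReal x) :=
    (h.mem_supp hxP).2 (by rw [h.coord_vertex hx, if_pos rfl]; exact one_pos)
  by_cases hy0 : y = 0
  · refine ⟨toReal x, hxP, (h.mem_cap_iff hxP x).2 (by rw [h.radial_vertex hx]; exact zero_le_one), ?_⟩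
    rw [hy0, toBall, displacement_eq_zero.2 rfl, smul_zero]
  have hyp := norm_pos_iff.2 hy0
  have hPn := mem_interior_iff_mem_nhds.1 hxi
  have hev := h.eventually_supp_subset hxP
  rw [nhdsWithin_eq_nhds.2 hPn] at hev
  have hc : Continuous fun t : ℝ => toReal x + t • y.ofLp := by fun_prop
  have h1 : ∀ᶠ t in 𝓝[>] (0 : ℝ), toReal x + t • y.ofLp ∈ P ∧
      supp K (toReal x) ⊆ supp K (toReal x + t • y.ofLp) := by
    have h0 : Tendsto (fun t : ℝ => toReal x + t • y.ofLp) (𝓝 0) (𝓝 (toReal x)) := by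
      simpa using hc.tendsto 0
    exact (h0.eventually ((eventually_mem_set.2 hPn).and hev)).filter_mono nhdsWithin_le_nhds
  obtain ⟨t, ⟨htP, hts⟩, ht0⟩ := (h1.and self_mem_nhdsWithin).exists
  replace ht0 : 0 < t := ht0
  set p := toReal x + t • y.ofLp with hp
  have hdp : displacement x p = t • y := by
    rw [displacement, hp, add_sub_cancel_left, WithLp.toLp_smul]
  have hr0 : 0 < radial K x p := by
    refine lt_of_le_of_ne (h.radial_nonneg htP x) fun e => ?_
    have := displacement_eq_zero.2 (h.eq_of_radial_eq_zero htP e.symm)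
    rw [hdp] at this
    exact (smul_ne_zero ht0.ne' hy0) this
  have hle : 1 - coord K p x ≤ radial K x p := by
    rw [radial]; linarith [norm_nonneg (otherCoord K x p)]
  obtain ⟨hs1, hs2⟩ := h.scale htP (hts hxs) (κ := ‖y‖ / radial K x p) (by positivity) (by
    calc ‖y‖ / radial K x p * (1 - coord K p x) ≤ ‖y‖ / radial K x p * radial K x p := by gcongr
      _ = ‖y‖ := div_mul_cancel₀ _ hr0.ne'
      _ ≤ 1 := hy)
  rw [div_mul_cancel₀ _ hr0.ne'] at hs2
  refine ⟨_, hs1, (h.mem_cap_iff hs1 x).2 (hs2.le.trans hy), ?_⟩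
  rw [toBall, hs2, displacement_add_smul, hdp, smul_smul, smul_smul, norm_smul, norm_smul,
    Real.norm_of_nonneg ht0.le, Real.norm_of_nonneg (show 0 ≤ ‖y‖ / radial K x p by positivity)]
  convert one_smul ℝ y using 2
  field_simp

theorem isCompact_polytope : IsCompact P := by
  have : P = wsum K '' weights K := by
    ext p
    constructor
    · intro hp
      obtain ⟨w, hw, rfl⟩ := h.exists_weights p hp
      exact ⟨w, hw, rfl⟩
    · rintro ⟨w, hw, rfl⟩
      exact h.wsum_mem hw
  rw [this]
  exact (isCompact_weights K).image (continuous_wsum K)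

/-- The set of points nearest to an interior vertex is a ball, bounded by its rim. -/
theorem exists_cap_homeomorph {x : Fin n → ℤ} (hx : {x} ∈ K) (hxi : toReal x ∈ interior P) :
    ∃ e : cap P K x ≃ₜ Metric.closedBall (0 : EuclideanSpace ℝ (Fin n)) 1,
      ∀ p : cap P K x, p.1 ∈ rim P K x ↔
        (e p : EuclideanSpace ℝ (Fin n)) ∈ Metric.sphere 0 1 := by
  have hmem : ∀ p : cap P K x, toBall K x p.1.1 ∈
      Metric.closedBall (0 : EuclideanSpace ℝ (Fin n)) 1 := fun p => by
    rw [mem_closedBall_zero_iff, h.norm_toBall p.1.2 hx]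
    exact (h.mem_cap_iff p.1.2 x).1 p.2
  let f : cap P K x → Metric.closedBall (0 : EuclideanSpace ℝ (Fin n)) 1 :=
    fun p => ⟨toBall K x p.1.1, hmem p⟩
  have hf : Continuous f := ((h.continuous_toBall hx).comp continuous_subtype_val).subtype_mk _
  have hb : Function.Bijective f := by
    constructor
    · intro p q hpq
      exact Subtype.ext (Subtype.ext
        (h.toBall_injOn hx p.1.2 q.1.2 p.2 q.2 (congrArg Subtype.val hpq)))
    · rintro ⟨y, hy⟩
      obtain ⟨p, hp, hpx, hpy⟩ := h.toBall_surjOn hx hxi (mem_closedBall_zero_iff.1 hy)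
      exact ⟨⟨⟨p, hp⟩, hpx⟩, Subtype.ext hpy⟩
  have : CompactSpace P := isCompact_iff_compactSpace.1 h.isCompact_polytope
  have : CompactSpace (cap P K x) := isCompact_iff_compactSpace.1 (h.isClosed_cap x).isCompact
  refine ⟨hf.homeoOfEquivCompactToT2 (f := Equiv.ofBijective f hb), fun p => ?_⟩
  change _ ↔ toBall K x p.1.1 ∈ _
  rw [mem_sphere_zero_iff_norm, h.norm_toBall p.1.2 hx, ← h.mem_rim_iff p.1.2 p.2]
  exact and_iff_right p.2

theorem isSphereBounding {x : Fin n → ℤ} (hx : {x} ∈ K) (hxi : toReal x ∈ interior P)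
    (hsed : ∀ p ∈ cap P K x, sed P p = ⊥) (v : Fin n → ZMod 2) :
    IsSphereBounding n (overQuadrant (rim P K x) v) (overQuadrant (cap P K x) v) := by
  have hsub : rim P K x ⊆ cap P K x := fun p hp => hp.1
  refine ⟨Set.image_mono hsub, ?_, ?_⟩
  · rw [frontier_overQuadrant hsed v (h.isClosed_cap x), h.frontier_cap]
  · obtain ⟨e, he⟩ := h.exists_cap_homeomorph hx hxi
    refine ⟨(overQuadrantHomeomorph (cap P K x) v).trans e, ?_⟩
    rintro ⟨_, p, hp, rfl⟩
    refine Iff.trans ?_ (he ⟨p, hp⟩)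
    rw [mk_mem_overQuadrant fun p hp => hsed p (hsub hp)]
    exact and_iff_left rfl

/-- The sphere around an isolated interior vertex is a component of the T-hypersurface. -/
theorem tHypersurface_inter {ε : (Fin n → ℤ) → ZMod 2} {x : Fin n → ℤ} {v : Fin n → ZMod 2}
    (hv : Isolated K ε x v) (hsed : ∀ p : P, 0 < coord K p.1 x → sed P p = ⊥) {A : Set P}
    (hA : cap P K x ⊆ A) (hA' : ∀ p ∈ A, 0 < coord K p.1 x) :
    tHypersurface P K ε ∩ overQuadrant A v = overQuadrant (rim P K x) v := by
  have hAs : ∀ p ∈ A, sed P p = ⊥ := fun p hp => hsed p (hA' p hp)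
  have dec1 : ∀ s t u y z : ZMod 2, s + t + y = 1 → s + u + z = 1 → t + u + (z - y) ≠ 1 := by decide
  ext q
  obtain ⟨p, w, rfl⟩ := q.exists_mk
  rw [Set.mem_inter_iff, mk_mem_overQuadrant hAs,
    mk_mem_overQuadrant fun p hp => hAs p (hA hp.1), h.mk_mem_tHypersurface]
  constructor
  · rintro ⟨⟨a, ha, b, hb, hab⟩, hp, rfl⟩
    refine ⟨?_, rfl⟩
    have hne : a ≠ b := by
      rintro rfl
      rw [sub_self, CharTwo.add_self_eq_zero, zero_add] at hab
      simp [pairing_apply] at hab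
    by_cases hax : a = x
    · subst hax
      exact ⟨ha, b, hb, hne.symm⟩
    by_cases hbx : b = x
    · subst hbx
      exact ⟨hb, a, ha, hne⟩
    -- Otherwise `a` and `b` are both of sign opposite to `x` in this quadrant, hence of the same
    -- sign.
    exfalso
    have hxs := (h.mem_supp p.2).2 (hA' p hp)
    have h1 := hv _ (h.supp_mem p.2) hxs a (peak_subset K _ ha) hax
    have h2 := hv _ (h.supp_mem p.2) hxs b (peak_subset K _ hb) hbx
    refine dec1 _ _ _ _ _ h1 h2 ?_
    rw [← pairing_sub_left, sub_sub_sub_cancel_right]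
    exact hab
  · rintro ⟨⟨hx, a, ha, hax⟩, rfl⟩
    exact ⟨⟨x, hx, a, ha, hv _ (h.supp_mem p.2) (peak_subset K _ hx) a (peak_subset K _ ha) hax⟩,
      hA hx, rfl⟩

/-- The open star of `x` and the closed cap, both in the quadrant `v`, cut the hypersurface in the
same sphere, which is connected since `n ≥ 2`. -/
theorem isComponentOf_rim (hn : 2 ≤ n) {ε : (Fin n → ℤ) → ZMod 2} {x : Fin n → ℤ}
    {v : Fin n → ZMod 2} (hx : {x} ∈ K) (hxi : toReal x ∈ interior P) (hv : Isolated K ε x v)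
    (hsed : ∀ p : P, 0 < coord K p.1 x → sed P p = ⊥) :
    IsComponentOf (tHypersurface P K ε) (overQuadrant (rim P K x) v) := by
  have hcap : ∀ p ∈ cap P K x, 0 < coord K p.1 x := fun p hp => h.coord_pos_of_mem_peak p.2 hp
  obtain ⟨h1, h2⟩ := (h.isSphereBounding hx hxi (fun p hp => hsed p (hcap p hp)) v).isPreconnected hn
  exact isComponentOf_of_clopen h1 h2
    (isOpen_overQuadrant (A := {p : P | 0 < coord K p.1 x}) hsed v
      (isOpen_lt continuous_const (h.continuous_coord x)))
    (isClosed_overQuadrant (fun p hp => hsed p (hcap p hp)) v (h.isClosed_cap x))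
    (h.tHypersurface_inter hv hsed hcap fun _ hp => hp)
    (h.tHypersurface_inter hv hsed subset_rfl hcap)

end IsTri

end Ball

/-! ### Locally constant functions on a T-hypersurface -/

section Local

variable {n : ℕ}

/-- The value of the cochain `dε + ω` on the edge `{a, b}` in the quadrant `v`. -/
def edgeSign (ε : (Fin n → ℤ) → ZMod 2) (a b : Fin n → ℤ) (v : Fin n → ZMod 2) : ZMod 2 :=
  ε a + ε b + pairing (b - a) v

theorem edgeSign_add (ε : (Fin n → ℤ) → ZMod 2) (a b c : Fin n → ℤ) (v : Fin n → ZMod 2) :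
    edgeSign ε a b v + edgeSign ε b c v = edgeSign ε a c v := by
  simp only [edgeSign, pairing_sub_left]
  have dec : ∀ a b c x y z : ZMod 2, a + b + (y - x) + (b + c + (z - y)) = a + c + (z - x) := by
    decide
  exact dec _ _ _ _ _ _

theorem edgeSign_self (ε : (Fin n → ℤ) → ZMod 2) (a : Fin n → ℤ) (v : Fin n → ZMod 2) :
    edgeSign ε a a v = 0 := by
  have dec : ∀ x : ZMod 2, x + x = x → x = 0 := by decide
  exact dec _ (edgeSign_add ε a a a v)

theorem edgeSign_symm (ε : (Fin n → ℤ) → ZMod 2) (a b : Fin n → ℤ) (v : Fin n → ZMod 2) :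
    edgeSign ε a b v = edgeSign ε b a v := by
  have dec : ∀ x y : ZMod 2, x + y = 0 → x = y := by decide
  exact dec _ _ ((edgeSign_add ε a b a v).trans (edgeSign_self ε a v))

theorem edgeSign_add_right (ε : (Fin n → ℤ) → ZMod 2) (a b : Fin n → ℤ) (v w : Fin n → ZMod 2) :
    edgeSign ε a b (v + w) = edgeSign ε a b v + pairing (b - a) w := by
  rw [edgeSign, edgeSign, map_add, ← add_assoc]

/-- A function of a point of the polytope and of a quadrant which is locally constant on the
T-hypersurface. -/
structure IsLocal (P : Set (Fin n → ℝ)) (K : SComplex n) (ε : (Fin n → ℤ) → ZMod 2)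
    (Ψ : (Fin n → ℝ) → (Fin n → ZMod 2) → ZMod 2) : Prop where
  eq_of_peak : ∀ σ ∈ K, ∀ p ∈ P, ∀ q ∈ P, supp K p ⊆ σ → supp K q ⊆ σ → ∀ a b v,
    a ∈ peak K p → b ∈ peak K p → a ∈ peak K q → b ∈ peak K q → edgeSign ε a b v = 1 →
    Ψ p v = Ψ q v
  add_sed : ∀ p ∈ P, ∀ v, ∀ s ∈ sed P p, Ψ p (v + s) = Ψ p v

/-- The sum of the values of `Ψ` at the points of the T-hypersurface over the middle of an
edge. -/
noncomputable def edgeSum (ε : (Fin n → ℤ) → ZMod 2)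
    (Ψ : (Fin n → ℝ) → (Fin n → ZMod 2) → ZMod 2) (a b : Fin n → ℤ) : ZMod 2 :=
  ∑ v, edgeSign ε a b v * Ψ (barycentre {a, b}) v

theorem mul_eq_mul_of_eq_one {x y z : ZMod 2} (h : x = 1 → y = z) : x * y = x * z := by
  have dec : ∀ x : ZMod 2, x = 0 ∨ x = 1 := by decide
  rcases dec x with hx | hx
  · rw [hx, zero_mul, zero_mul]
  · rw [h hx]

/-- A function on a vector space modulo `2` with vanishing sum and moments is zero if its support
lies in a line. -/
theorem eq_zero_of_moments {G : (Fin n → ZMod 2) → ZMod 2} (h0 : ∑ v, G v = 0)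
    (h1 : ∑ v, G v • v = 0) (N : Set (Fin n → ZMod 2))
    (hN : ∀ v ∈ N, ∀ w ∈ N, v ≠ 0 → w ≠ 0 → v = w)
    (hG : ∀ v w, G v ≠ 0 → G w ≠ 0 → v + w ∈ N) : G = 0 := by
  have dec : ∀ x : ZMod 2, x ≠ 0 → x = 1 := by decide
  by_contra hne
  obtain ⟨v₀, hv₀⟩ := Function.ne_iff.1 hne
  -- The vanishing total excludes a support with one element. The support is then a pair, by the
  -- hypothesis on `N`, and the vanishing first moment says that its two elements are equal.
  obtain ⟨v₁, hv₁, hne₁⟩ : ∃ v₁, G v₁ ≠ 0 ∧ v₁ ≠ v₀ := by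
    by_contra hc
    push Not at hc
    rw [Finset.sum_eq_single v₀] at h0
    · exact hv₀ h0
    · intro v _ hv
      by_contra hv'
      exact hv (hc v hv')
    · simp
  have hadd : ∀ v w : Fin n → ZMod 2, v + w = 0 → v = w := fun v w h => by
    rw [← sub_eq_zero, sub_eq_add_neg, ZModModule.neg_eq_self, h]
  have hs : ∑ v, G v • v = v₀ + v₁ := by
    rw [← Finset.sum_subset (Finset.subset_univ {v₀, v₁}), Finset.sum_pair hne₁.symm, dec _ hv₀,
      dec _ hv₁, one_smul, one_smul]
    intro v _ hv
    by_contra hc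
    have hGv : G v ≠ 0 := fun h => hc (by rw [h, zero_smul])
    have hvv₀ : v ≠ v₀ := by rintro rfl; simp at hv
    refine hv ?_
    have := hN _ (hG v v₀ hGv hv₀) _ (hG v₁ v₀ hv₁ hv₀) (fun h => hvv₀ (hadd _ _ h))
      (fun h => hne₁ (hadd _ _ h))
    rw [add_right_cancel this]
    simp
  rw [hs] at h1
  exact hne₁ (hadd _ _ h1).symm

/-- At most one vertex of `σ` is missing from `τ`; a nonzero normal vector of `τ` must take the
value `1` on the edges leading to it. -/
theorem IsUnimodular.normal_line {σ τ : Simplex n} (h : IsUnimodular σ) (hτ : τ ⊆ σ)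
    (hc : n ≤ τ.card) (hn : 1 ≤ n) {v w : Fin n → ZMod 2} (hv : v ∈ normal τ) (hw : w ∈ normal τ)
    (hv0 : v ≠ 0) (hw0 : w ≠ 0) : v = w := by
  obtain ⟨a, ha⟩ : τ.Nonempty := Finset.card_pos.1 (by omega)
  rw [mem_normal] at hv hw
  have hcard : (σ \ τ).card ≤ 1 := by
    rw [Finset.card_sdiff_of_subset hτ, h.1]; omega
  have key : ∀ u : Fin n → ZMod 2, (∀ a ∈ τ, ∀ b ∈ τ, pairing (b - a) u = 0) → u ≠ 0 →
      ∀ b ∈ σ, b ∉ τ → pairing (b - a) u = 1 := by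
    intro u hu hu0 b hb hbτ
    have dec : ∀ x : ZMod 2, x ≠ 0 → x = 1 := by decide
    refine dec _ fun h0 => hu0 (h.eq_zero (hτ ha) fun c hcσ => ?_)
    by_cases hcτ : c ∈ τ
    · exact hu a ha c hcτ
    · rw [Finset.card_le_one.1 hcard c (Finset.mem_sdiff.2 ⟨hcσ, hcτ⟩) b
        (Finset.mem_sdiff.2 ⟨hb, hbτ⟩)]
      exact h0
  rw [← sub_eq_zero]
  refine h.eq_zero (hτ ha) fun b hb => ?_
  rw [map_sub]
  by_cases hbτ : b ∈ τ
  · rw [hv a ha b hbτ, hw a ha b hbτ, sub_zero]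
  · rw [key v hv hv0 b hb hbτ, key w hw hw0 b hb hbτ, sub_self]

theorem IsTri.peak_barycentre {P : Set (Fin n → ℝ)} {K : SComplex n} (h : IsTri P K)
    {σ : Simplex n} (hσ : σ ∈ K) : peak K (barycentre σ) = σ := by
  have hp := h.barycentre_mem hσ
  refine subset_antisymm ((peak_subset _ _).trans (h.supp_barycentre hσ).subset) fun a ha => ?_
  refine (h.mem_peak hp).2 fun b => ?_
  rw [h.coord_barycentre hσ, h.coord_barycentre hσ, if_pos ha]
  split_ifs
  · exact le_rfl
  · positivity

namespace IsLocal

variable {P : Set (Fin n → ℝ)} {K : SComplex n} {ε : (Fin n → ℤ) → ZMod 2}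
  {Ψ : (Fin n → ℝ) → (Fin n → ZMod 2) → ZMod 2} (hΨ : IsLocal P K ε Ψ) (h : IsTri P K)
include hΨ h

theorem eq_barycentre {p : Fin n → ℝ} (hp : p ∈ P) {σ : Simplex n} (hσ : σ ∈ K)
    (hs : supp K p ⊆ σ) {a b : Fin n → ℤ} {v : Fin n → ZMod 2} (ha : a ∈ peak K p)
    (hb : b ∈ peak K p) (hab : edgeSign ε a b v = 1) : Ψ p v = Ψ (barycentre σ) v := by
  have hpk := h.peak_barycentre hσ
  refine hΨ.eq_of_peak σ hσ p hp _ (h.barycentre_mem hσ) hs (h.supp_barycentre hσ).subset a b v ha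
    hb ?_ ?_ hab
  · rw [hpk]; exact hs (peak_subset _ _ ha)
  · rw [hpk]; exact hs (peak_subset _ _ hb)

theorem barycentre_eq_barycentre {τ σ : Simplex n} (hσ : σ ∈ K) (hτ : τ ⊆ σ)
    {a b : Fin n → ℤ} {v : Fin n → ZMod 2} (ha : a ∈ τ) (hb : b ∈ τ)
    (hab : edgeSign ε a b v = 1) : Ψ (barycentre τ) v = Ψ (barycentre σ) v := by
  have hτK := h.down_closed σ hσ τ hτ ⟨a, ha⟩
  refine hΨ.eq_barycentre h (h.barycentre_mem hτK) hσ ((h.supp_barycentre hτK).subset.trans hτ)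
    (a := a) (b := b) ?_ ?_ hab
  · rwa [h.peak_barycentre hτK]
  · rwa [h.peak_barycentre hτK]

theorem edgeSum_eq {σ : Simplex n} (hσ : σ ∈ K) {a b : Fin n → ℤ} (ha : a ∈ σ) (hb : b ∈ σ) :
    edgeSum ε Ψ a b = ∑ v, edgeSign ε a b v * Ψ (barycentre σ) v :=
  Finset.sum_congr rfl fun v _ => mul_eq_mul_of_eq_one fun h1 =>
    hΨ.barycentre_eq_barycentre h hσ (Finset.insert_subset ha (Finset.singleton_subset_iff.2 hb))
      (a := a) (b := b) (by simp) (by simp) h1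

/-- Local constancy moves all three sums to the barycentre of the triangle, where additivity of
`edgeSign` applies for each quadrant. -/
theorem edgeSum_add {a b c : Fin n → ℤ} (hσ : {a, b, c} ∈ K) :
    edgeSum ε Ψ a b + edgeSum ε Ψ b c = edgeSum ε Ψ a c := by
  rw [hΨ.edgeSum_eq h hσ (by simp) (by simp), hΨ.edgeSum_eq h hσ (by simp) (by simp),
    hΨ.edgeSum_eq h hσ (by simp) (by simp), ← Finset.sum_add_distrib]
  refine Finset.sum_congr rfl fun v _ => ?_
  rw [← add_mul, edgeSign_add]

-- Translation by a sedentary vector is an involution of the quadrants without fixed points; it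
-- preserves both factors of each term, so the terms cancel in pairs.
omit h in
theorem edgeSum_eq_zero_of_sed {a b : Fin n → ℤ} (hm : barycentre {a, b} ∈ P)
    {s : Fin n → ZMod 2} (hs : s ∈ sed P (barycentre {a, b})) (hab : pairing (b - a) s = 0)
    (hs0 : s ≠ 0) : edgeSum ε Ψ a b = 0 := by
  refine Finset.sum_involution (fun v _ => v + s) ?_ ?_ ?_ ?_
  · intro v _
    rw [edgeSign_add_right, hab, add_zero, hΨ.add_sed _ hm v s hs, CharTwo.add_self_eq_zero]
  · intro v _ _ he
    exact hs0 (by simpa using he)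
  · intro v _
    exact Finset.mem_univ _
  · intro v _
    rw [add_assoc, ZModModule.add_self, add_zero]

/-- The function of the quadrant given by `Ψ` at the barycentre of a maximal simplex, completed to
a function with vanishing sum. -/
noncomputable def _root_.THyp.completed (ε : (Fin n → ℤ) → ZMod 2)
    (Ψ : (Fin n → ℝ) → (Fin n → ZMod 2) → ZMod 2) (σ : Simplex n) (v : Fin n → ZMod 2) : ZMod 2 :=
  if v = monoQuadrant ε σ then ∑ u ∈ Finset.univ.erase v, Ψ (barycentre σ) u
  else Ψ (barycentre σ) v

-- The hypersurface has no point at the barycentre of `σ` in its monochromatic quadrant, so the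
-- value there is free and is chosen to make the total vanish.
omit h hΨ in
theorem _root_.THyp.sum_completed (σ : Simplex n) : ∑ v, completed ε Ψ σ v = 0 := by
  have h1 : ∑ v ∈ Finset.univ.erase (monoQuadrant ε σ), completed ε Ψ σ v =
      ∑ v ∈ Finset.univ.erase (monoQuadrant ε σ), Ψ (barycentre σ) v :=
    Finset.sum_congr rfl fun v hv => if_neg (Finset.mem_erase.1 hv).1
  rw [← Finset.add_sum_erase _ _ (Finset.mem_univ (monoQuadrant ε σ)), h1, completed, if_pos rfl,
    CharTwo.add_self_eq_zero]

omit h hΨ in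
theorem _root_.THyp.edgeSign_monoQuadrant {σ : Simplex n} (hU : IsUnimodular σ) {a b : Fin n → ℤ}
    (ha : a ∈ σ) (hb : b ∈ σ) (v : Fin n → ZMod 2) :
    edgeSign ε a b v = pairing (b - a) (v + monoQuadrant ε σ) := by
  rw [edgeSign, map_add, hU.monoQuadrant_spec ε ha hb]
  have dec : ∀ x y z : ZMod 2, x + y + z = z + (y - x) := by decide
  exact dec _ _ _

omit h hΨ in
theorem _root_.THyp.completed_eq {σ : Simplex n} (hU : IsUnimodular σ) {a b : Fin n → ℤ}
    (ha : a ∈ σ) (hb : b ∈ σ) {v : Fin n → ZMod 2} (hab : edgeSign ε a b v = 1) :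
    completed ε Ψ σ v = Ψ (barycentre σ) v := by
  refine if_neg ?_
  rintro rfl
  rw [edgeSign_monoQuadrant hU ha hb, ZModModule.add_self, map_zero] at hab
  exact zero_ne_one hab

/-- Paired with an edge of `σ`, the first moment is the edge sum plus a multiple of the total; both
vanish, and the edges of `σ` separate vectors. -/
theorem sum_completed_smul {σ : Simplex n} (hσ : σ ∈ K) (hU : IsUnimodular σ)
    (hq : ∀ a ∈ σ, ∀ b ∈ σ, edgeSum ε Ψ a b = 0) : ∑ v, completed ε Ψ σ v • v = 0 := by
  obtain ⟨a, ha⟩ := h.nonempty σ hσ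
  refine hU.eq_zero ha fun b hb => ?_
  have h1 := hq a ha b hb
  rw [hΨ.edgeSum_eq h hσ ha hb] at h1
  have h2 : ∑ v, edgeSign ε a b v * completed ε Ψ σ v = 0 := by
    rw [← h1]
    exact Finset.sum_congr rfl fun v _ => mul_eq_mul_of_eq_one fun h3 => completed_eq hU ha hb h3
  rw [map_sum]
  have h4 : ∀ v, pairing (b - a) (completed ε Ψ σ v • v) =
      edgeSign ε a b v * completed ε Ψ σ v + (ε a + ε b) * completed ε Ψ σ v := by
    intro v
    rw [map_smul, smul_eq_mul, edgeSign]
    have dec : ∀ c z e : ZMod 2, c * z = (e + z) * c + e * c := by decide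
    exact dec _ _ _
  rw [Finset.sum_congr rfl fun v _ => h4 v, Finset.sum_add_distrib, h2, ← Finset.mul_sum,
    sum_completed, mul_zero, add_zero]

omit h hΨ in
theorem _root_.THyp.add_mem_normal {σ τ : Simplex n} (hU : IsUnimodular σ) (hτ : τ ⊆ σ)
    {v w : Fin n → ZMod 2} (hv : ¬ ∃ a ∈ τ, ∃ b ∈ τ, edgeSign ε a b v = 1)
    (hw : ¬ ∃ a ∈ τ, ∃ b ∈ τ, edgeSign ε a b w = 1) : v + w ∈ normal τ := by
  have dec : ∀ x : ZMod 2, x ≠ 1 → x = 0 := by decide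
  rw [mem_normal]
  intro a ha b hb
  have h1 : edgeSign ε a b v = 0 := dec _ fun h => hv ⟨a, ha, b, hb, h⟩
  have h2 : edgeSign ε a b w = 0 := dec _ fun h => hw ⟨a, ha, b, hb, h⟩
  rw [edgeSign_monoQuadrant hU (hτ ha) (hτ hb)] at h1 h2
  have := congrArg₂ (· + ·) h1 h2
  beta_reduce at this
  rw [← map_add, add_zero, add_add_add_comm, ZModModule.add_self (monoQuadrant ε σ), add_zero] at this
  exact this

/-- In a quadrant where the common facet is not monochromatic, both functions have the value of `Ψ`
at the barycentre of the facet. The difference is carried by the other quadrants, a coset of the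
normal line, and its total and first moment vanish. -/
theorem completed_eq_of_adjacent {σ σ' : Simplex n} (hσ : σ ∈ K) (hσ' : σ' ∈ K)
    (hU : IsUnimodular σ) (hU' : IsUnimodular σ') (hc : (σ ∩ σ').card = n) (hn : 1 ≤ n)
    (hq : ∀ σ ∈ K, ∀ a ∈ σ, ∀ b ∈ σ, edgeSum ε Ψ a b = 0) :
    completed ε Ψ σ = completed ε Ψ σ' := by
  have dec : ∀ x y : ZMod 2, x + y = 0 → x = y := by decide
  have hnz : ∀ v, completed ε Ψ σ v + completed ε Ψ σ' v ≠ 0 →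
      ¬ ∃ a ∈ σ ∩ σ', ∃ b ∈ σ ∩ σ', edgeSign ε a b v = 1 := by
    rintro v hv ⟨a, ha, b, hb, hab⟩
    refine hv ?_
    rw [Finset.mem_inter] at ha hb
    rw [completed_eq hU ha.1 hb.1 hab, completed_eq hU' ha.2 hb.2 hab,
      ← hΨ.barycentre_eq_barycentre h hσ Finset.inter_subset_left (Finset.mem_inter.2 ha)
        (Finset.mem_inter.2 hb) hab,
      ← hΨ.barycentre_eq_barycentre h hσ' Finset.inter_subset_right (Finset.mem_inter.2 ha)
        (Finset.mem_inter.2 hb) hab, CharTwo.add_self_eq_zero]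
  have := eq_zero_of_moments (G := fun v => completed ε Ψ σ v + completed ε Ψ σ' v)
    (by rw [Finset.sum_add_distrib, sum_completed, sum_completed, add_zero])
    (by
      simp only [add_smul, Finset.sum_add_distrib]
      rw [hΨ.sum_completed_smul h hσ hU (hq σ hσ), hΨ.sum_completed_smul h hσ' hU' (hq σ' hσ'),
        add_zero])
    (normal (σ ∩ σ'))
    (fun v hv w hw hv0 hw0 =>
      hU.normal_line Finset.inter_subset_left hc.ge hn hv hw hv0 hw0)
    (fun v w hv hw => add_mem_normal hU Finset.inter_subset_left (hnz v hv) (hnz w hw))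
  funext v
  exact dec _ _ (congrFun this v)

/-- The argument for adjacent simplices applies, with the translate by a sedentary vector in the
role of the function on the other side of the facet. -/
theorem completed_add_sed {σ τ : Simplex n} (hσ : σ ∈ K) (hU : IsUnimodular σ) (hτ : τ ⊆ σ)
    (hc : n ≤ τ.card) (hn : 1 ≤ n) (hq : ∀ σ ∈ K, ∀ a ∈ σ, ∀ b ∈ σ, edgeSum ε Ψ a b = 0)
    {s : Fin n → ZMod 2} (hs : s ∈ sed P (barycentre τ)) (v : Fin n → ZMod 2) :
    completed ε Ψ σ (v + s) = completed ε Ψ σ v := by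
  have dec : ∀ x y : ZMod 2, x + y = 0 → y = x := by decide
  have hne : τ.Nonempty := Finset.card_pos.1 (by omega)
  have hτK := h.down_closed σ hσ τ hτ hne
  have hsp : ∀ a ∈ τ, ∀ b ∈ τ, pairing (b - a) s = 0 := fun a ha b hb =>
    h.pairing_eq_zero_of_mem_sed (h.barycentre_mem hτK)
      (by rwa [h.supp_barycentre hτK]) (by rwa [h.supp_barycentre hτK]) hs
  have hnz : ∀ v, completed ε Ψ σ v + completed ε Ψ σ (v + s) ≠ 0 →
      ¬ ∃ a ∈ τ, ∃ b ∈ τ, edgeSign ε a b v = 1 := by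
    rintro v hv ⟨a, ha, b, hb, hab⟩
    refine hv ?_
    have hab' : edgeSign ε a b (v + s) = 1 := by
      rw [edgeSign_add_right, hsp a ha b hb, add_zero, hab]
    rw [completed_eq hU (hτ ha) (hτ hb) hab, completed_eq hU (hτ ha) (hτ hb) hab',
      ← hΨ.barycentre_eq_barycentre h hσ hτ ha hb hab,
      ← hΨ.barycentre_eq_barycentre h hσ hτ ha hb hab',
      hΨ.add_sed _ (h.barycentre_mem hτK) v s hs, CharTwo.add_self_eq_zero]
  have hshift : ∑ v, completed ε Ψ σ (v + s) = 0 := by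
    rw [← sum_completed (ε := ε) (Ψ := Ψ) σ]
    exact Equiv.sum_comp (Equiv.addRight s) (completed ε Ψ σ)
  have hshift' : ∑ v, completed ε Ψ σ (v + s) • v = 0 := by
    have e1 : ∑ v, completed ε Ψ σ (v + s) • (v + s) = 0 := by
      rw [← hΨ.sum_completed_smul h hσ hU (hq σ hσ)]
      exact Equiv.sum_comp (Equiv.addRight s) fun v => completed ε Ψ σ v • v
    simpa only [smul_add, Finset.sum_add_distrib, ← Finset.sum_smul, hshift, zero_smul, add_zero]
      using e1
  have := eq_zero_of_moments (G := fun v => completed ε Ψ σ v + completed ε Ψ σ (v + s))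
    (by rw [Finset.sum_add_distrib, sum_completed, hshift, add_zero])
    (by
      simp only [add_smul, Finset.sum_add_distrib]
      rw [hΨ.sum_completed_smul h hσ hU (hq σ hσ), hshift', add_zero])
    (normal τ)
    (fun v hv w hw hv0 hw0 => hU.normal_line hτ hc hn hv hw hv0 hw0)
    (fun v w hv hw => add_mem_normal hU hτ (hnz v hv) (hnz w hw))
  exact dec _ _ (congrFun this v)

end IsLocal

end Local

/-! ### Locally constant functions on a T-hypersurface of the projective space -/

section Projective

variable {n d : ℕ}

/-- A vector of the sedentarity of the `i`-th facet of the standard simplex. -/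
def sedVector (i : Fin (n + 1)) : Fin n → ZMod 2 :=
  Fin.cases (fun _ => 1) (fun j => Pi.single j 1) i

theorem sedVector_ne_zero (hn : 1 ≤ n) (i : Fin (n + 1)) : sedVector i ≠ 0 := by
  induction i using Fin.cases with
  | zero =>
    intro h
    exact one_ne_zero (congrFun h ⟨0, hn⟩)
  | succ j =>
    intro h
    have := congrFun h j
    simp [sedVector] at this

/-- If `p` can move both ways along `a` inside the simplex while its `i`-th coordinate is zero, this
coordinate is stationary along `a`, and its differential modulo `2` is `sedVector i`. -/
theorem sedVector_mem_sed {p : Fin n → ℝ} {i : Fin (n + 1)} (hi : homCoord d p i = 0) :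
    sedVector i ∈ sed (sizedSimplex n d) p := by
  rw [sed, Submodule.mem_iInf]
  intro a
  rw [Submodule.mem_iInf]
  rintro ⟨t, ht, h1, h2⟩
  rw [mem_sizedSimplex] at h1 h2
  rw [LinearMap.mem_ker, pairing_apply]
  replace h1 := h1 i
  replace h2 := h2 i
  induction i using Fin.cases with
  | zero =>
    rw [homCoord_zero] at hi h1 h2
    simp only [Pi.add_apply, Pi.sub_apply, Pi.smul_apply, smul_eq_mul, Finset.sum_add_distrib,
      Finset.sum_sub_distrib, ← Finset.mul_sum, toReal] at h1 h2
    have h3 : t * ∑ j, (a j : ℝ) = 0 := by linarith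
    have h4 : ∑ j, a j = 0 := by
      rcases mul_eq_zero.1 h3 with h3 | h3
      · linarith
      · exact_mod_cast h3
    simp only [sedVector, Fin.cases_zero, mul_one]
    rw [← Int.cast_sum, h4, Int.cast_zero]
  | succ j =>
    rw [homCoord_succ] at hi h1 h2
    simp only [Pi.add_apply, Pi.sub_apply, Pi.smul_apply, smul_eq_mul, toReal, hi] at h1 h2
    have h3 : t * (a j : ℝ) = 0 := by linarith
    have h4 : a j = 0 := by
      rcases mul_eq_zero.1 h3 with h3 | h3
      · linarith
      · exact_mod_cast h3
    rw [Finset.sum_eq_single j]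
    · rw [h4, Int.cast_zero, zero_mul]
    · intro k _ hk
      simp [sedVector, Pi.single_eq_of_ne hk]
    · simp

theorem eq_of_add_single {α : Type*} (F : (Fin n → ZMod 2) → α)
    (hF : ∀ (j : Fin n) v, F (v + Pi.single j 1) = F v) (v : Fin n → ZMod 2) : F v = F 0 := by
  have key : ∀ s : Finset (Fin n), ∀ v, F (v + ∑ j ∈ s, Pi.single j 1) = F v := by
    intro s
    induction s using Finset.induction_on with
    | empty => intro v; simp
    | insert j s hj ih =>
      intro v
      rw [Finset.sum_insert hj, ← add_assoc, ih, hF]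
  have hv : v = ∑ j ∈ Finset.univ.filter fun j => v j = 1, Pi.single j 1 := by
    have dec : ∀ x : ZMod 2, x ≠ 1 → x = 0 := by decide
    funext i
    rw [Finset.sum_apply]
    by_cases hi : v i = 1
    · rw [Finset.sum_eq_single i]
      · simp [hi]
      · intro j _ hj
        rw [Pi.single_eq_of_ne hj.symm]
      · intro hi'
        simp [hi] at hi'
    · rw [dec _ hi, Finset.sum_eq_zero]
      intro j hj
      rw [Pi.single_eq_of_ne]
      rintro rfl
      exact hi (Finset.mem_filter.1 hj).2
  have := key (Finset.univ.filter fun j => v j = 1) 0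
  rw [zero_add, ← hv] at this
  exact this

theorem homCoord_barycentre_eq_zero {σ : Simplex n} (hσ : σ.Nonempty) {i : Fin (n + 1)}
    (hi : ∀ a ∈ σ, homCoord d a i = 0) : homCoord d (barycentre σ) i = 0 := by
  rw [IsTri.barycentre_eq, homCoord_sum _ _ _ _ (IsTri.barycentre_weights hσ).2.2]
  refine Finset.sum_eq_zero fun a ha => ?_
  rw [homCoord_toReal, hi a ha, Int.cast_zero, mul_zero]

/-- A locally constant function whose sum along every edge vanishes is constant. -/
theorem IsLocal.constant (hn : 1 ≤ n) (hd : 1 ≤ d) {K : SComplex n}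
    (h : IsTri (sizedSimplex n d) K) (hK : ∀ σ ∈ K, σ.card = n + 1 → IsUnimodular σ)
    (hvert : ∀ x : Fin n → ℤ, (∀ k, 0 ≤ homCoord d x k) → {x} ∈ K)
    {ε : (Fin n → ℤ) → ZMod 2} {Ψ : (Fin n → ℝ) → (Fin n → ZMod 2) → ZMod 2}
    (hΨ : IsLocal (sizedSimplex n d) K ε Ψ)
    (hq : ∀ σ ∈ K, ∀ a ∈ σ, ∀ b ∈ σ, edgeSum ε Ψ a b = 0) :
    ∃ c, ∀ p ∈ sizedSimplex n d, ∀ v, (∃ a ∈ peak K p, ∃ b ∈ peak K p, edgeSign ε a b v = 1) →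
      Ψ p v = c := by
  have hconn : ∀ {σ σ' : Simplex n}, σ ∈ K → σ' ∈ K → σ.card = n + 1 → σ'.card = n + 1 →
      completed ε Ψ σ' = completed ε Ψ σ := fun {σ σ'} hσ hσ' hc hc' =>
    h.topSimplex_connected hd (completed ε Ψ)
      (fun σ hσ σ' hσ' hc hc' hcc =>
        hΨ.completed_eq_of_adjacent h hσ hσ' (hK σ hσ hc) (hK σ' hσ' hc') hcc hn hq) hσ hσ' hc hc'
  have h0 : ∀ i : Fin (n + 1), ∃ x : Fin n → ℤ, (∀ k, 0 ≤ homCoord d x k) ∧ homCoord d x i = 0 := by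
    intro i
    obtain ⟨j, hj⟩ : ∃ j, j ≠ i := by
      have : Nontrivial (Fin (n + 1)) := Fin.nontrivial_iff_two_le.2 (by omega)
      exact exists_ne i
    have hp := isPoint_single d j
    have e := homCoord_tail (d := d) (X := (Pi.single j (d : ℤ) : Fin (n + 1) → ℤ))
      (by exact_mod_cast hp.2)
    exact ⟨_, fun k => by rw [e]; exact hp.1 k, by rw [e, Pi.single_eq_of_ne hj.symm]⟩
  obtain ⟨x₀, hx₀, -⟩ := h0 0
  obtain ⟨σ₀, hσ₀, -, hc₀⟩ := h.pure hd (hvert x₀ hx₀)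
  -- A top simplex with a facet in the face `x_j = 0` gives the invariance under the `j`-th unit
  -- vector; independence of the simplex carries it to `σ₀`.
  have hinv : ∀ (j : Fin n) v, completed ε Ψ σ₀ (v + Pi.single j 1) = completed ε Ψ σ₀ v := by
    intro j v
    obtain ⟨x, hx, hxj⟩ := h0 j.succ
    have hJ : (Finset.univ.erase j.succ : Finset (Fin (n + 1))).card = n := by
      rw [Finset.card_erase_of_mem (Finset.mem_univ _), Finset.card_univ, Fintype.card_fin]
      rfl
    have hmem : ∀ k, k ∉ (Finset.univ.erase j.succ : Finset (Fin (n + 1))) → k = j.succ := by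
      intro k hk
      by_contra hne
      exact hk (Finset.mem_erase.2 ⟨hne, Finset.mem_univ _⟩)
    obtain ⟨τ, hτ, -, hτj, hτc⟩ := h.exists_extension hd (Finset.univ.erase j.succ) n {x}
      (hvert x hx) (fun a ha k hk => by
        rw [Finset.mem_singleton.1 ha, hmem k hk, hxj]) (by omega)
    rw [hJ] at hτc
    obtain ⟨σ, hσ, hτσ, hc⟩ := h.pure hd hτ
    rw [hconn hσ hσ₀ hc hc₀]
    refine hΨ.completed_add_sed h hσ (hK σ hσ hc) hτσ hτc hn hq ?_ v
    exact sedVector_mem_sed (i := j.succ) (homCoord_barycentre_eq_zero (h.nonempty τ hτ)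
      fun a ha => hτj a ha _ (by simp))
  refine ⟨completed ε Ψ σ₀ 0, fun p hp v => ?_⟩
  rintro ⟨a, ha, b, hb, hab⟩
  obtain ⟨σ, hσ, hs, hc⟩ := h.pure hd (h.supp_mem hp)
  rw [hΨ.eq_barycentre h hp hσ hs ha hb hab, ← completed_eq (Ψ := Ψ) (hK σ hσ hc)
    (hs (peak_subset _ _ ha)) (hs (peak_subset _ _ hb)) hab, hconn hσ₀ hσ hc₀ hc]
  exact eq_of_add_single _ hinv v

end Projective

/-! ### Functions constant on the connected subsets of a T-hypersurface -/

section Components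

open Topology Filter

variable {n : ℕ}

/-- `Φ` is constant on the preconnected subsets of `X`. -/
def ConstOnPreconnected {Y : Type*} [TopologicalSpace Y] (X : Set Y) (Φ : Y → ZMod 2) : Prop :=
  ∀ T ⊆ X, IsPreconnected T → ∀ p ∈ T, ∀ q ∈ T, Φ p = Φ q

open scoped Classical in
theorem constOnPreconnected_component {Y : Type*} [TopologicalSpace Y] {X S : Set Y}
    (h : IsComponentOf X S) : ConstOnPreconnected X fun q => if q ∈ S then 1 else 0 := by
  obtain ⟨q₀, -, rfl⟩ := h
  intro T hT hc p hp q hq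
  have key : ∀ p ∈ T, ∀ q ∈ T, p ∈ connectedComponentIn X q₀ → q ∈ connectedComponentIn X q₀ := by
    intro p hp q hq h
    rw [connectedComponentIn_eq h]
    exact hc.subset_connectedComponentIn hp hT hq
  have : p ∈ connectedComponentIn X q₀ ↔ q ∈ connectedComponentIn X q₀ :=
    ⟨key p hp q hq, key q hq p hp⟩
  simp only [this]

open scoped Classical in
/-- A function on the real locus, as a function of a point of the polytope and of a quadrant. -/
noncomputable def pullback {P : Set (Fin n → ℝ)} (Φ : RealLocus P → ZMod 2) (p : Fin n → ℝ)
    (v : Fin n → ZMod 2) : ZMod 2 :=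
  if hp : p ∈ P then Φ (RealLocus.mk ⟨p, hp⟩ v) else 0

theorem pullback_apply {P : Set (Fin n → ℝ)} (Φ : RealLocus P → ZMod 2) {p : Fin n → ℝ}
    (hp : p ∈ P) (v : Fin n → ZMod 2) : pullback Φ p v = Φ (RealLocus.mk ⟨p, hp⟩ v) :=
  dif_pos hp

/-- Vertices that are maximal at both ends of a segment inside a simplex are maximal all along it,
so the segment stays on the hypersurface in the given quadrant. -/
theorem IsTri.isLocal_pullback {P : Set (Fin n → ℝ)} {K : SComplex n} (h : IsTri P K)
    {ε : (Fin n → ℤ) → ZMod 2} {Φ : RealLocus P → ZMod 2}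
    (hΦ : ConstOnPreconnected (tHypersurface P K ε) Φ) : IsLocal P K ε (pullback Φ) := by
  constructor
  · intro σ hσ p hp q hq hps hqs a b v hap hbp haq hbq hab
    rw [pullback_apply Φ hp, pullback_apply Φ hq]
    have hseg : segment ℝ p q ⊆ P := h.convex.segment_subset hp hq
    have hpre : IsPreconnected (Subtype.val ⁻¹' segment ℝ p q : Set P) := by
      rw [← Topology.IsInducing.subtypeVal.isPreconnected_image, Subtype.image_preimage_coe,
        Set.inter_eq_right.2 hseg]
      exact (convex_segment p q).isPreconnected
    refine hΦ ((fun z : P => RealLocus.mk z v) '' (Subtype.val ⁻¹' segment ℝ p q)) ?_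
      (hpre.image _ (RealLocus.continuous_mk v).continuousOn) _
      ⟨⟨p, hp⟩, left_mem_segment ℝ p q, rfl⟩ _ ⟨⟨q, hq⟩, right_mem_segment ℝ p q, rfl⟩
    rintro _ ⟨z, ⟨s, t, hs, ht, hst, hz⟩, rfl⟩
    have hmem : ∀ c, c ∈ peak K p → c ∈ peak K q → c ∈ peak K z.1 := by
      intro c hcp hcq
      rw [h.mem_peak z.2]
      rw [h.mem_peak hp] at hcp
      rw [h.mem_peak hq] at hcq
      rw [← hz, h.coord_combo hp hq hσ hps hqs hs ht hst]
      intro e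
      simp only [Pi.add_apply, Pi.smul_apply, smul_eq_mul]
      exact add_le_add (mul_le_mul_of_nonneg_left (hcp e) hs)
        (mul_le_mul_of_nonneg_left (hcq e) ht)
    exact (h.mk_mem_tHypersurface z v).2 ⟨a, hmem a hap haq, b, hmem b hbp hbq, hab⟩
  · intro p hp v s hs
    rw [pullback_apply Φ hp, pullback_apply Φ hp]
    congr 1
    exact RealLocus.mk_eq_mk.2 ⟨rfl, by rwa [add_sub_cancel_left]⟩

theorem IsLocal.add_sum {P : Set (Fin n → ℝ)} {K : SComplex n} {ε : (Fin n → ℤ) → ZMod 2}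
    {ι : Type*} [Fintype ι] {Ψ : (Fin n → ℝ) → (Fin n → ZMod 2) → ZMod 2}
    {Ψ' : ι → (Fin n → ℝ) → (Fin n → ZMod 2) → ZMod 2} (hΨ : IsLocal P K ε Ψ)
    (hΨ' : ∀ i, IsLocal P K ε (Ψ' i)) (g : ι → ZMod 2) :
    IsLocal P K ε fun p v => Ψ p v + ∑ i, g i * Ψ' i p v := by
  constructor
  · intro σ hσ p hp q hq hps hqs a b v hap hbp haq hbq hab
    rw [hΨ.eq_of_peak σ hσ p hp q hq hps hqs a b v hap hbp haq hbq hab]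
    congr 1
    refine Finset.sum_congr rfl fun i _ => ?_
    rw [(hΨ' i).eq_of_peak σ hσ p hp q hq hps hqs a b v hap hbp haq hbq hab]
  · intro p hp v s hs
    rw [hΨ.add_sed p hp v s hs]
    congr 1
    refine Finset.sum_congr rfl fun i _ => ?_
    rw [(hΨ' i).add_sed p hp v s hs]

theorem edgeSum_add_sum {ε : (Fin n → ℤ) → ZMod 2}
    {ι : Type*} [Fintype ι] (Ψ : (Fin n → ℝ) → (Fin n → ZMod 2) → ZMod 2)
    (Ψ' : ι → (Fin n → ℝ) → (Fin n → ZMod 2) → ZMod 2) (g : ι → ZMod 2) (a b : Fin n → ℤ) :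
    edgeSum ε (fun p v => Ψ p v + ∑ i, g i * Ψ' i p v) a b =
      edgeSum ε Ψ a b + ∑ i, g i * edgeSum ε (Ψ' i) a b := by
  simp only [edgeSum, mul_add, Finset.sum_add_distrib, Finset.mul_sum]
  congr 1
  rw [Finset.sum_comm]
  refine Finset.sum_congr rfl fun i _ => Finset.sum_congr rfl fun v _ => ?_
  ring

open scoped Classical in
/-- The edge sums of the indicator function of the sphere around an isolated vertex. -/
theorem IsTri.edgeSum_rim {P : Set (Fin n → ℝ)} {K : SComplex n} (h : IsTri P K)
    {ε : (Fin n → ℤ) → ZMod 2} {x : Fin n → ℤ} {u : Fin n → ZMod 2} (hu : Isolated K ε x u)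
    (hsed : ∀ p : P, 0 < coord K p.1 x → sed P p = ⊥) {σ : Simplex n} (hσ : σ ∈ K)
    {a b : Fin n → ℤ} (ha : a ∈ σ) (hb : b ∈ σ) :
    edgeSum ε (pullback fun q => if q ∈ overQuadrant (rim P K x) u then 1 else 0) a b =
      (if x = a then 1 else 0) + if x = b then 1 else 0 := by
  by_cases hab : a = b
  · subst hab
    rw [CharTwo.add_self_eq_zero]
    exact Finset.sum_eq_zero fun v _ => by rw [edgeSign_self, zero_mul]
  have hτ : {a, b} ∈ K := h.down_closed σ hσ _
    (Finset.insert_subset ha (Finset.singleton_subset_iff.2 hb)) ⟨a, by simp⟩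
  have hm := h.barycentre_mem hτ
  have hrim : (⟨barycentre {a, b}, hm⟩ : P) ∈ rim P K x ↔ x = a ∨ x = b := by
    change x ∈ peak K (barycentre {a, b}) ∧ (∃ c ∈ peak K (barycentre {a, b}), c ≠ x) ↔ _
    rw [h.peak_barycentre hτ]
    simp only [Finset.mem_insert, Finset.mem_singleton]
    refine ⟨And.left, fun hx => ⟨hx, ?_⟩⟩
    rcases hx with rfl | rfl
    · exact ⟨b, Or.inr rfl, fun e => hab e.symm⟩
    · exact ⟨a, Or.inl rfl, hab⟩
  have hval : ∀ v, pullback (fun q => if q ∈ overQuadrant (rim P K x) u then (1 : ZMod 2) else 0)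
      (barycentre {a, b}) v = if (x = a ∨ x = b) ∧ v = u then 1 else 0 := by
    intro v
    rw [pullback_apply _ hm]
    have := mk_mem_overQuadrant (A := rim P K x) (v := u) (w := v) (p := ⟨barycentre {a, b}, hm⟩)
      fun p hp => hsed p (h.coord_pos_of_mem_peak p.2 hp.1)
    rw [hrim] at this
    simp only [this]
  have hsum : ∀ v, edgeSign ε a b v * (if (x = a ∨ x = b) ∧ v = u then 1 else 0) =
      if v = u then (if x = a ∨ x = b then edgeSign ε a b u else 0) else 0 := by
    intro v
    by_cases hv : v = u
    · subst hv
      by_cases hx : x = a ∨ x = b <;> simp [hx]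
    · simp [hv]
  simp only [edgeSum, hval, hsum, Finset.sum_ite_eq', Finset.mem_univ, if_true]
  by_cases hxa : x = a
  · subst hxa
    rw [if_pos (Or.inl rfl), if_pos rfl, if_neg hab, add_zero]
    exact hu σ hσ ha b hb fun e => hab e.symm
  by_cases hxb : x = b
  · subst hxb
    rw [if_pos (Or.inr rfl), if_pos rfl, if_neg hxa, zero_add, edgeSign_symm]
    exact hu σ hσ hb a ha hab
  · rw [if_neg (by tauto), if_neg hxa, if_neg hxb, add_zero]

end Components

/-! ### The components of the projective T-hypersurface -/

section Main

open Topology Filter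

variable {n d : ℕ}

theorem continuous_homCoord (d : ℕ) (k : Fin (n + 1)) :
    Continuous fun p : Fin n → ℝ => homCoord d p k := by
  induction k using Fin.cases with
  | zero => simp only [homCoord_zero]; fun_prop
  | succ j => simp only [homCoord_succ]; fun_prop

theorem eventually_add_smul_mem {P : Set (Fin n → ℝ)} {p : Fin n → ℝ} (hp : p ∈ interior P)
    (u : Fin n → ℝ) : ∀ᶠ t in 𝓝[>] (0 : ℝ), p + t • u ∈ P := by
  have h0 : Tendsto (fun t : ℝ => p + t • u) (𝓝 0) (𝓝 p) := by
    have hc : Continuous fun t : ℝ => p + t • u := by fun_prop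
    simpa using hc.tendsto 0
  exact (h0.eventually (eventually_mem_set.2 (mem_interior_iff_mem_nhds.1 hp))).filter_mono
    nhdsWithin_le_nhds

theorem sed_eq_bot {P : Set (Fin n → ℝ)} {p : Fin n → ℝ} (hp : p ∈ interior P) : sed P p = ⊥ := by
  rw [Submodule.eq_bot_iff]
  intro v hv
  have key : ∀ a, pairing a v = 0 := by
    intro a
    have h1 := eventually_add_smul_mem hp (toReal a)
    have h2 := eventually_add_smul_mem hp (-toReal a)
    obtain ⟨t, ⟨ht1, ht2⟩, ht0⟩ := ((h1.and h2).and self_mem_nhdsWithin).exists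
    have := (Submodule.mem_iInf _).1 hv a
    refine (Submodule.mem_iInf _).1 this ⟨t, ht0, ht1, ?_⟩
    rwa [smul_neg, ← sub_eq_add_neg] at ht2
  funext j
  have := key (Pi.single j 1)
  rw [pairing_apply, Finset.sum_eq_single j] at this
  · simpa using this
  · intro k _ hk
    rw [Pi.single_eq_of_ne hk, Int.cast_zero, zero_mul]
  · simp

theorem mem_interior_sizedSimplex (hn : 1 ≤ n) {p : Fin n → ℝ} :
    p ∈ interior (sizedSimplex n d) ↔ ∀ k, 0 < homCoord d p k := by
  constructor
  · intro hp k
    refine lt_of_le_of_ne (mem_sizedSimplex.1 (interior_subset hp) k) fun hk => ?_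
    induction k using Fin.cases with
    | zero =>
      obtain ⟨t, ht, ht0⟩ := ((eventually_add_smul_mem hp (Pi.single ⟨0, hn⟩ 1)).and
        self_mem_nhdsWithin).exists
      have := mem_sizedSimplex.1 ht 0
      rw [homCoord_zero] at this hk
      have hs : ∑ j, (Pi.single ⟨0, hn⟩ 1 : Fin n → ℝ) j = 1 := by simp
      simp only [Pi.add_apply, Pi.smul_apply, Finset.sum_add_distrib, smul_eq_mul,
        ← Finset.mul_sum, hs] at this
      have ht0' : 0 < t := ht0
      linarith
    | succ j =>
      obtain ⟨t, ht, ht0⟩ := ((eventually_add_smul_mem hp (-Pi.single j 1)).and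
        self_mem_nhdsWithin).exists
      have := mem_sizedSimplex.1 ht j.succ
      rw [homCoord_succ] at this hk
      simp only [Pi.add_apply, Pi.smul_apply, Pi.neg_apply, Pi.single_eq_same, smul_eq_mul] at this
      have ht0' : 0 < t := ht0
      linarith
  · intro h
    refine mem_interior.2 ⟨⋂ k, {p | 0 < homCoord d p k}, ?_, ?_, ?_⟩
    · intro q hq
      exact mem_sizedSimplex.2 fun k => le_of_lt (Set.mem_iInter.1 hq k)
    · exact isOpen_iInter_of_finite fun k => isOpen_lt continuous_const (continuous_homCoord d k)
    · exact Set.mem_iInter.2 h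

theorem toReal_mem_interior (hn : 1 ≤ n) {x : Fin n → ℤ} :
    toReal x ∈ interior (sizedSimplex n d) ↔ ∀ k, 0 < homCoord d x k := by
  rw [mem_interior_sizedSimplex hn]
  simp only [homCoord_toReal, Int.cast_pos]

theorem IsTri.mem_interior_of_coord_pos (hn : 1 ≤ n) {K : SComplex n}
    (h : IsTri (sizedSimplex n d) K) {x : Fin n → ℤ} (hx : toReal x ∈ interior (sizedSimplex n d))
    {p : Fin n → ℝ} (hp : p ∈ sizedSimplex n d) (hpx : 0 < coord K p x) :
    p ∈ interior (sizedSimplex n d) := by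
  rw [mem_interior_sizedSimplex hn]
  intro k
  refine lt_of_le_of_ne (mem_sizedSimplex.1 hp k) fun hk => ?_
  have h1 := (h.homCoord_eq_zero_iff hp k).1 hk.symm x ((h.mem_supp hp).2 hpx)
  have h2 := (toReal_mem_interior hn).1 hx k
  omega

theorem singleton_mem_itenbergViro (hn : 1 ≤ n) (hd : 1 ≤ d) {x : Fin n → ℤ}
    (hx : ∀ k, 0 ≤ homCoord d x k) : {x} ∈ itenbergViro n d := by
  rw [mem_itenbergViro n d hn hd]
  refine ⟨Finset.singleton_nonempty x, fun y hy => ?_, fun y hy z hz => ?_⟩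
  · rw [Finset.mem_singleton.1 hy]; exact hx
  · rw [Finset.mem_singleton.1 hy, Finset.mem_singleton.1 hz]; exact Compat.refl _

/-- The edge sums of a locally constant function are the coboundary of a function vanishing on the
boundary. -/
theorem exists_edgeSum_primitive (hn : 2 ≤ n) (hd : 1 ≤ d) {ε : (Fin n → ℤ) → ZMod 2}
    {Ψ : (Fin n → ℝ) → (Fin n → ZMod 2) → ZMod 2}
    (hΨ : IsLocal (sizedSimplex n d) (itenbergViro n d) ε Ψ) :
    ∃ g : (Fin n → ℤ) → ZMod 2, (∀ σ ∈ itenbergViro n d, ∀ a ∈ σ, ∀ b ∈ σ,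
      edgeSum ε Ψ a b = g a + g b) ∧
      ∀ a i, (∀ k, 0 ≤ homCoord d a k) → homCoord d a i = 0 → g a = 0 := by
  have hn1 : 1 ≤ n := by omega
  have h := itenbergViro_isTri hn1 hd
  let tail : (Fin (n + 1) → ℤ) → Fin n → ℤ := fun A i => A i.succ
  have htail : ∀ A : Fin (n + 1) → ℤ, IsPoint d A → homCoord d (tail A) = A := fun A hA =>
    homCoord_tail (by exact_mod_cast hA.2)
  have hhom : ∀ a : Fin n → ℤ, tail (homCoord d a) = a := fun a => rfl
  have hpt : ∀ a : Fin n → ℤ, (∀ k, 0 ≤ homCoord d a k) → IsPoint d (homCoord d a) := fun a ha =>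
    ⟨ha, by rw [sum_homCoord]⟩
  obtain ⟨g, hg⟩ := exists_primitive (n + 1) d (fun A B => edgeSum ε Ψ (tail A) (tail B)) (by
    intro A B C hA hB hC hAB hBC hAC
    refine hΨ.edgeSum_add h ((mem_itenbergViro n d hn1 hd _).2 ⟨⟨tail A, by simp⟩, ?_, ?_⟩)
    · intro x hx
      simp only [Finset.mem_insert, Finset.mem_singleton] at hx
      rcases hx with rfl | rfl | rfl
      · rw [htail A hA]; exact hA.1
      · rw [htail B hB]; exact hB.1
      · rw [htail C hC]; exact hC.1
    · intro x hx y hy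
      simp only [Finset.mem_insert, Finset.mem_singleton] at hx hy
      rcases hx with rfl | rfl | rfl <;> rcases hy with rfl | rfl | rfl <;>
        simp only [htail A hA, htail B hB, htail C hC]
      exacts [Compat.refl _, hAB, hAC, hAB.symm, Compat.refl _, hBC, hAC.symm, hBC.symm,
        Compat.refl _])
  -- Edge sums vanish inside each facet of the polytope, so `g` is constant on the facet by
  -- connectedness of its graph.
  have hface : ∀ i A B, IsPoint d A → IsPoint d B → A i = 0 → B i = 0 → g A = g B := by
    intro i A B hA hB hAi hBi
    have hJ : ∀ A : Fin (n + 1) → ℤ, A i = 0 →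
        ∀ j ∉ (Finset.univ.erase i : Finset (Fin (n + 1))), A j = 0 := by
      intro A hAi j hj
      obtain rfl : j = i := by
        by_contra hne
        exact hj (Finset.mem_erase.2 ⟨hne, Finset.mem_univ _⟩)
      exact hAi
    refine face_connected d (Finset.univ.erase i) g ?_ A B hA hB (hJ A hAi) (hJ B hBi)
    intro A B hA hB hAJ hBJ hAB
    have hAi := hAJ i (by simp)
    have hBi := hBJ i (by simp)
    have dec : ∀ x y : ZMod 2, 0 = x + y → x = y := by decide
    refine dec _ _ (Eq.trans ?_ (hg A B hA hB hAB))
    have hτ : {tail A, tail B} ∈ itenbergViro n d := by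
      refine (mem_itenbergViro n d hn1 hd _).2 ⟨⟨tail A, by simp⟩, ?_, ?_⟩
      · intro x hx
        simp only [Finset.mem_insert, Finset.mem_singleton] at hx
        rcases hx with rfl | rfl
        · rw [htail A hA]; exact hA.1
        · rw [htail B hB]; exact hB.1
      · intro x hx y hy
        simp only [Finset.mem_insert, Finset.mem_singleton] at hx hy
        rcases hx with rfl | rfl <;> rcases hy with rfl | rfl <;>
          simp only [htail A hA, htail B hB]
        exacts [Compat.refl _, hAB, hAB.symm, Compat.refl _]
    have hm := h.barycentre_mem hτ
    have hs : sedVector i ∈ sed (sizedSimplex n d) (barycentre {tail A, tail B}) := by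
      refine sedVector_mem_sed (homCoord_barycentre_eq_zero ⟨tail A, by simp⟩ fun x hx => ?_)
      simp only [Finset.mem_insert, Finset.mem_singleton] at hx
      rcases hx with rfl | rfl
      · rw [htail A hA, hAi]
      · rw [htail B hB, hBi]
    refine (hΨ.edgeSum_eq_zero_of_sed hm hs ?_ (sedVector_ne_zero hn1 i)).symm
    refine h.pairing_eq_zero_of_mem_sed hm ?_ ?_ hs <;> rw [h.supp_barycentre hτ] <;> simp
  -- Every facet except the facet `0` contains the vertex `0`. The facet `0` is linked to it through
  -- the vertex `1`, which lies with the vertex `0` in the facet `2`; here `n ≥ 2` is needed.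
  have hbdry : ∀ i A, IsPoint d A → A i = 0 → g A = g (Pi.single 0 (d : ℤ)) := by
    have hne : ∀ i j : Fin (n + 1), i ≠ j → (Pi.single i (d : ℤ) : Fin (n + 1) → ℤ) j = 0 :=
      fun i j hij => Pi.single_eq_of_ne hij.symm _
    intro i A hA hAi
    by_cases hi : i = 0
    · subst hi
      rw [hface 0 A (Pi.single ⟨1, by omega⟩ (d : ℤ)) hA (isPoint_single d _) hAi
        (hne _ _ (by simp [Fin.ext_iff]))]
      exact hface ⟨2, by omega⟩ _ _ (isPoint_single d _) (isPoint_single d _)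
        (hne _ _ (by simp)) (hne _ _ (by simp [Fin.ext_iff]))
    · exact hface i _ _ hA (isPoint_single d _) hAi (hne _ _ (Ne.symm hi))
  refine ⟨fun a => g (homCoord d a) + g (Pi.single 0 (d : ℤ)), ?_, ?_⟩
  · intro σ hσ a ha b hb
    obtain ⟨-, h1, h2⟩ := (mem_itenbergViro n d hn1 hd σ).1 hσ
    have := hg _ _ (hpt a (h1 a ha)) (hpt b (h1 b hb)) (h2 a ha b hb)
    rw [hhom, hhom] at this
    rw [this]
    have dec : ∀ x y c : ZMod 2, x + y = x + c + (y + c) := by decide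
    exact dec _ _ _
  · intro a i ha hi
    beta_reduce
    rw [hbdry i _ (hpt a ha) hi, CharTwo.add_self_eq_zero]

/-- The lattice points in the interior of the standard simplex. -/
abbrev InteriorPoint (n d : ℕ) := {x : Fin n → ℤ // toReal x ∈ interior (sizedSimplex n d)}

theorem singleton_mem_of_interior (hn : 1 ≤ n) (hd : 1 ≤ d) (x : InteriorPoint n d) :
    {x.1} ∈ itenbergViro n d :=
  singleton_mem_itenbergViro hn hd fun k => ((toReal_mem_interior hn).1 x.2 k).le

theorem finite_interiorPoint (hn : 1 ≤ n) (hd : 1 ≤ d) : Finite (InteriorPoint n d) :=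
  Set.Finite.subset (verts (itenbergViro n d)).finite_toSet fun _ hx =>
    subset_verts (singleton_mem_of_interior hn hd ⟨_, hx⟩) (Finset.mem_singleton_self _)

theorem sed_eq_bot_of_coord_pos (hn : 1 ≤ n) (hd : 1 ≤ d) (x : InteriorPoint n d)
    (p : sizedSimplex n d) (hp : 0 < coord (itenbergViro n d) p.1 x.1) :
    sed (sizedSimplex n d) p = ⊥ :=
  sed_eq_bot ((itenbergViro_isTri hn hd).mem_interior_of_coord_pos hn x.2 p.2 hp)

/-- A locally constant function on the T-hypersurface is constant away from the spheres around the
interior vertices. -/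
theorem constant_off_spheres (hn : 2 ≤ n) (hd : 1 ≤ d) {ε : (Fin n → ℤ) → ZMod 2}
    {u : InteriorPoint n d → Fin n → ZMod 2}
    (hu : ∀ x, Isolated (itenbergViro n d) ε x.1 (u x))
    {Φ : RealLocus (sizedSimplex n d) → ZMod 2}
    (hΦ : ConstOnPreconnected (tHypersurface (sizedSimplex n d) (itenbergViro n d) ε) Φ) :
    ∃ c, ∀ q ∈ tHypersurface (sizedSimplex n d) (itenbergViro n d) ε,
      (∀ x : InteriorPoint n d,
        q ∉ overQuadrant (rim (sizedSimplex n d) (itenbergViro n d) x.1) (u x)) → Φ q = c := by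
  classical
  have hn1 : 1 ≤ n := by omega
  have h := itenbergViro_isTri hn1 hd
  have := finite_interiorPoint hn1 hd
  let := Fintype.ofFinite (InteriorPoint n d)
  have hΨ := h.isLocal_pullback hΦ
  obtain ⟨g, hg, hg0⟩ := exists_edgeSum_primitive hn hd hΨ
  let ind : InteriorPoint n d → RealLocus (sizedSimplex n d) → ZMod 2 := fun x q =>
    if q ∈ overQuadrant (rim (sizedSimplex n d) (itenbergViro n d) x.1) (u x) then 1 else 0
  have hind : ∀ x, IsLocal (sizedSimplex n d) (itenbergViro n d) ε (pullback (ind x)) := fun x =>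
    h.isLocal_pullback (constOnPreconnected_component (h.isComponentOf_rim hn
      (singleton_mem_of_interior hn1 hd x) x.2 (hu x) (sed_eq_bot_of_coord_pos hn1 hd x)))
  -- The sum over interior points recovers `g` also at boundary vertices, because `g` vanishes
  -- there.
  have hdelta : ∀ σ ∈ itenbergViro n d, ∀ a ∈ σ,
      ∑ x : InteriorPoint n d, g x.1 * (if x.1 = a then 1 else 0) = g a := by
    intro σ hσ a ha
    by_cases hai : toReal a ∈ interior (sizedSimplex n d)
    · rw [Finset.sum_eq_single ⟨a, hai⟩]
      · rw [if_pos rfl, mul_one]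
      · intro x _ hx
        rw [if_neg fun e => hx (Subtype.ext e), mul_zero]
      · simp
    · have hnn := h.vertex_homCoord_nonneg hσ ha
      obtain ⟨i, hi⟩ : ∃ i, homCoord d a i = 0 := by
        by_contra hc
        push Not at hc
        exact hai ((toReal_mem_interior hn1).2 fun k => lt_of_le_of_ne (hnn k) (hc k).symm)
      rw [hg0 a i hnn hi]
      refine Finset.sum_eq_zero fun x _ => ?_
      rw [if_neg (fun e : x.1 = a => hai (e ▸ x.2)), mul_zero]
  -- Adding the spheres with coefficients `g` kills the edge cocycle without changing the function
  -- away from the spheres.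
  obtain ⟨c, hc⟩ := (hΨ.add_sum hind fun x => g x.1).constant hn1 hd h
    (fun σ hσ hcard => ⟨hcard, fun a _ => itenbergViro_primitive hn1 hd hσ hcard a⟩)
    (fun x hx => singleton_mem_itenbergViro hn1 hd hx) (by
      intro σ hσ a ha b hb
      rw [edgeSum_add_sum, hg σ hσ a ha b hb]
      have : ∀ x : InteriorPoint n d, edgeSum ε (pullback (ind x)) a b =
          (if x.1 = a then 1 else 0) + if x.1 = b then 1 else 0 := fun x =>
        h.edgeSum_rim (hu x) (sed_eq_bot_of_coord_pos hn1 hd x) hσ ha hb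
      simp only [this, mul_add, Finset.sum_add_distrib]
      rw [hdelta σ hσ a ha, hdelta σ hσ b hb, CharTwo.add_self_eq_zero])
  refine ⟨c, fun q hq hqS => ?_⟩
  obtain ⟨p, v, rfl⟩ := q.exists_mk
  obtain ⟨a, ha, b, hb, hab⟩ := (h.mk_mem_tHypersurface p v).1 hq
  have h1 := hc p.1 p.2 v ⟨a, ha, b, hb, hab⟩
  rw [Finset.sum_eq_zero, add_zero, pullback_apply Φ p.2] at h1
  · exact h1
  · intro x _
    rw [pullback_apply _ p.2]
    have : ind x (RealLocus.mk p v) = 0 := if_neg (hqS x)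
    rw [show (⟨p.1, p.2⟩ : sizedSimplex n d) = p from rfl, this, mul_zero]

/-- The balls around distinct interior vertices are disjoint. -/
theorem disjoint_caps (hn : 2 ≤ n) (hd : 1 ≤ d) {ε : (Fin n → ℤ) → ZMod 2}
    {u : InteriorPoint n d → Fin n → ZMod 2}
    (hu : ∀ x, Isolated (itenbergViro n d) ε x.1 (u x)) {x y : InteriorPoint n d} (hxy : x ≠ y) :
    Disjoint (overQuadrant (cap (sizedSimplex n d) (itenbergViro n d) x.1) (u x))
      (overQuadrant (cap (sizedSimplex n d) (itenbergViro n d) y.1) (u y)) := by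
  have hn1 : 1 ≤ n := by omega
  have h := itenbergViro_isTri hn1 hd
  rw [Set.disjoint_left]
  rintro _ ⟨p, hpx, rfl⟩ hpy
  obtain ⟨hpy, huv⟩ := (mk_mem_overQuadrant fun p hp => sed_eq_bot_of_coord_pos hn1 hd y p
    (h.coord_pos_of_mem_peak p.2 hp)).1 hpy
  obtain ⟨σ, hσ, hs, hc⟩ := h.pure hd (h.supp_mem p.2)
  have hx : x.1 ∈ σ := hs (peak_subset _ _ hpx)
  have hy : y.1 ∈ σ := hs (peak_subset _ _ hpy)
  have hne : x.1 ≠ y.1 := fun e => hxy (Subtype.ext e)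
  -- A third vertex exists since `n + 1 ≥ 3`. If the two quadrants agreed, `x`, `y` and `z` would
  -- have pairwise opposite signs, which is impossible with two signs.
  obtain ⟨z, hz, hzx, hzy⟩ : ∃ z ∈ σ, z ≠ x.1 ∧ z ≠ y.1 := by
    have hcard : 0 < ((σ.erase x.1).erase y.1).card := by
      rw [Finset.card_erase_of_mem (Finset.mem_erase.2 ⟨hne.symm, hy⟩),
        Finset.card_erase_of_mem hx]
      omega
    obtain ⟨z, hz⟩ := Finset.card_pos.1 hcard
    simp only [Finset.mem_erase] at hz
    exact ⟨z, hz.2.2, hz.2.1, hz.1⟩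
  have h1 := hu x σ hσ hx z hz hzx
  have h2 := hu y σ hσ hy z hz hzy
  have h3 := hu x σ hσ hx y.1 hy hne.symm
  rw [← huv] at h2
  have h4 := edgeSign_add ε x.1 y.1 z (u x)
  rw [edgeSign, edgeSign, edgeSign, h1, h2, h3] at h4
  exact absurd h4 (by decide)

theorem disjoint_toricDivisor (hn : 1 ≤ n) (hd : 1 ≤ d) (x : InteriorPoint n d)
    (v : Fin n → ZMod 2) (i : Fin (n + 1)) :
    Disjoint (overQuadrant (rim (sizedSimplex n d) (itenbergViro n d) x.1) v)
      (toricDivisor n d i) := by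
  have h := itenbergViro_isTri hn hd
  rw [Set.disjoint_left]
  rintro _ ⟨p, hp, rfl⟩ ⟨q, w, hq, he⟩
  obtain ⟨rfl, -⟩ := RealLocus.mk_eq_mk.1 he
  have := h.mem_interior_of_coord_pos hn x.2 p.2 (h.coord_pos_of_mem_peak p.2 hp.1)
  rw [mem_interior_sizedSimplex hn] at this
  exact (this i).ne' hq

/-- A T-hypersurface meets all the toric divisors. -/
theorem tHypersurface_inter_toricDivisor (hn : 2 ≤ n) (hd : 1 ≤ d) (ε : (Fin n → ℤ) → ZMod 2)
    (i : Fin (n + 1)) :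
    (tHypersurface (sizedSimplex n d) (itenbergViro n d) ε ∩ toricDivisor n d i).Nonempty := by
  classical
  have hn1 : 1 ≤ n := by omega
  have h := itenbergViro_isTri hn1 hd
  obtain ⟨j, hj⟩ : ∃ j, j ≠ i := by
    have : Nontrivial (Fin (n + 1)) := Fin.nontrivial_iff_two_le.2 (by omega)
    exact exists_ne i
  have hp := isPoint_single d j
  have e := homCoord_tail (d := d) (X := (Pi.single j (d : ℤ) : Fin (n + 1) → ℤ))
    (by exact_mod_cast hp.2)
  have hJ : (Finset.univ.erase i : Finset (Fin (n + 1))).card = n := by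
    rw [Finset.card_erase_of_mem (Finset.mem_univ _), Finset.card_univ, Fintype.card_fin]
    rfl
  obtain ⟨τ, hτ, -, hτi, hτc⟩ := h.exists_extension hd (Finset.univ.erase i) n
    {fun k => (Pi.single j (d : ℤ) : Fin (n + 1) → ℤ) k.succ}
    (singleton_mem_itenbergViro hn1 hd fun k => by rw [e]; exact hp.1 k)
    (fun a ha k hk => by
      obtain rfl : k = i := by
        by_contra hne
        exact hk (Finset.mem_erase.2 ⟨hne, Finset.mem_univ _⟩)
      rw [Finset.mem_singleton.1 ha, e, Pi.single_eq_of_ne hj.symm]) (by omega)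
  obtain ⟨a, ha, b, hb, hab⟩ := Finset.one_lt_card.1 (show 1 < τ.card by omega)
  obtain ⟨σ, hσ, hτσ, hc⟩ := h.pure hd hτ
  have hU : IsUnimodular σ := ⟨hc, fun a _ => itenbergViro_primitive hn1 hd hσ hc a⟩
  -- The auxiliary distribution is chosen so that the edge `{a, b}`, lying in the facet `i`, carries
  -- the value `1` in the quadrant `v`.
  obtain ⟨v, hv⟩ := hU.exists_quadrant fun y => if y = b then 1 + ε a + ε b else 0
  have hv' := hv a (hτσ ha) b (hτσ hb)
  rw [if_pos rfl, if_neg hab, sub_zero] at hv'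
  have hpair : {a, b} ∈ itenbergViro n d := h.down_closed τ hτ _
    (Finset.insert_subset ha (Finset.singleton_subset_iff.2 hb)) ⟨a, by simp⟩
  have hm := h.barycentre_mem hpair
  refine ⟨RealLocus.mk ⟨barycentre {a, b}, hm⟩ v, ?_, ⟨_, hm⟩, v, ?_, rfl⟩
  · rw [h.mk_mem_tHypersurface]
    refine ⟨a, ?_, b, ?_, ?_⟩
    · change a ∈ peak _ (barycentre {a, b})
      rw [h.peak_barycentre hpair]; simp
    · change b ∈ peak _ (barycentre {a, b})
      rw [h.peak_barycentre hpair]; simp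
    · rw [hv']
      have dec : ∀ x y : ZMod 2, x + y + (1 + x + y) = 1 := by decide
      exact dec _ _
  · refine homCoord_barycentre_eq_zero ⟨a, by simp⟩ fun c hc => ?_
    simp only [Finset.mem_insert, Finset.mem_singleton] at hc
    rcases hc with rfl | rfl
    · exact hτi _ ha i (by simp)
    · exact hτi _ hb i (by simp)

/-- The complement of the spheres is a component of the T-hypersurface. -/
theorem isComponentOf_compl (hn : 2 ≤ n) (hd : 1 ≤ d) {ε : (Fin n → ℤ) → ZMod 2}
    {u : InteriorPoint n d → Fin n → ZMod 2}
    (hu : ∀ x, Isolated (itenbergViro n d) ε x.1 (u x)) :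
    IsComponentOf (tHypersurface (sizedSimplex n d) (itenbergViro n d) ε)
      (tHypersurface (sizedSimplex n d) (itenbergViro n d) ε \
        ⋃ x, overQuadrant (rim (sizedSimplex n d) (itenbergViro n d) x.1) (u x)) := by
  classical
  have hn1 : 1 ≤ n := by omega
  have h := itenbergViro_isTri hn1 hd
  set X := tHypersurface (sizedSimplex n d) (itenbergViro n d) ε
  have hS : ∀ x : InteriorPoint n d, IsComponentOf X
      (overQuadrant (rim (sizedSimplex n d) (itenbergViro n d) x.1) (u x)) := fun x =>
    h.isComponentOf_rim hn (singleton_mem_of_interior hn1 hd x) x.2 (hu x)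
      (sed_eq_bot_of_coord_pos hn1 hd x)
  -- A base point on a toric divisor is on none of the spheres. The indicator function of its
  -- component is then constant, equal to `1`, away from the spheres.
  obtain ⟨q, hqX, hq0⟩ := tHypersurface_inter_toricDivisor hn hd ε 0
  have hqS : ∀ x : InteriorPoint n d,
      q ∉ overQuadrant (rim (sizedSimplex n d) (itenbergViro n d) x.1) (u x) := fun x hx =>
    Set.disjoint_left.1 (disjoint_toricDivisor hn1 hd x (u x) 0) hx hq0
  obtain ⟨c, hc⟩ := constant_off_spheres hn hd hu
    (constOnPreconnected_component (X := X) ⟨q, hqX, rfl⟩)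
  have hq1 := hc q hqX hqS
  rw [if_pos (mem_connectedComponentIn hqX)] at hq1
  refine ⟨q, hqX, subset_antisymm ?_ ?_⟩
  · rintro y ⟨hy, hyS⟩
    have := hc y hy fun x hx => hyS (Set.mem_iUnion.2 ⟨x, hx⟩)
    by_contra hn
    rw [if_neg hn, ← hq1] at this
    exact zero_ne_one this
  · intro y hy
    refine ⟨connectedComponentIn_subset X q hy, fun hyS => ?_⟩
    obtain ⟨x, hx⟩ := Set.mem_iUnion.1 hyS
    have := constOnPreconnected_component (hS x) (connectedComponentIn X q)
      (connectedComponentIn_subset X q) isPreconnected_connectedComponentIn q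
      (mem_connectedComponentIn hqX) y hy
    beta_reduce at this
    rw [if_neg (hqS x), if_pos hx] at this
    exact zero_ne_one this

end Main

end THyp

/-! ### The main theorem -/

theorem mainTheorem4 (n d : ℕ) (hn : 2 ≤ n) (hd : 1 ≤ d) :
    THyp.IsPrimitiveTriangulation (THyp.sizedSimplex n d) (THyp.itenbergViro n d) ∧
    THyp.SimplyIntegrable (THyp.itenbergViro n d) ∧
    THyp.SolvesHarnackEquation (THyp.itenbergViro n d) (THyp.harnack n) ∧
    ∃ (S B : Fin (THyp.geometricGenus (THyp.sizedSimplex n d)) →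
        Set (THyp.RealLocus (THyp.sizedSimplex n d)))
      (C : Set (THyp.RealLocus (THyp.sizedSimplex n d))),
      THyp.tHypersurface (THyp.sizedSimplex n d) (THyp.itenbergViro n d) (THyp.harnack n) =
        C ∪ ⋃ k, S k ∧
      (∀ k, THyp.IsComponentOf
        (THyp.tHypersurface (THyp.sizedSimplex n d) (THyp.itenbergViro n d) (THyp.harnack n))
        (S k)) ∧
      (∀ k, THyp.IsSphereBounding n (S k) (B k)) ∧
      (∀ k l, k ≠ l → Disjoint (B k) (B l)) ∧
      (∀ k i, Disjoint (S k) (THyp.toricDivisor n d i)) ∧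
      THyp.IsComponentOf
        (THyp.tHypersurface (THyp.sizedSimplex n d) (THyp.itenbergViro n d) (THyp.harnack n)) C ∧
      (∀ i, (C ∩ THyp.toricDivisor n d i).Nonempty) := by
  open THyp in
  have hn1 : 1 ≤ n := by omega
  have h := itenbergViro_isTri hn1 hd
  obtain ⟨hρ, hsol⟩ := itenbergViro_solvesHarnackEquation hn hd
  refine ⟨itenbergViro_isPrimitiveTriangulation hn1 hd, ⟨hρ, _, hsol⟩, hsol, ?_⟩
  have hu : ∀ x : InteriorPoint n d, ∃ v, Isolated (itenbergViro n d) (harnack n) x.1 v := fun x =>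
    exists_isolated_harnack hn1 hd fun k => ((toReal_mem_interior hn1).1 x.2 k).ne'
  choose u hu using hu
  have := finite_interiorPoint hn1 hd
  let e : InteriorPoint n d ≃ Fin (geometricGenus (sizedSimplex n d)) := Finite.equivFin _
  let S : InteriorPoint n d → Set (RealLocus (sizedSimplex n d)) := fun x =>
    overQuadrant (rim (sizedSimplex n d) (itenbergViro n d) x.1) (u x)
  have hcomp : ∀ x, IsComponentOf
      (tHypersurface (sizedSimplex n d) (itenbergViro n d) (harnack n)) (S x) := fun x =>
    h.isComponentOf_rim hn (singleton_mem_of_interior hn1 hd x) x.2 (hu x)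
      (sed_eq_bot_of_coord_pos hn1 hd x)
  refine ⟨fun k => S (e.symm k),
    fun k => overQuadrant (cap (sizedSimplex n d) (itenbergViro n d) (e.symm k).1) (u (e.symm k)),
    tHypersurface (sizedSimplex n d) (itenbergViro n d) (harnack n) \ ⋃ x, S x,
    ?_, fun k => hcomp _, fun k => ?_, fun k l hkl => ?_, fun k i => ?_,
    isComponentOf_compl hn hd hu, fun i => ?_⟩
  · rw [e.symm.surjective.iUnion_comp S, Set.sdiff_union_of_subset]
    refine Set.iUnion_subset fun x => ?_
    obtain ⟨q, -, hq⟩ := hcomp x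
    rw [hq]
    exact connectedComponentIn_subset _ _
  · exact h.isSphereBounding (singleton_mem_of_interior hn1 hd _) (e.symm k).2
      (fun p hp => sed_eq_bot_of_coord_pos hn1 hd _ p (h.coord_pos_of_mem_peak p.2 hp)) _
  · exact disjoint_caps hn hd hu fun he => hkl (e.symm.injective he)
  · exact disjoint_toricDivisor hn1 hd _ _ i
  · obtain ⟨q, hqX, hqi⟩ := tHypersurface_inter_toricDivisor hn hd (harnack n) i
    refine ⟨q, ⟨hqX, fun hqS => ?_⟩, hqi⟩
    obtain ⟨x, hx⟩ := Set.mem_iUnion.1 hqS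
    exact Set.disjoint_left.1 (disjoint_toricDivisor hn1 hd x (u x) i) hx hqi
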